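/- **Setting.** Let $\mathbb G$ be a Carnot group: a finite-dimensional stratified real Lie algebra $\mathfrak g=V_1\oplus\dots\oplus V_s$ (with $[V_1,V_j]=V_{j+1}$), endowed with the group law given by the Baker–Campbell–Hausdorff formula, with the dilations $\delta_\lambda$ ($\delta_\lambda v=\lambda^j v$ for $v\in V_j$, $\lambda>0$), and with a distance $\rho$ that is left-invariant and satisfies $\rho(\delta_\lambda x,\delta_\lambda y)=\lambda\rho(x,y)$. A subgroup $\mathbb P$ is homogeneous if $\delta_\lambda\mathbb P=\mathbb P$ for all $\lambda>0$; its homogeneous dimension is the number $d$ with $(\delta_\lambda)_\#\theta=\lambda^{-d}\theta$ for all $\lambda>0$, where $\theta$ is a Haar measure of $\mathbb P$. Two homogeneous subgroups $\mathbb W,\mathbb V$ are complementary if $\mathbb G=\mathbb W\mathbb V$ and $\mathbb W\cap\mathbb V=\{0\}$; if moreover $\mathbb W$ is normal, $\mathbb G=\mathbb W\cdot\mathbb V$ is called a splitting, and $\mathbb W$ is said to split $\mathbb G$. The measure $\psi^d$ is either the Hausdorff measure (coverings by sets $E_j$ of small diameter, with weights $(\operatorname{diam}E_j)^d$) or the spherical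 measure (coverings by closed balls of $\mathbb G$ of small radii $r_j$, with weights $(2r_j)^d$) of $(\mathbb G,\rho)$, without normalization constants. A map $f:\Omega\to\mathbb G'$ from an open set $\Omega\subset\mathbb G$ to a Carnot group is of class $C^1_H$ if at every $p\in\Omega$ it has a Pansu differential $D_Hf_p$, i.e. a homogeneous morphism $L$ with $\rho'(f(p)^{-1}f(x),L(p^{-1}x))/\rho(p,x)\to0$ as $x\to p$, and $p\mapsto D_Hf_p$ is continuous. A set $\Sigma\subset\mathbb G$ is a $C^1_H$ submanifold if there is a Carnot group $\mathbb G'$ such that every $p\in\Sigma$ has an open neighbourhood $\Omega$ and a map $f\in C^1_H(\Omega;\mathbb G')$ with $\Sigma\cap\Omega=\{f=0\}$, $D_Hf_p$ surjective, and $\ker D_Hf_p$ splitting $\mathbb G$. Its homogeneous tangent subgroup at $p$ is $T^H_p\Sigma:=\ker D_Hf_p$ (it does not depend on $f$). Given a splitting $\mathbb G=\mathbb W\cdot\mathbb V$ and an open set $A\subset\mathbb W$, a map $\phi:A\to\mathbb V$ is of class $C^1_{\mathbb W,\mathbb V}(A)$ if its intrinsic graph $\Sigma=\{w\phi(w):w\in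 A\}$ is a $C^1_H$ submanifold and, for every $w\in A$, $T^H_{w\phi(w)}\Sigma$ is complementary to $\mathbb V$. **Theorem (Area formula).** Let $\mathbb G=\mathbb W\cdot\mathbb V$ be a splitting of a Carnot group with $\mathbb W$ normal, let $d$ be the homogeneous dimension of $\mathbb W$, and let $\psi^d$ be the Hausdorff or the spherical measure. There is a function $\mathcal A$, the area factor, which depends only on $(\mathbb G,\rho)$, $\mathbb W$, $\mathbb V$ and the choice of $\psi$, and is defined on the homogeneous subgroups $\mathbb P$ of $\mathbb G$ that are intrinsic graphs $\{w\phi_{\mathbb P}(w):w\in\mathbb W\}$ of maps $\phi_{\mathbb P}:\mathbb W\to\mathbb V$ (these include the subgroups $T^H_p\Sigma$ below), with the following properties. 1. $0<\mathcal A(\mathbb P)<\infty$ and, for $\Phi_{\mathbb P}(w):=w\phi_{\mathbb P}(w)$, $$\psi^d\llcorner\mathbb P=\mathcal A(\mathbb P)\,(\Phi_{\mathbb P})_\#(\psi^d\llcorner\mathbb W).$$ 2. $\mathcal A$ is continuous: for every $\mathbb P$ and every $\varepsilon>0$ there is $\delta>0$ such that $|\mathcal A(\mathbb P)-\mathcal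 A(\mathbb P')|<\varepsilon$ for every $\mathbb P'$ with $\rho(\phi_{\mathbb P}(w),\phi_{\mathbb P'}(w))<\delta$ for all $w$ in the projection to $\mathbb W$ (along $\mathbb V$) of the closed unit ball centered at $0$. 3. For every open set $A\subset\mathbb W$, every $\phi\in C^1_{\mathbb W,\mathbb V}(A)$ with intrinsic graph $\Sigma$, and every Borel function $h:\Sigma\to[0,+\infty)$, $$\int_\Sigma h\,d\psi^d=\int_A h(w\phi(w))\,\mathcal A\big(T^H_{w\phi(w)}\Sigma\big)\,d\psi^d(w).$$ -/

import Mathlib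

open MeasureTheory Topology Filter Set
open scoped ENNReal NNReal

namespace Carnot

universe u v

/-- The right-nested bracket `[a₁, [a₂, … [a_{k-1}, a_k] … ]]` of a list; a list with one entry
gives that entry. -/
def lieWord {𝔤 : Type u} [LieRing 𝔤] : List 𝔤 → 𝔤
  | [] => 0
  | [a] => a
  | a :: b :: l => ⁅a, lieWord (b :: l)⁆

/-- The Baker-Campbell-Hausdorff product (in Dynkin's form) on a Lie algebra that is nilpotent of
step at most `N`. The summation is over `1 ≤ n` and over the pairs `(rⱼ, sⱼ)`, `j = 1, …, n`, with
`rⱼ + sⱼ > 0`; the terms with `n > N`, `rⱼ > N` or `sⱼ > N` are iterated brackets of more than `N`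
elements, hence zero, and are left out. -/
noncomputable def bch {𝔤 : Type u} [LieRing 𝔤] [LieAlgebra ℝ 𝔤] (N : ℕ) (x y : 𝔤) : 𝔤 :=
  ∑ n ∈ Finset.Icc 1 N, ((-1 : ℝ) ^ (n - 1) / (n : ℝ)) •
    ∑ e : Fin n → Fin (N + 1) × Fin (N + 1) with
        ∀ j, 0 < ((e j).1 : ℕ) + ((e j).2 : ℕ),
      (((∑ j, (((e j).1 : ℕ) + ((e j).2 : ℕ))) *
        ∏ j, (Nat.factorial (e j).1 * Nat.factorial (e j).2) : ℕ) : ℝ)⁻¹ •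
      lieWord (List.ofFn fun j =>
        List.replicate ((e j).1 : ℕ) x ++ List.replicate ((e j).2 : ℕ) y).flatten

/-- A stratification `𝔤 = V₁ ⊕ … ⊕ V_s` of a real Lie algebra: `layer i` is `V_i` for
`1 ≤ i ≤ s`, and zero for the other indices. The zero algebra is stratified of step `0`. -/
structure Stratification (𝔤 : Type u) [LieRing 𝔤] [LieAlgebra ℝ 𝔤] where
  step : ℕ
  layer : ℕ → Submodule ℝ 𝔤
  isInternal : DirectSum.IsInternal layer
  layer_zero : layer 0 = ⊥
  layer_of_lt : ∀ i, step < i → layer i = ⊥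
  layer_step_ne_bot : 0 < step → layer step ≠ ⊥
  lie_mem : ∀ i j, ∀ x ∈ layer i, ∀ y ∈ layer j, ⁅x, y⁆ ∈ layer (i + j)
  span_lie : ∀ j, 1 ≤ j →
    Submodule.span ℝ {z : 𝔤 | ∃ x ∈ layer 1, ∃ y ∈ layer j, ⁅x, y⁆ = z} = layer (j + 1)

theorem Stratification.bijective {𝔤 : Type u} [LieRing 𝔤] [LieAlgebra ℝ 𝔤]
    (S : Stratification 𝔤) : Function.Bijective (DirectSum.coeLinearMap S.layer) :=
  S.isInternal

/-- The projection of `𝔤` onto its `i`-th layer along the other layers. -/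
noncomputable def Stratification.proj {𝔤 : Type u} [LieRing 𝔤] [LieAlgebra ℝ 𝔤]
    (S : Stratification 𝔤) (i : ℕ) : 𝔤 →ₗ[ℝ] 𝔤 :=
  (S.layer i).subtype ∘ₗ DirectSum.component ℝ ℕ (fun i => S.layer i) i ∘ₗ
    (LinearEquiv.ofBijective (DirectSum.coeLinearMap S.layer) S.bijective).symm.toLinearMap

/-- The dilation `δ_t`, which multiplies the elements of `V_i` by `t ^ i`. -/
noncomputable def Stratification.dilation {𝔤 : Type u} [LieRing 𝔤] [LieAlgebra ℝ 𝔤]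
    (S : Stratification 𝔤) (t : ℝ) : 𝔤 →ₗ[ℝ] 𝔤 :=
  ∑ i ∈ Finset.range (S.step + 1), t ^ i • S.proj i

/-- A Carnot group: a finite-dimensional real Lie algebra with a stratification, with the group
law that the Baker-Campbell-Hausdorff formula gives on it (so the group is identified with its Lie
algebra through the exponential map), and with a distance that is left-invariant and
`1`-homogeneous with respect to the dilations. -/
class CarnotGroup (G : Type u) extends LieRing G, LieAlgebra ℝ G, Group G, MetricSpace G where
  finiteDimensional : FiniteDimensional ℝ G
  strat : Stratification G
  mul_eq_bch : ∀ x y : G, x * y = bch strat.step x y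
  dist_mul_left' : ∀ g x y : G, dist (g * x) (g * y) = dist x y
  dist_dilation : ∀ t : ℝ, 0 < t → ∀ x y : G,
    dist (strat.dilation t x) (strat.dilation t y) = t * dist x y

/-- The dilations of a Carnot group. -/
noncomputable def dil {G : Type u} [CarnotGroup G] (t : ℝ) : G →ₗ[ℝ] G :=
  (CarnotGroup.strat (G := G)).dilation t

/-- Homogeneous morphisms: the morphisms of Lie algebras that map the `j`-th layer to the `j`-th
layer. -/
structure HomogeneousHom (G : Type u) (H : Type v) [CarnotGroup G] [CarnotGroup H]
    extends G →ₗ⁅ℝ⁆ H where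
  map_layer : ∀ j, ∀ x ∈ (CarnotGroup.strat (G := G)).layer j,
    toLieHom x ∈ (CarnotGroup.strat (G := H)).layer j

/-! ### Homogeneous subgroups and splittings -/

def IsHomogeneous {G : Type u} [CarnotGroup G] (P : Subgroup G) : Prop :=
  ∀ t : ℝ, 0 < t → (dil t : G → G) '' (P : Set G) = P

/-- `G = W V` and `W ∩ V` is trivial. -/
def Complementary {G : Type u} [CarnotGroup G] (W V : Subgroup G) : Prop :=
  (∀ g : G, ∃ w ∈ W, ∃ v ∈ V, g = w * v) ∧ W ⊓ V = ⊥

/-- The set of the homogeneous subgroups that are complementary to `V`. -/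
def complements {G : Type u} [CarnotGroup G] (V : Subgroup G) : Set (Subgroup G) :=
  {W | IsHomogeneous W ∧ Complementary W V}

/-- A splitting `G = W · V`: both subgroups are homogeneous, `W` is normal, and they are
complementary. -/
structure IsSplitting {G : Type u} [CarnotGroup G] (W V : Subgroup G) : Prop where
  normal : W.Normal
  homogeneous_left : IsHomogeneous W
  homogeneous_right : IsHomogeneous V
  complementary : Complementary W V

/-- `d` is the homogeneous dimension of `P`: the dilations multiply a Haar measure of `P` by
`(δ_t)_# θ = t ^ (-d) θ`. (Measures on `P` are viewed as measures on `G` supported on `P`.) -/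
def IsHomogeneousDimension {G : Type u} [CarnotGroup G] [MeasurableSpace G]
    (P : Subgroup G) (d : ℝ) : Prop :=
  ∃ θ : Measure P, θ.IsHaarMeasure ∧ ∀ t : ℝ, 0 < t →
    (θ.map (Subtype.val : P → G)).map (dil t : G → G) =
      ENNReal.ofReal (t ^ (-d)) • θ.map (Subtype.val : P → G)

/-! ### Hausdorff and spherical measures (without normalization constants) -/

/-- The spherical measure: countable coverings by closed balls `B` of small diameter, each one with
weight `(2 r) ^ d`, where `r` is the radius. A set that is not a closed ball has weight `∞`. -/
noncomputable def sphericalMeasure {X : Type u} [MetricSpace X] [MeasurableSpace X] [BorelSpace X]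
    (d : ℝ) : Measure X :=
  Measure.mkMetric' fun B : Set X =>
    ⨅ (x : X) (r : ℝ) (_ : 0 ≤ r) (_ : B = Metric.closedBall x r), ENNReal.ofReal (2 * r) ^ d

inductive MeasureKind
  | hausdorff
  | spherical

/-- `ψ^d`: either the Hausdorff or the spherical measure of dimension `d`. -/
noncomputable def psi {X : Type u} [MetricSpace X] [MeasurableSpace X] [BorelSpace X]
    (k : MeasureKind) (d : ℝ) : Measure X :=
  match k with
  | .hausdorff => Measure.hausdorffMeasure d
  | .spherical => sphericalMeasure d

/-! ### Pansu differentials, submanifolds, tangent subgroups -/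

/-- `L` is the Pansu differential of `f` at `p`. -/
def HasPansuDifferentialAt {G : Type u} {H : Type v} [CarnotGroup G] [CarnotGroup H]
    (f : G → H) (L : HomogeneousHom G H) (p : G) : Prop :=
  Tendsto (fun x => dist ((f p)⁻¹ * f x) (L.toLieHom (p⁻¹ * x)) / dist p x) (𝓝[≠] p) (𝓝 0)

/-- `f` is of class `C¹_H` on `Ω`: it has a Pansu differential at every point of `Ω`, and the
differential is continuous for the distance
`d(L, M) = sup {dist (L x) (M x) / ‖x‖ : x ≠ 0}` between homogeneous morphisms. -/
def IsC1H {G : Type u} {H : Type v} [CarnotGroup G] [CarnotGroup H]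
    (f : G → H) (Ω : Set G) : Prop :=
  ∃ D : G → HomogeneousHom G H,
    (∀ p ∈ Ω, HasPansuDifferentialAt f (D p) p) ∧
    ∀ p ∈ Ω, ∀ ε > 0, ∃ δ > 0, ∀ q ∈ Ω, dist q p < δ →
      ∀ x : G, dist ((D q).toLieHom x) ((D p).toLieHom x) ≤ ε * dist 0 x

/-- `p` is split-regular for `f`, and `T` is the kernel of the Pansu differential of `f` at `p`:
the differential is surjective and its kernel `T` splits `G`. -/
def IsSplitRegularAt {G : Type u} {H : Type v} [CarnotGroup G] [CarnotGroup H]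
    (f : G → H) (p : G) (T : Subgroup G) : Prop :=
  ∃ L : HomogeneousHom G H, HasPansuDifferentialAt f L p ∧ Function.Surjective L.toLieHom ∧
    (T : Set G) = {x | L.toLieHom x = 0} ∧ ∃ V : Subgroup G, IsSplitting T V

/-- In a neighbourhood of `p`, the set `S` is the zero level set of a `C¹_H` map `f` with values
in `H`, for which `p` is split-regular, and `T` is the kernel of the differential of `f` at `p`. -/
def IsLevelSetNear {G : Type u} [CarnotGroup G] (H : Type v) [CarnotGroup H]
    (S : Set G) (p : G) (T : Subgroup G) : Prop :=
  ∃ (Ω : Set G) (f : G → H), IsOpen Ω ∧ p ∈ Ω ∧ IsC1H f Ω ∧ IsSplitRegularAt f p T ∧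
    S ∩ Ω = {x ∈ Ω | f x = 0}

/-- Submanifolds of class `C¹_H`. -/
def IsC1HSubmanifold {G : Type u} [CarnotGroup G] (S : Set G) : Prop :=
  ∃ (H : Type u) (_ : CarnotGroup H), ∀ p ∈ S, ∃ T : Subgroup G, IsLevelSetNear H S p T

open Classical in
/-- The homogeneous tangent subgroup of `S` at `p`: the kernel of the Pansu differential at `p` of
a map that defines `S` near `p`. (All such maps have the same kernel; the trivial subgroup is a
default value where there is no such map.) -/
noncomputable def tangentSubgroup {G : Type u} [CarnotGroup G] (S : Set G) (p : G) : Subgroup G :=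
  if h : ∃ (T : Subgroup G) (H : Type u) (_ : CarnotGroup H), p ∈ S ∧ IsLevelSetNear H S p T then
    h.choose
  else ⊥

/-! ### Intrinsic graphs -/

/-- The graph map `w ↦ w φ(w)`. -/
def graphMap {G : Type u} [CarnotGroup G] {W V : Subgroup G} {A : Set W} (φ : A → V) (w : A) : G :=
  ((w : W) : G) * (φ w : G)

/-- The intrinsic graph `{w φ(w) : w ∈ A}`. -/
def intrinsicGraph {G : Type u} [CarnotGroup G] {W V : Subgroup G} {A : Set W} (φ : A → V) :
    Set G :=
  range (graphMap φ)

/-- The class `C¹_{W,V}(A)`. -/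
def IsC1WV {G : Type u} [CarnotGroup G] {W V : Subgroup G} {A : Set W} (φ : A → V) : Prop :=
  IsC1HSubmanifold (intrinsicGraph φ) ∧
    ∀ w : A, tangentSubgroup (intrinsicGraph φ) (graphMap φ w) ∈ complements V

/-- The homogeneous subgroup `P` is the intrinsic graph of the map `φ` defined on all of `W`. -/
def IsHomogeneousGraph {G : Type u} [CarnotGroup G] {W V : Subgroup G} (P : Subgroup G)
    (φ : W → V) : Prop :=
  IsHomogeneous P ∧ (P : Set G) = range fun w : W => (w : G) * (φ w : G)

/-- `𝒜` is the area factor of the splitting `W · V`: if the homogeneous subgroup `P` is the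
intrinsic graph of `φ : W → V`, with graph map `Φ`, then `𝒜 P` is positive and
`ψ^d ⌞ P = 𝒜 P • Φ_# (ψ^d ⌞ W)`. -/
def IsAreaFactor {G : Type u} [CarnotGroup G] [MeasurableSpace G] [BorelSpace G]
    (k : MeasureKind) (d : ℝ) (W V : Subgroup G) (𝒜 : Subgroup G → ℝ≥0) : Prop :=
  ∀ (P : Subgroup G) (φ : W → V), IsHomogeneousGraph P φ →
    0 < 𝒜 P ∧
    (psi k d).restrict (P : Set G) =
      (𝒜 P : ℝ≥0∞) • ((psi k d).comap (Subtype.val : W → G)).map fun w : W => (w : G) * (φ w : G)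

/-- `𝒜` is continuous on the set of the homogeneous subgroups `P` that are intrinsic graphs of maps
`φ_P : W → V`; the topology is that of the uniform convergence of `φ_P` on the projection to `W`
(along `V`) of the closed unit ball, i.e., since the maps commute with dilations, that of the
uniform convergence on bounded sets. -/
def IsContinuousOnGraphs {G : Type u} [CarnotGroup G]
    (W V : Subgroup G) (𝒜 : Subgroup G → ℝ≥0) : Prop :=
  ∀ (P : Subgroup G) (φ : W → V), IsHomogeneousGraph P φ →
    ∀ ε > 0, ∃ δ > 0, ∀ (P' : Subgroup G) (φ' : W → V), IsHomogeneousGraph P' φ' →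
      (∀ w : W, (∃ v ∈ V, (w : G) * v ∈ Metric.closedBall (0 : G) 1) →
        dist (φ w : G) (φ' w : G) < δ) →
      dist (𝒜 P) (𝒜 P') < ε

end Carnot

/-!
Fix a Haar measure `τ` of `W`, and let `π : G → W` be the projection along `V`. A set `S` on which
`π` is injective carries the measure `μ B = τ (π (B ∩ S))`. If `S` is a homogeneous subgroup `P`,
then, by invariance and homogeneity, the density of `μ` with respect to `ψ^d` is the same at every
point of `P`: it is the supremum of the ratios `τ (π (E ∩ P)) / s ^ d` over the sets `E` meeting `P`
that enter the coverings defining `ψ^d` with weight `s ^ d`. The area factor of `P` is the quotient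
of this constant for `W` by the one for `P`.

At a point `p` of a `C¹_H` graph `Σ` the blow-ups of `Σ` converge to the tangent subgroup `T`, and
left translations of `G` act on the fibres of `π` by maps that preserve `τ`. The density of `μ` at
`p` is therefore at most the constant of `T`, and it is equal to it as soon as the projections of
small balls around `p` are covered, up to a vanishing fraction, by the projection of `Σ`. Let `Z` be
the set of the points where this fails. The measure `τ` restricted to the complement of `π Σ`
vanishes on `π Z`, but at the points of `Z` it charges the projections of small balls of radius `s`
with at least a multiple of `s ^ d`. Since `Σ` satisfies a cone condition over `W`, balls centred on
`Z` whose projections meet are close to each other in `G`, and a covering argument in the style of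
Vitali shows that `ψ^d Z = 0`. Federer's differentiation theorem for `ψ^d` now recovers `μ` from its
density, and this is the area formula.
-/

namespace Carnot

universe u v

/-! ### Stratified Lie algebras -/

namespace Stratification

variable {𝔤 : Type u} [LieRing 𝔤] [LieAlgebra ℝ 𝔤] (S : Stratification 𝔤)

theorem proj_mem (i : ℕ) (x : 𝔤) : S.proj i x ∈ S.layer i :=
  Subtype.property _

theorem proj_apply_of_mem {i : ℕ} {x : 𝔤} (hx : x ∈ S.layer i) (j : ℕ) :
    S.proj j x = if j = i then x else 0 := by
  have h : (LinearEquiv.ofBijective (DirectSum.coeLinearMap S.layer) S.bijective).symm x =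
      DirectSum.lof ℝ ℕ (fun i => S.layer i) i ⟨x, hx⟩ := by
    rw [LinearEquiv.symm_apply_eq]
    simp
  simp only [proj, LinearMap.comp_apply, LinearEquiv.coe_coe, h]
  split_ifs with hij
  · subst hij
    simp [DirectSum.component.lof_self]
  · rw [DirectSum.component.of, dif_neg (fun h => hij h.symm)]
    simp

theorem proj_of_ne {i j : ℕ} (h : j ≠ i) {x : 𝔤} (hx : x ∈ S.layer i) : S.proj j x = 0 := by
  rw [S.proj_apply_of_mem hx, if_neg h]

theorem eq_zero_of_mem_layer_of_step_lt {i : ℕ} (hi : S.step < i) {x : 𝔤} (hx : x ∈ S.layer i) :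
    x = 0 := by
  rwa [S.layer_of_lt i hi, Submodule.mem_bot] at hx

theorem induction_on {p : 𝔤 → Prop} (x : 𝔤) (zero : p 0) (layer : ∀ i, ∀ y ∈ S.layer i, p y)
    (add : ∀ y z, p y → p z → p (y + z)) : p x := by
  obtain ⟨y, rfl⟩ := S.bijective.2 x
  induction y using DirectSum.induction_on with
  | zero => simpa using zero
  | of i y => simpa using layer i _ y.2
  | add y z hy hz => simpa using add _ _ hy hz

theorem linearMap_ext {M : Type*} [AddCommGroup M] [Module ℝ M] {f g : 𝔤 →ₗ[ℝ] M}
    (h : ∀ i, ∀ x ∈ S.layer i, f x = g x) : f = g := by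
  ext x
  induction x using S.induction_on with
  | zero => rw [map_zero, map_zero]
  | layer i x hx => exact h i x hx
  | add x y hx hy => rw [map_add, map_add, hx, hy]

theorem sum_proj (x : 𝔤) : ∑ i ∈ Finset.range (S.step + 1), S.proj i x = x := by
  suffices h : ∑ i ∈ Finset.range (S.step + 1), S.proj i = LinearMap.id by
    simpa using LinearMap.congr_fun h x
  refine S.linearMap_ext fun i y hy => ?_
  simp only [LinearMap.sum_apply, S.proj_apply_of_mem hy, Finset.sum_ite_eq', Finset.mem_range,
    LinearMap.id_apply, ite_eq_left_iff]
  exact fun h => (S.eq_zero_of_mem_layer_of_step_lt (by lia) hy).symm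

theorem dilation_of_mem (t : ℝ) {i : ℕ} {x : 𝔤} (hx : x ∈ S.layer i) :
    S.dilation t x = t ^ i • x := by
  simp only [dilation, LinearMap.sum_apply, LinearMap.smul_apply, S.proj_apply_of_mem hx,
    smul_ite, smul_zero, Finset.sum_ite_eq', Finset.mem_range, ite_eq_left_iff]
  intro h
  rw [S.eq_zero_of_mem_layer_of_step_lt (by lia) hx, smul_zero]

theorem dilation_lie (t : ℝ) (x y : 𝔤) :
    S.dilation t ⁅x, y⁆ = ⁅S.dilation t x, S.dilation t y⁆ := by
  induction x using S.induction_on with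
  | zero => simp
  | add a b ha hb => simp only [add_lie, map_add, ha, hb]
  | layer i a ha =>
    induction y using S.induction_on with
    | zero => simp
    | add b c hb hc => simp only [lie_add, map_add, hb, hc]
    | layer j b hb =>
      rw [S.dilation_of_mem t ha, S.dilation_of_mem t hb,
        S.dilation_of_mem t (S.lie_mem i j a ha b hb), lie_smul, smul_lie, smul_smul, pow_add,
        mul_comm]

theorem dilation_comp_dilation (s t : ℝ) :
    S.dilation s ∘ₗ S.dilation t = S.dilation (s * t) := by
  refine S.linearMap_ext fun i a ha => ?_
  rw [LinearMap.comp_apply, S.dilation_of_mem t ha, map_smul, S.dilation_of_mem s ha,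
    S.dilation_of_mem _ ha, smul_smul, mul_pow, mul_comm]

theorem dilation_one : S.dilation 1 = LinearMap.id :=
  S.linearMap_ext fun i a ha => by
    rw [S.dilation_of_mem 1 ha, one_pow, one_smul, LinearMap.id_apply]

theorem dilation_zero : S.dilation 0 = 0 := by
  refine S.linearMap_ext fun i a ha => ?_
  rw [S.dilation_of_mem 0 ha, LinearMap.zero_apply]
  rcases Nat.eq_zero_or_pos i with rfl | hi
  · rw [S.layer_zero, Submodule.mem_bot] at ha
    rw [ha, smul_zero]
  · rw [zero_pow hi.ne', zero_smul]

theorem proj_dilation (t : ℝ) (k : ℕ) (x : 𝔤) :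
    S.proj k (S.dilation t x) = t ^ k • S.proj k x := by
  suffices h : S.proj k ∘ₗ S.dilation t = t ^ k • S.proj k from LinearMap.congr_fun h x
  refine S.linearMap_ext fun i a ha => ?_
  rw [LinearMap.comp_apply, S.dilation_of_mem t ha, map_smul, LinearMap.smul_apply]
  rcases eq_or_ne k i with rfl | h
  · rfl
  · rw [S.proj_of_ne h ha, smul_zero, smul_zero]

/-- The filtration `V_k ⊕ V_{k+1} ⊕ … ⊕ V_s` of a stratified Lie algebra (all of it for `k ≤ 1`),
described as the set of the elements whose components in the layers before the `k`-th one
vanish. -/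
noncomputable def filtration (k : ℕ) : Submodule ℝ 𝔤 :=
  ⨅ i : Fin k, LinearMap.ker (S.proj i)

theorem mem_filtration {k : ℕ} {x : 𝔤} : x ∈ S.filtration k ↔ ∀ i < k, S.proj i x = 0 := by
  simp only [filtration, Submodule.mem_iInf, LinearMap.mem_ker]
  exact ⟨fun h i hi => h ⟨i, hi⟩, fun h i => h i i.2⟩

theorem filtration_antitone : Antitone S.filtration := fun _ _ h _ hx =>
  S.mem_filtration.2 fun i hi => S.mem_filtration.1 hx i (hi.trans_le h)

theorem layer_le_filtration {j k : ℕ} (h : k ≤ j) : S.layer j ≤ S.filtration k := fun _ hx =>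
  S.mem_filtration.2 fun _ hi => S.proj_of_ne (hi.trans_le h).ne hx

theorem filtration_one : S.filtration 1 = ⊤ := by
  refine eq_top_iff.2 fun x _ => S.mem_filtration.2 fun i hi => ?_
  have h := S.proj_mem i x
  rwa [Nat.lt_one_iff.1 hi, S.layer_zero, Submodule.mem_bot, ← Nat.lt_one_iff.1 hi] at h

theorem filtration_eq_bot {k : ℕ} (h : S.step < k) : S.filtration k = ⊥ := by
  refine eq_bot_iff.2 fun x hx => ?_
  rw [Submodule.mem_bot, ← S.sum_proj x]
  exact Finset.sum_eq_zero fun i hi =>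
    S.mem_filtration.1 hx i ((Finset.mem_range_succ_iff.1 hi).trans_lt h)

theorem sub_proj_mem_filtration {k : ℕ} {x : 𝔤} (hx : x ∈ S.filtration k) :
    x - S.proj k x ∈ S.filtration (k + 1) := by
  refine S.mem_filtration.2 fun i hi => ?_
  rw [map_sub, S.proj_apply_of_mem (S.proj_mem k x)]
  split_ifs with h
  · rw [h, sub_self]
  · rw [S.mem_filtration.1 hx i (by lia), sub_zero]

theorem lie_mem_filtration {j k : ℕ} {x y : 𝔤} (hx : x ∈ S.filtration j)
    (hy : y ∈ S.filtration k) : ⁅x, y⁆ ∈ S.filtration (j + k) := by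
  rw [← S.sum_proj x, ← S.sum_proj y, sum_lie_sum]
  refine Submodule.sum_mem _ fun a _ => Submodule.sum_mem _ fun b _ => ?_
  by_cases ha : a < j
  · simp [S.mem_filtration.1 hx a ha]
  by_cases hb : b < k
  · simp [S.mem_filtration.1 hy b hb]
  exact S.layer_le_filtration (by lia) (S.lie_mem a b _ (S.proj_mem a x) _ (S.proj_mem b y))

theorem dilation_mem_filtration (t : ℝ) {k : ℕ} {x : 𝔤} (hx : x ∈ S.filtration k) :
    S.dilation t x ∈ S.filtration k :=
  S.mem_filtration.2 fun i hi => by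
    rw [S.proj_dilation, S.mem_filtration.1 hx i hi, smul_zero]

end Stratification

/-! ### The Baker-Campbell-Hausdorff product -/

section BakerCampbellHausdorff

section Words

variable {𝔤 : Type u} [LieRing 𝔤]

theorem lieWord_cons {a : 𝔤} {l : List 𝔤} (hl : l ≠ []) : lieWord (a :: l) = ⁅a, lieWord l⁆ := by
  cases l with
  | nil => exact absurd rfl hl
  | cons b l => rfl

theorem map_lieWord {𝔥 : Type v} [LieRing 𝔥] (f : 𝔤 → 𝔥) (h0 : f 0 = 0)
    (hf : ∀ x y, f ⁅x, y⁆ = ⁅f x, f y⁆) (l : List 𝔤) : f (lieWord l) = lieWord (l.map f) := by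
  induction l with
  | nil => exact h0
  | cons a l ih =>
    cases l with
    | nil => rfl
    | cons b l =>
      rw [lieWord_cons (List.cons_ne_nil b l), hf, ih]
      rfl

theorem lieWord_mem {I : AddSubgroup 𝔤} {x y : 𝔤} (hx : ∀ z ∈ I, ⁅x, z⁆ ∈ I)
    (hy : ∀ z ∈ I, ⁅y, z⁆ ∈ I) (hxy : ⁅x, y⁆ ∈ I) {l : List 𝔤} (hl : ∀ a ∈ l, a = x ∨ a = y)
    (h2 : 2 ≤ l.length) : lieWord l ∈ I := by
  induction l with
  | nil => simp at h2
  | cons a l ih =>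
    match l, ih, h2 with
    | [b], _, _ =>
      have hyx : ⁅y, x⁆ ∈ I := by
        rw [← lie_skew]
        exact I.neg_mem hxy
      rcases hl a (by simp) with rfl | rfl <;> rcases hl b (by simp) with rfl | rfl <;>
        simp_all [lieWord]
    | b :: c :: l, ih, _ =>
      have h := ih (fun a ha => hl a (List.mem_cons_of_mem _ ha)) (by simp)
      rw [lieWord_cons (List.cons_ne_nil _ _)]
      rcases hl a List.mem_cons_self with rfl | rfl
      · exact hx _ h
      · exact hy _ h

end Words

/-- The word `x^{r₁} y^{s₁} ⋯ x^{rₙ} y^{sₙ}`, with `(rⱼ, sⱼ) = e j`, whose iterated bracket is a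
term of Dynkin's formula. -/
def dynkinWord {α : Type*} {N n : ℕ} (e : Fin n → Fin (N + 1) × Fin (N + 1)) (x y : α) : List α :=
  (List.ofFn fun j =>
    List.replicate ((e j).1 : ℕ) x ++ List.replicate ((e j).2 : ℕ) y).flatten

section DynkinWord

variable {α β : Type*} {N n : ℕ} {e : Fin n → Fin (N + 1) × Fin (N + 1)} {x y a : α}

theorem eq_or_eq_of_mem_dynkinWord (h : a ∈ dynkinWord e x y) : a = x ∨ a = y := by
  simp only [dynkinWord, List.mem_flatten, List.mem_ofFn] at h
  obtain ⟨_, ⟨j, rfl⟩, h⟩ := h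
  simp only [List.mem_append, List.mem_replicate] at h
  tauto

theorem length_dynkinWord : (dynkinWord e x y).length = ∑ j, (((e j).1 : ℕ) + ((e j).2 : ℕ)) := by
  simp [dynkinWord, List.length_flatten, List.map_ofFn, List.sum_ofFn, Function.comp_def]

theorem map_dynkinWord (f : α → β) : (dynkinWord e x y).map f = dynkinWord e (f x) (f y) := by
  simp [dynkinWord, List.map_flatten, List.map_ofFn, Function.comp_def]

end DynkinWord

variable {𝔤 : Type u} [LieRing 𝔤] [LieAlgebra ℝ 𝔤]

/-- The sum of the terms of Dynkin's formula that have `n` pairs of exponents, without the factor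
`(-1)^{n-1} / n`. -/
noncomputable def dynkinSum (N n : ℕ) (x y : 𝔤) : 𝔤 :=
  ∑ e : Fin n → Fin (N + 1) × Fin (N + 1) with ∀ j, 0 < ((e j).1 : ℕ) + ((e j).2 : ℕ),
    (((∑ j, (((e j).1 : ℕ) + ((e j).2 : ℕ))) *
      ∏ j, (Nat.factorial (e j).1 * Nat.factorial (e j).2) : ℕ) : ℝ)⁻¹ • lieWord (dynkinWord e x y)

theorem bch_eq_sum_dynkinSum (N : ℕ) (x y : 𝔤) :
    bch N x y = ∑ n ∈ Finset.Icc 1 N, ((-1 : ℝ) ^ (n - 1) / (n : ℝ)) • dynkinSum N n x y :=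
  rfl

theorem map_bch (f : 𝔤 →ₗ[ℝ] 𝔤) (hf : ∀ x y, f ⁅x, y⁆ = ⁅f x, f y⁆) (N : ℕ) (x y : 𝔤) :
    f (bch N x y) = bch N (f x) (f y) := by
  simp only [bch_eq_sum_dynkinSum, dynkinSum, map_sum, map_smul, map_lieWord f (map_zero f) hf,
    map_dynkinWord]

section Remainder

variable {I : Submodule ℝ 𝔤} {x y : 𝔤}

theorem lieWord_dynkinWord_mem (hx : ∀ z ∈ I, ⁅x, z⁆ ∈ I) (hy : ∀ z ∈ I, ⁅y, z⁆ ∈ I)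
    (hxy : ⁅x, y⁆ ∈ I) {N n : ℕ} {e : Fin n → Fin (N + 1) × Fin (N + 1)}
    (he : 2 ≤ ∑ j, (((e j).1 : ℕ) + ((e j).2 : ℕ))) : lieWord (dynkinWord e x y) ∈ I :=
  lieWord_mem (I := I.toAddSubgroup) hx hy hxy (fun _ => eq_or_eq_of_mem_dynkinWord)
    (by rwa [length_dynkinWord])

theorem dynkinSum_mem (hx : ∀ z ∈ I, ⁅x, z⁆ ∈ I) (hy : ∀ z ∈ I, ⁅y, z⁆ ∈ I) (hxy : ⁅x, y⁆ ∈ I)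
    (N : ℕ) {n : ℕ} (hn : 2 ≤ n) : dynkinSum N n x y ∈ I := by
  refine Submodule.sum_mem _ fun e he =>
    Submodule.smul_mem _ _ (lieWord_dynkinWord_mem hx hy hxy ?_)
  simp only [Finset.mem_filter, Finset.mem_univ, true_and] at he
  calc 2 ≤ ∑ j : Fin n, 1 := by simpa using hn
    _ ≤ _ := Finset.sum_le_sum fun j _ => he j

theorem dynkinSum_one_sub_add_mem (hx : ∀ z ∈ I, ⁅x, z⁆ ∈ I) (hy : ∀ z ∈ I, ⁅y, z⁆ ∈ I)
    (hxy : ⁅x, y⁆ ∈ I) {N : ℕ} (hN : 1 ≤ N) : dynkinSum N 1 x y - (x + y) ∈ I := by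
  have h1 : 1 < N + 1 := by lia
  let e₁ : Fin 1 → Fin (N + 1) × Fin (N + 1) := fun _ => (⟨1, h1⟩, 0)
  let e₂ : Fin 1 → Fin (N + 1) × Fin (N + 1) := fun _ => (0, ⟨1, h1⟩)
  have hne : e₁ ≠ e₂ := fun h => by simpa [e₁, e₂] using congrArg (fun e => (e 0).1.1) h
  rw [← Submodule.Quotient.mk_eq_zero, ← Submodule.mkQ_apply, map_sub, sub_eq_zero, dynkinSum,
    map_sum, Finset.sum_eq_add_of_mem e₁ e₂
      (Finset.mem_filter.2 ⟨Finset.mem_univ _, fun _ => Nat.zero_lt_one⟩)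
      (Finset.mem_filter.2 ⟨Finset.mem_univ _, fun _ => Nat.zero_lt_one⟩) hne]
  · simp [e₁, e₂, dynkinWord, lieWord]
  rintro e he ⟨hne₁, hne₂⟩
  rw [map_smul, Submodule.mkQ_apply, (Submodule.Quotient.mk_eq_zero I).2, smul_zero]
  refine lieWord_dynkinWord_mem hx hy hxy ?_
  simp only [Finset.mem_filter, Finset.mem_univ, true_and, Fin.forall_fin_one] at he
  by_contra! hlt
  rw [Fin.sum_univ_one] at hlt
  rcases Nat.add_eq_one_iff.1 (le_antisymm (Nat.lt_succ_iff.1 hlt) he) with ⟨ha, hb⟩ | ⟨ha, hb⟩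
  · refine hne₂ (funext fun j => ?_)
    rw [Subsingleton.elim j 0]
    exact Prod.ext (Fin.ext ha) (Fin.ext hb)
  · refine hne₁ (funext fun j => ?_)
    rw [Subsingleton.elim j 0]
    exact Prod.ext (Fin.ext ha) (Fin.ext hb)

theorem bch_sub_add_mem (hx : ∀ z ∈ I, ⁅x, z⁆ ∈ I) (hy : ∀ z ∈ I, ⁅y, z⁆ ∈ I) (hxy : ⁅x, y⁆ ∈ I)
    {N : ℕ} (hN : 1 ≤ N) : bch N x y - (x + y) ∈ I := by
  rw [bch_eq_sum_dynkinSum, ← Finset.add_sum_erase _ _ (Finset.mem_Icc.2 ⟨le_rfl, hN⟩),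
    add_sub_right_comm]
  refine I.add_mem (by simpa using dynkinSum_one_sub_add_mem hx hy hxy hN)
    (Submodule.sum_mem _ fun n hn => Submodule.smul_mem _ _ (dynkinSum_mem hx hy hxy N ?_))
  rw [Finset.mem_erase, Finset.mem_Icc] at hn
  lia

end Remainder

end BakerCampbellHausdorff

/-! ### Algebra of Carnot groups -/

section Algebra

variable {G : Type u} [CarnotGroup G]

/-- The stratification of the Lie algebra of a Carnot group, with the group as an explicit
argument. -/
abbrev str (G : Type u) [CarnotGroup G] : Stratification G := CarnotGroup.strat

theorem mul_sub_add_mem {I : Submodule ℝ G} {x y : G} (hx : ∀ z ∈ I, ⁅x, z⁆ ∈ I)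
    (hy : ∀ z ∈ I, ⁅y, z⁆ ∈ I) (hxy : ⁅x, y⁆ ∈ I) : x * y - (x + y) ∈ I := by
  rcases Nat.eq_zero_or_pos (str G).step with h | h
  · have htop : (⊤ : Submodule ℝ G) = ⊥ := by
      rw [← (str G).filtration_one, (str G).filtration_eq_bot (by lia)]
    exact (htop.le.trans bot_le : (⊤ : Submodule ℝ G) ≤ I) Submodule.mem_top
  · rw [CarnotGroup.mul_eq_bch]
    exact bch_sub_add_mem hx hy hxy h

theorem mul_sub_add_mem_filtration_of_lie_mem {k : ℕ} {x y : G}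
    (h : ⁅x, y⁆ ∈ (str G).filtration k) : x * y - (x + y) ∈ (str G).filtration k := by
  have h_ideal (x : G) : ∀ z ∈ (str G).filtration k, ⁅x, z⁆ ∈ (str G).filtration k := fun z hz =>
    (str G).filtration_antitone (Nat.le_add_left k 1)
      ((str G).lie_mem_filtration ((str G).filtration_one ▸ Submodule.mem_top) hz)
  exact mul_sub_add_mem (h_ideal x) (h_ideal y) h

theorem mul_sub_add_mem_filtration {i j k : ℕ} (hk : k ≤ i + j) {x y : G}
    (hx : x ∈ (str G).filtration i) (hy : y ∈ (str G).filtration j) :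
    x * y - (x + y) ∈ (str G).filtration k :=
  mul_sub_add_mem_filtration_of_lie_mem
    ((str G).filtration_antitone hk ((str G).lie_mem_filtration hx hy))

theorem mul_eq_add_of_lie_eq_zero {x y : G} (h : ⁅x, y⁆ = 0) : x * y = x + y := by
  have := mul_sub_add_mem (I := ⊥) (x := x) (y := y) (by simp) (by simp) (by simpa using h)
  rwa [Submodule.mem_bot, sub_eq_zero] at this

theorem one_eq_zero : (1 : G) = 0 := by
  have h : (0 : G) * 0 = 0 := by rw [mul_eq_add_of_lie_eq_zero (lie_self 0), add_zero]
  exact (mul_eq_left.1 h).symm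

theorem inv_eq_neg (x : G) : x⁻¹ = -x := by
  rw [inv_eq_iff_mul_eq_one, mul_eq_add_of_lie_eq_zero (by simp), one_eq_zero, add_neg_cancel]

theorem mul_self_eq (x : G) : x * x = (2 : ℝ) • x := by
  rw [mul_eq_add_of_lie_eq_zero (lie_self x), two_smul]

theorem inv_mul_mem_filtration {k : ℕ} (hk : 1 ≤ k) {p x : G} (hx : x ∈ (str G).filtration k)
    (hpx : x - p ∈ (str G).filtration (k + 1)) : p⁻¹ * x ∈ (str G).filtration (k + 1) := by
  have hp : -p ∈ (str G).filtration k := by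
    have := Submodule.sub_mem _ ((str G).filtration_antitone (Nat.le_succ k) hpx) hx
    rwa [sub_sub_cancel_left] at this
  have h := mul_sub_add_mem_filtration (add_le_add_right hk k) hp hx
  have := Submodule.add_mem _ h hpx
  rwa [sub_eq_add_neg x, add_comm x, sub_add_cancel, ← inv_eq_neg] at this

theorem inv_proj_mul_mem_filtration {k : ℕ} (hk : 1 ≤ k) {x : G}
    (hx : x ∈ (str G).filtration k) : ((str G).proj k x)⁻¹ * x ∈ (str G).filtration (k + 1) :=
  inv_mul_mem_filtration hk hx ((str G).sub_proj_mem_filtration hx)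

theorem list_prod_sub_sum_mem_filtration {k : ℕ} (hk : 1 ≤ k) {l : List G}
    (hl : ∀ x ∈ l, x ∈ (str G).filtration k) :
    l.prod - l.sum ∈ (str G).filtration (k + 1) := by
  induction l with
  | nil => simp [one_eq_zero]
  | cons x l ih =>
    have hx := hl x List.mem_cons_self
    have hl' : ∀ y ∈ l, y ∈ (str G).filtration k := fun y hy => hl y (List.mem_cons_of_mem x hy)
    have hprod : l.prod ∈ (str G).filtration k := by
      have := Submodule.add_mem _ ((str G).filtration_antitone (Nat.le_succ k) (ih hl'))
        (list_sum_mem hl')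
      rwa [sub_add_cancel] at this
    have h := Submodule.add_mem _
      (mul_sub_add_mem_filtration (add_le_add_right hk k) hx hprod) (ih hl')
    rw [List.prod_cons, List.sum_cons]
    convert h using 1
    abel

theorem dil_mul (t : ℝ) (x y : G) : dil t (x * y) = dil t x * dil t y := by
  simp only [CarnotGroup.mul_eq_bch, dil]
  exact map_bch _ ((str G).dilation_lie t) _ _ _

theorem dil_one_right (t : ℝ) : dil t (1 : G) = 1 := by
  rw [one_eq_zero, map_zero]

theorem dil_inv (t : ℝ) (x : G) : dil t x⁻¹ = (dil t x)⁻¹ := by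
  rw [inv_eq_neg, inv_eq_neg, map_neg]

theorem dil_dil (s t : ℝ) (x : G) : dil s (dil t x) = dil (s * t) x :=
  LinearMap.congr_fun ((str G).dilation_comp_dilation s t) x

theorem dil_one_left (x : G) : dil 1 x = x :=
  LinearMap.congr_fun (str G).dilation_one x

theorem dil_zero_left (x : G) : dil 0 x = 0 :=
  LinearMap.congr_fun (str G).dilation_zero x

theorem dil_of_mem (t : ℝ) {i : ℕ} {x : G} (hx : x ∈ (str G).layer i) : dil t x = t ^ i • x :=
  (str G).dilation_of_mem t hx

theorem dil_rpow_of_mem {c : ℝ} (hc : 0 ≤ c) {k : ℕ} (hk : 1 ≤ k) {x : G}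
    (hx : x ∈ (str G).layer k) : dil (c ^ (k : ℝ)⁻¹) x = c • x := by
  rw [dil_of_mem _ hx, Real.rpow_inv_natCast_pow hc (Nat.one_le_iff_ne_zero.1 hk)]

theorem HomogeneousHom.map_dil {H : Type v} [CarnotGroup H] (L : HomogeneousHom G H) (t : ℝ)
    (x : G) : L.toLieHom (dil t x) = dil t (L.toLieHom x) := by
  suffices h : (L.toLieHom : G →ₗ[ℝ] H) ∘ₗ dil t = dil t ∘ₗ (L.toLieHom : G →ₗ[ℝ] H) from
    LinearMap.congr_fun h x
  refine (str G).linearMap_ext fun i a ha => ?_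
  simp [dil_of_mem t ha, dil_of_mem t (L.map_layer i a ha)]

end Algebra

/-! ### The homogeneous norm -/

section HomogeneousNorm

variable {G : Type u} [CarnotGroup G]

instance : IsIsometricSMul G G :=
  ⟨fun g => Isometry.of_dist_eq (CarnotGroup.dist_mul_left' g)⟩

/-- The homogeneous norm of a Carnot group: the distance from the identity. -/
noncomputable def gnorm (x : G) : ℝ := dist 1 x

theorem gnorm_nonneg (x : G) : 0 ≤ gnorm x := dist_nonneg

@[simp] theorem gnorm_one : gnorm (1 : G) = 0 := dist_self _

theorem gnorm_eq_zero {x : G} : gnorm x = 0 ↔ x = 1 := by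
  rw [gnorm, dist_eq_zero, eq_comm]

theorem mem_closedBall_one {x : G} {r : ℝ} : x ∈ Metric.closedBall 1 r ↔ gnorm x ≤ r := by
  rw [Metric.mem_closedBall, dist_comm, gnorm]

theorem dist_eq_gnorm (x y : G) : dist x y = gnorm (x⁻¹ * y) := by
  rw [gnorm, ← dist_mul_left x 1, mul_one, mul_inv_cancel_left]

theorem gnorm_inv (x : G) : gnorm x⁻¹ = gnorm x := by
  rw [gnorm, ← dist_mul_left x 1, mul_one, mul_inv_cancel, dist_comm, gnorm]

theorem gnorm_mul_le (x y : G) : gnorm (x * y) ≤ gnorm x + gnorm y := by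
  refine (dist_triangle 1 x (x * y)).trans_eq ?_
  rw [dist_eq_gnorm x, inv_mul_cancel_left, gnorm, gnorm]

theorem dist_dil {t : ℝ} (ht : 0 < t) (x y : G) : dist (dil t x) (dil t y) = t * dist x y :=
  CarnotGroup.dist_dilation t ht x y

theorem gnorm_dil {t : ℝ} (ht : 0 < t) (x : G) : gnorm (dil t x) = t * gnorm x := by
  rw [gnorm, ← dil_one_right t, dist_dil ht, gnorm]

theorem gnorm_smul_of_mem {k : ℕ} (hk : 1 ≤ k) {b : G} (hb : b ∈ (str G).layer k) (c : ℝ) :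
    gnorm (c • b) = |c| ^ (k : ℝ)⁻¹ * gnorm b := by
  have h_abs : gnorm (c • b) = gnorm (|c| • b) := by
    rcases abs_choice c with h | h
    · rw [h]
    · rw [h, neg_smul, ← inv_eq_neg, gnorm_inv]
  rcases (abs_nonneg c).eq_or_lt with hc | hc
  · rw [h_abs, ← hc, zero_smul, ← one_eq_zero, gnorm_one, Real.zero_rpow (by positivity), zero_mul]
  · rw [h_abs, ← dil_rpow_of_mem hc.le hk hb, gnorm_dil (Real.rpow_pos_of_pos hc _)]

end HomogeneousNorm

/-! ### The topology of a Carnot group -/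

section Topology

variable {G : Type u} [CarnotGroup G]

instance : FiniteDimensional ℝ G := CarnotGroup.finiteDimensional

/-- Linear coordinates on a Carnot group. They transport the topology of `ℝⁿ` to `G`, which turns
out to be that of the distance: see `continuous_coord` and `continuous_coord_symm`. -/
noncomputable def coord (G : Type u) [CarnotGroup G] :
    G ≃ₗ[ℝ] (Fin (Module.finrank ℝ G) → ℝ) :=
  (Module.finBasis ℝ G).equivFun

section ContinuousCoord

variable {X : Type*} [TopologicalSpace X] {f g : X → G}

theorem continuous_coord_lie (hf : Continuous fun x => coord G (f x))
    (hg : Continuous fun x => coord G (g x)) : Continuous fun x => coord G ⁅f x, g x⁆ := by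
  have h : ∀ x, coord G ⁅f x, g x⁆ = ∑ i, ∑ j, (coord G (f x) i * coord G (g x) j) •
      coord G ⁅Module.finBasis ℝ G i, Module.finBasis ℝ G j⁆ := by
    intro x
    conv_lhs =>
      rw [← (Module.finBasis ℝ G).sum_equivFun (f x), ← (Module.finBasis ℝ G).sum_equivFun (g x),
        sum_lie_sum]
    simp only [map_sum, smul_lie, lie_smul, map_smul, smul_smul]
    refine Finset.sum_congr rfl fun i _ => Finset.sum_congr rfl fun j _ => ?_
    rw [mul_comm]
    rfl
  simp only [h]
  fun_prop

theorem continuous_coord_lieWord (l : List (X → G))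
    (hl : ∀ f ∈ l, Continuous fun x => coord G (f x)) :
    Continuous fun x => coord G (lieWord (l.map fun f => f x)) := by
  induction l with
  | nil => simpa [lieWord] using continuous_const
  | cons f l ih =>
    rcases eq_or_ne l [] with rfl | h
    · exact hl f List.mem_cons_self
    · have h' : ∀ x, l.map (fun f => f x) ≠ [] := by simp [h]
      simp only [List.map_cons, lieWord_cons (h' _)]
      exact continuous_coord_lie (hl f List.mem_cons_self)
        (ih fun g hg => hl g (List.mem_cons_of_mem f hg))

theorem continuous_coord_mul (hf : Continuous fun x => coord G (f x))
    (hg : Continuous fun x => coord G (g x)) : Continuous fun x => coord G (f x * g x) := by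
  simp only [CarnotGroup.mul_eq_bch, bch_eq_sum_dynkinSum, dynkinSum, map_sum, map_smul]
  refine continuous_finsetSum _ fun n _ => Continuous.fun_const_smul
    (continuous_finsetSum _ fun e _ => Continuous.fun_const_smul ?_ _) _
  have h := continuous_coord_lieWord (dynkinWord e f g) (fun a ha => by
    rcases eq_or_eq_of_mem_dynkinWord ha with rfl | rfl <;> assumption)
  simpa only [map_dynkinWord] using h

theorem continuous_coord_inv (hf : Continuous fun x => coord G (f x)) :
    Continuous fun x => coord G (f x)⁻¹ := by
  simpa only [inv_eq_neg, map_neg] using hf.fun_neg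

end ContinuousCoord

theorem continuous_coord_coord_symm : Continuous fun p => coord G ((coord G).symm p) := by
  simpa using continuous_id'

theorem continuous_linearMap_coord_symm {F : Type*} [AddCommGroup F] [Module ℝ F]
    [TopologicalSpace F] [IsTopologicalAddGroup F] [ContinuousSMul ℝ F] (L : G →ₗ[ℝ] F) :
    Continuous fun p => L ((coord G).symm p) :=
  LinearMap.continuous_of_finiteDimensional (L ∘ₗ (coord G).symm.toLinearMap)

/-- The neighbourhood filter of the identity for the linear topology, before it is known that this
is the topology of the distance. -/
noncomputable def linearNhdsOne (G : Type u) [CarnotGroup G] : Filter G :=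
  comap (coord G) (𝓝 0)

theorem tendsto_linearNhdsOne {f : G → G}
    (hf : Continuous fun p => coord G (f ((coord G).symm p))) (h1 : f 1 = 1) :
    Tendsto f (linearNhdsOne G) (linearNhdsOne G) := by
  refine tendsto_comap_iff.2 ?_
  have h := hf.tendsto 0
  simp only [map_zero, ← one_eq_zero, h1] at h
  rw [one_eq_zero, map_zero] at h
  refine (h.comp tendsto_comap).congr fun x => ?_
  simp

/-- The maps `f` of a Carnot group to itself that are continuous for the linear topology and fix
`1`, and for which `gnorm (f x)` tends to zero as `x` tends to `1` for the linear topology. The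
continuity of the homogeneous norm amounts to `id` being such a map. -/
noncomputable def smallMaps (G : Type u) [CarnotGroup G] : Submonoid (G → G) where
  carrier := {f | (Continuous fun p => coord G (f ((coord G).symm p))) ∧ f 1 = 1 ∧
    Tendsto (fun x => gnorm (f x)) (linearNhdsOne G) (𝓝 0)}
  one_mem' := ⟨by simp only [Pi.one_apply]; exact continuous_const, rfl,
    by simpa only [Pi.one_apply, gnorm_one] using tendsto_const_nhds⟩
  mul_mem' := fun ⟨hf, hf1, hf0⟩ ⟨hg, hg1, hg0⟩ =>
    ⟨continuous_coord_mul hf hg, by simp [hf1, hg1],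
      squeeze_zero (fun _ => gnorm_nonneg _) (fun _ => gnorm_mul_le _ _)
        (by simpa using hf0.add hg0)⟩

theorem mem_smallMaps {f : G → G} :
    f ∈ smallMaps G ↔ (Continuous fun p => coord G (f ((coord G).symm p))) ∧ f 1 = 1 ∧
      Tendsto (fun x => gnorm (f x)) (linearNhdsOne G) (𝓝 0) :=
  Iff.rfl

theorem comp_mem_smallMaps {f g : G → G} (hf : f ∈ smallMaps G)
    (hg : Continuous fun p => coord G (g ((coord G).symm p))) (hg1 : g 1 = 1) :
    f ∘ g ∈ smallMaps G := by
  obtain ⟨hfc, hf1, hf0⟩ := mem_smallMaps.1 hf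
  refine mem_smallMaps.2 ⟨?_, by simp [hf1, hg1], hf0.comp (tendsto_linearNhdsOne hg hg1)⟩
  simpa [Function.comp_def] using hfc.comp hg

theorem smul_mem_smallMaps (L : G →ₗ[ℝ] ℝ) {k : ℕ} (hk : 1 ≤ k) {b : G}
    (hb : b ∈ (str G).layer k) : (fun x => L x • b) ∈ smallMaps G := by
  have hL : Continuous fun p => L ((coord G).symm p) := continuous_linearMap_coord_symm L
  refine mem_smallMaps.2 ⟨?_, by simp [one_eq_zero], ?_⟩
  · simp only [map_smul]
    exact hL.smul continuous_const
  · simp only [gnorm_smul_of_mem hk hb]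
    have h0 : Tendsto L (linearNhdsOne G) (𝓝 0) := by
      have := (hL.tendsto 0).comp (tendsto_comap (f := coord G))
      simpa [Function.comp_def, linearNhdsOne] using this
    have h := (h0.abs.rpow_const (p := (k : ℝ)⁻¹) (Or.inr (by positivity))).mul_const (gnorm b)
    rwa [abs_zero, Real.zero_rpow (by positivity), zero_mul] at h

/-- In a basis `b₁, …, b_m` of the `k`-th layer with coordinates `c₁, …, c_m`, the product of the
`cᵢ(x) bᵢ` agrees with the `k`-th component of `x` up to terms in the subsequent layers. -/
theorem exists_smallMaps_inv_mul_mem_filtration {k : ℕ} (hk : 1 ≤ k) :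
    ∃ f ∈ smallMaps G, ∀ x ∈ (str G).filtration k, (f x)⁻¹ * x ∈ (str G).filtration (k + 1) := by
  let b := Module.finBasis ℝ ((str G).layer k)
  let projLayer : G →ₗ[ℝ] (str G).layer k :=
    ((str G).proj k).codRestrict ((str G).layer k) ((str G).proj_mem k)
  let factor (i : Fin _) (x : G) : G := (b.coord i ∘ₗ projLayer) x • (b i : G)
  have h_mem (i x) : factor i x ∈ (str G).filtration k :=
    Submodule.smul_mem _ _ ((str G).layer_le_filtration le_rfl (b i).2)
  refine ⟨(List.ofFn factor).prod, Submonoid.list_prod_mem _ fun f hf => ?_, fun x hx => ?_⟩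
  · obtain ⟨i, rfl⟩ := List.mem_ofFn.1 hf
    exact smul_mem_smallMaps _ hk (b i).2
  have h_prod : (List.ofFn factor).prod x = (List.ofFn fun i => factor i x).prod := by
    rw [Pi.list_prod_apply, List.map_ofFn, Function.comp_def]
  have h_sum : (List.ofFn fun i => factor i x).sum = (str G).proj k x := by
    rw [List.sum_ofFn]
    calc ∑ i, factor i x = ((∑ i, b.repr (projLayer x) i • b i : (str G).layer k) : G) := by
          rw [Submodule.coe_sum]; rfl
      _ = (str G).proj k x := by rw [b.sum_repr]; rfl
  have h := list_prod_sub_sum_mem_filtration hk (l := List.ofFn fun i => factor i x) fun y hy => by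
    obtain ⟨i, rfl⟩ := List.mem_ofFn.1 hy
    exact h_mem i x
  rw [h_sum] at h
  refine inv_mul_mem_filtration hk hx ?_
  rw [h_prod]
  have := Submodule.sub_mem _ ((str G).sub_proj_mem_filtration hx) h
  rwa [sub_sub_sub_cancel_right] at this

theorem exists_smallMaps_forall_inv_mul_mem_filtration (k : ℕ) :
    ∃ f ∈ smallMaps G, ∀ x, (f x)⁻¹ * x ∈ (str G).filtration (k + 1) := by
  induction k with
  | zero =>
    refine ⟨1, one_mem _, fun x => ?_⟩
    rw [zero_add, (str G).filtration_one]
    exact Submodule.mem_top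
  | succ k ih =>
    obtain ⟨f, hf, hfx⟩ := ih
    obtain ⟨g, hg, hgx⟩ := exists_smallMaps_inv_mul_mem_filtration (G := G) (Nat.le_add_left 1 k)
    obtain ⟨hf_cont, hf_one, -⟩ := mem_smallMaps.1 hf
    refine ⟨_, mul_mem hf (comp_mem_smallMaps (g := fun x => (f x)⁻¹ * x) hg
      (continuous_coord_mul (continuous_coord_inv hf_cont) continuous_coord_coord_symm)
      (by simp [hf_one])), fun x => ?_⟩
    simpa [mul_assoc] using hgx _ (hfx x)

theorem id_mem_smallMaps : (id : G → G) ∈ smallMaps G := by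
  obtain ⟨f, hf, hfx⟩ := exists_smallMaps_forall_inv_mul_mem_filtration (G := G) (str G).step
  convert hf
  funext x
  have h := hfx x
  rw [(str G).filtration_eq_bot (Nat.lt_succ_self _), Submodule.mem_bot, ← one_eq_zero,
    inv_mul_eq_one] at h
  exact h.symm

theorem continuous_coord_symm : Continuous ((coord G).symm : _ → G) := by
  refine continuous_iff_continuousAt.2 fun p => ?_
  refine tendsto_iff_dist_tendsto_zero.2 ?_
  simp only [dist_comm _ ((coord G).symm p), dist_eq_gnorm]
  refine (mem_smallMaps.1 id_mem_smallMaps).2.2.comp (tendsto_comap_iff.2 ?_)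
  have h : Continuous fun q => coord G (((coord G).symm p)⁻¹ * (coord G).symm q) :=
    continuous_coord_mul continuous_const continuous_coord_coord_symm
  have := h.tendsto p
  rwa [inv_mul_cancel, one_eq_zero, map_zero] at this

theorem continuous_gnorm : Continuous (gnorm : G → ℝ) := continuous_const.dist continuous_id

theorem exists_forall_norm_coord_eq_imp_le_gnorm {ρ : ℝ} (hρ : 0 < ρ) :
    ∃ c > 0, ∀ x : G, ‖coord G x‖ = ρ → c ≤ gnorm x := by
  have hcont : Continuous fun p => gnorm ((coord G).symm p : G) :=
    continuous_gnorm.comp continuous_coord_symm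
  rcases (Metric.sphere (0 : Fin (Module.finrank ℝ G) → ℝ) ρ).eq_empty_or_nonempty with h | h
  · refine ⟨1, one_pos, fun x hx => absurd (mem_sphere_zero_iff_norm.2 hx) ?_⟩
    rw [h]
    exact notMem_empty _
  obtain ⟨p, hp, hmin⟩ := (isCompact_sphere _ ρ).exists_isMinOn h hcont.continuousOn
  refine ⟨gnorm ((coord G).symm p), (gnorm_nonneg _).lt_of_ne' fun h0 => ?_, fun x hx => ?_⟩
  · rw [gnorm_eq_zero, one_eq_zero, LinearEquiv.map_eq_zero_iff] at h0
    rw [h0, mem_sphere_zero_iff_norm, norm_zero] at hp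
    exact hρ.ne hp
  · simpa using hmin (mem_sphere_zero_iff_norm.2 hx)

theorem exists_norm_coord_dil_eq {ρ : ℝ} (hρ : 0 < ρ) {x : G} (hx : ρ ≤ ‖coord G x‖) :
    ∃ t, 0 < t ∧ t ≤ 1 ∧ ‖coord G (dil t x)‖ = ρ := by
  have hcont : Continuous fun t : ℝ => ‖coord G (dil t x)‖ := by
    simp only [dil, Stratification.dilation, LinearMap.sum_apply, LinearMap.smul_apply, map_sum,
      map_smul]
    fun_prop
  obtain ⟨t, ⟨ht0, ht1⟩, ht⟩ := intermediate_value_Icc zero_le_one hcont.continuousOn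
    (show ρ ∈ Icc _ _ from ⟨by simp [dil_zero_left, hρ.le], by rwa [dil_one_left]⟩)
  refine ⟨t, ht0.lt_of_ne ?_, ht1, ht⟩
  rintro rfl
  simp only [dil_zero_left, map_zero, norm_zero] at ht
  exact hρ.ne ht

theorem exists_gnorm_lt_imp_norm_coord_lt {ρ : ℝ} (hρ : 0 < ρ) :
    ∃ c > 0, ∀ x : G, gnorm x < c → ‖coord G x‖ < ρ := by
  obtain ⟨c, hc, hmin⟩ := exists_forall_norm_coord_eq_imp_le_gnorm (G := G) hρ
  refine ⟨c, hc, fun x hx => ?_⟩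
  by_contra! hge
  obtain ⟨t, ht0, ht1, ht⟩ := exists_norm_coord_dil_eq hρ hge
  refine (hmin _ ht).not_gt ?_
  calc gnorm (dil t x) = t * gnorm x := gnorm_dil ht0 x
    _ ≤ gnorm x := mul_le_of_le_one_left (gnorm_nonneg x) ht1
    _ < c := hx

theorem continuous_coord : Continuous (coord G) := by
  have h1 : Tendsto (coord G) (𝓝 1) (𝓝 0) := by
    refine Metric.tendsto_nhds_nhds.2 fun ε hε => ?_
    obtain ⟨c, hc, h⟩ := exists_gnorm_lt_imp_norm_coord_lt (G := G) hε
    exact ⟨c, hc, fun {x} hx => by simpa using h x (by rwa [dist_comm] at hx)⟩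
  refine continuous_iff_continuousAt.2 fun x => ?_
  have h2 : Tendsto (fun y => x⁻¹ * y) (𝓝 x) (𝓝 1) := by
    simpa using (continuous_const_smul x⁻¹).tendsto x
  have h3 : Continuous fun p => coord G (x * (coord G).symm p) :=
    continuous_coord_mul continuous_const continuous_coord_coord_symm
  have h4 := (h3.tendsto 0).comp (h1.comp h2)
  rw [map_zero, ← one_eq_zero, mul_one] at h4
  refine h4.congr fun y => ?_
  simp

theorem continuous_of_continuous_coord {X : Type*} [TopologicalSpace X] {f : X → G}
    (h : Continuous fun x => coord G (f x)) : Continuous f := by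
  simpa [Function.comp_def] using continuous_coord_symm.comp h

instance : IsTopologicalGroup G where
  continuous_mul := continuous_of_continuous_coord
    (continuous_coord_mul (continuous_coord.comp continuous_fst)
      (continuous_coord.comp continuous_snd))
  continuous_inv := continuous_of_continuous_coord (continuous_coord_inv continuous_coord)

theorem continuous_linearMap {H : Type v} [CarnotGroup H] (L : G →ₗ[ℝ] H) : Continuous L := by
  refine continuous_of_continuous_coord ?_
  have h : Continuous fun p => coord H (L ((coord G).symm p)) :=
    continuous_linearMap_coord_symm ((coord H).toLinearMap ∘ₗ L)
  simpa [Function.comp_def] using h.comp continuous_coord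

theorem HomogeneousHom.continuous {H : Type v} [CarnotGroup H] (L : HomogeneousHom G H) :
    Continuous L.toLieHom :=
  continuous_linearMap (L.toLieHom : G →ₗ[ℝ] H)

theorem isClosed_submodule (U : Submodule ℝ G) : IsClosed (U : Set G) := by
  have h : IsClosed (U.map (coord G).toLinearMap : Set (Fin (Module.finrank ℝ G) → ℝ)) :=
    Submodule.closed_of_finiteDimensional _
  convert h.preimage (continuous_coord (G := G)) using 1
  ext x
  simp

theorem isCompact_closedBall_one {R : ℝ} (hR : 0 < R) :
    IsCompact (Metric.closedBall (1 : G) R) := by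
  obtain ⟨c, hc, h⟩ := exists_gnorm_lt_imp_norm_coord_lt (G := G) one_pos
  have hK : IsCompact ((fun x : G => dil (2 * R / c) x) ''
      ((coord G).symm '' Metric.closedBall 0 1)) :=
    ((isCompact_closedBall _ _).image continuous_coord_symm).image (continuous_linearMap _)
  refine hK.of_isClosed_subset Metric.isClosed_closedBall fun x hx => ?_
  refine ⟨dil (c / (2 * R)) x, ⟨coord G (dil (c / (2 * R)) x), ?_, by simp⟩, ?_⟩
  · refine mem_closedBall_zero_iff.2 (h _ ?_).le
    calc gnorm (dil (c / (2 * R)) x) = c / (2 * R) * gnorm x := gnorm_dil (by positivity) x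
      _ ≤ c / (2 * R) * R := by gcongr; exact mem_closedBall_one.1 hx
      _ = c / 2 := by field_simp
      _ < c := half_lt_self hc
  · have : 2 * R / c * (c / (2 * R)) = 1 := by field_simp
    simp only [dil_dil, this, dil_one_left]

instance : ProperSpace G := by
  refine ProperSpace.of_isCompact_closedBall_of_le 1 fun x r hr => ?_
  have := (isCompact_closedBall_one (G := G) (zero_lt_one.trans_le hr)).smul x
  rwa [Metric.smul_closedBall, smul_eq_mul, mul_one] at this

end Topology

/-! ### Homogeneous subgroups are closed -/

/-- If `a ^ k = 2`, then `δ_a q = 2 q = q q`, so `p p (δ_a p)⁻¹` measures the deviation of `p` from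
the layer of `q`. -/
theorem mul_self_mul_inv_dil_sub_mem_filtration {G : Type u} [CarnotGroup G] {k m : ℕ}
    (hk : 1 ≤ k) (hkm : k < m) {a : ℝ} (ha : a ^ k = 2) {p q : G} (hq : q ∈ (str G).layer k)
    (hpq : p - q ∈ (str G).filtration m) :
    p * p * (dil a p)⁻¹ - ((2 : ℝ) • (p - q) - dil a (p - q)) ∈ (str G).filtration (m + 1) := by
  set s : G := (2 : ℝ) • (p - q) - dil a (p - q) with hs
  have hsm : s ∈ (str G).filtration m :=
    Submodule.sub_mem _ (Submodule.smul_mem _ _ hpq) ((str G).dilation_mem_filtration a hpq)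
  have hp : p ∈ (str G).filtration k := by
    have := Submodule.add_mem _ ((str G).filtration_antitone hkm.le hpq)
      ((str G).layer_le_filtration le_rfl hq)
    rwa [sub_add_cancel] at this
  have h_eq : (2 : ℝ) • p = s + dil a p := by
    rw [hs, map_sub, dil_of_mem a hq, ha, smul_sub]
    abel
  have h_lie : ⁅(2 : ℝ) • p, -dil a p⁆ ∈ (str G).filtration (m + 1) := by
    rw [h_eq, lie_neg, add_lie, lie_self, add_zero]
    exact Submodule.neg_mem _ ((str G).filtration_antitone (Nat.add_le_add_left hk m)
      ((str G).lie_mem_filtration hsm ((str G).dilation_mem_filtration a hp)))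
  have h := mul_sub_add_mem_filtration_of_lie_mem h_lie
  rwa [← mul_self_eq, ← inv_eq_neg, mul_self_eq, h_eq, inv_eq_neg, add_neg_cancel_right, ← h_eq,
    ← mul_self_eq, ← inv_eq_neg] at h

namespace IsHomogeneous

variable {G : Type u} [CarnotGroup G] {P : Subgroup G}

theorem dil_mem (hP : IsHomogeneous P) {t : ℝ} (ht : 0 < t) {x : G} (hx : x ∈ P) : dil t x ∈ P := by
  have h : dil t x ∈ (dil t : G → G) '' (P : Set G) := mem_image_of_mem _ hx
  rwa [hP t ht] at h

/-- The space of the components in the `k`-th layer of the elements of a homogeneous subgroup whose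
components in the previous layers vanish. -/
noncomputable def leading (hP : IsHomogeneous P) {k : ℕ} (hk : 1 ≤ k) : Submodule ℝ G where
  carrier := {q | ∃ p ∈ P, p ∈ (str G).filtration k ∧ (str G).proj k p = q}
  add_mem' := by
    rintro _ _ ⟨p, hp, hpk, rfl⟩ ⟨p', hp', hpk', rfl⟩
    have h : p * p' - (p + p') ∈ (str G).filtration (k + 1) :=
      mul_sub_add_mem_filtration (by lia) hpk hpk'
    refine ⟨p * p', P.mul_mem hp hp', ?_, ?_⟩
    · have := Submodule.add_mem _ ((str G).filtration_antitone (Nat.le_succ k) h)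
        (Submodule.add_mem _ hpk hpk')
      rwa [sub_add_cancel] at this
    · have := (str G).mem_filtration.1 h k (Nat.lt_succ_self k)
      rwa [map_sub, map_add, sub_eq_zero] at this
  zero_mem' := ⟨1, P.one_mem, by simp [one_eq_zero], by simp [one_eq_zero]⟩
  smul_mem' := by
    have h_pos (c : ℝ) (hc : 0 ≤ c) (p : G) (hp : p ∈ P) (hpk : p ∈ (str G).filtration k) :
        ∃ p' ∈ P, p' ∈ (str G).filtration k ∧ (str G).proj k p' = c • (str G).proj k p := by
      rcases hc.eq_or_lt with rfl | hc
      · exact ⟨1, P.one_mem, by simp [one_eq_zero], by simp [one_eq_zero]⟩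
      refine ⟨dil (c ^ (k : ℝ)⁻¹) p, hP.dil_mem (Real.rpow_pos_of_pos hc _) hp,
        (str G).dilation_mem_filtration _ hpk, ?_⟩
      rw [dil, Stratification.proj_dilation, Real.rpow_inv_natCast_pow hc.le (by lia)]
    rintro c _ ⟨p, hp, hpk, rfl⟩
    rcases le_total 0 c with hc | hc
    · exact h_pos c hc p hp hpk
    · obtain ⟨p', h1, h2, h3⟩ := h_pos (-c) (neg_nonneg.2 hc) p hp hpk
      refine ⟨p'⁻¹, P.inv_mem h1, ?_, ?_⟩
      · rw [inv_eq_neg]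
        exact Submodule.neg_mem _ h2
      · rw [inv_eq_neg, map_neg, h3, neg_smul, neg_neg]

theorem mem_layer_of_mem_leading (hP : IsHomogeneous P) {k : ℕ} (hk : 1 ≤ k) {q : G}
    (hq : q ∈ hP.leading hk) : q ∈ (str G).layer k := by
  obtain ⟨p, -, -, rfl⟩ := hq
  exact (str G).proj_mem k p

theorem proj_sub_mem_leading (hP : IsHomogeneous P) {k m : ℕ} (hk : 1 ≤ k) (hkm : k < m) {p q : G}
    (hq : q ∈ (str G).layer k) (hp : p ∈ P) (hpq : p - q ∈ (str G).filtration m) :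
    (str G).proj m (p - q) ∈ hP.leading (hk.trans hkm.le) := by
  set a : ℝ := 2 ^ (k : ℝ)⁻¹
  have ha1 : 1 < a := Real.one_lt_rpow one_lt_two (by positivity)
  have hak : a ^ k = 2 := Real.rpow_inv_natCast_pow zero_le_two (by lia)
  have ham : 2 - a ^ m ≠ 0 := (sub_neg.2 (hak ▸ pow_lt_pow_right₀ ha1 hkm)).ne
  have h := mul_self_mul_inv_dil_sub_mem_filtration hk hkm hak hq hpq
  have h_lead : (2 - a ^ m) • (str G).proj m (p - q) ∈ hP.leading (hk.trans hkm.le) := by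
    refine ⟨p * p * (dil a p)⁻¹, P.mul_mem (P.mul_mem hp hp)
      (P.inv_mem (hP.dil_mem (zero_lt_one.trans ha1) hp)), ?_, ?_⟩
    · have := Submodule.add_mem _ ((str G).filtration_antitone (Nat.le_succ m) h)
        (Submodule.sub_mem _ (Submodule.smul_mem _ (2 : ℝ) hpq)
          ((str G).dilation_mem_filtration a hpq))
      rwa [dil, sub_add_cancel] at this
    · have := (str G).mem_filtration.1 h m (Nat.lt_succ_self m)
      rw [map_sub, sub_eq_zero] at this
      rw [this, map_sub _ ((2 : ℝ) • _), map_smul, dil, Stratification.proj_dilation, sub_smul]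
  rwa [Submodule.smul_mem_iff _ ham] at h_lead

theorem exists_sub_mem_filtration_succ (hP : IsHomogeneous P) {k m : ℕ} (hk : 1 ≤ k) (hkm : k < m)
    (hm : ∀ q ∈ hP.leading (hk.trans hkm.le), q ∈ P) {p q : G} (hq : q ∈ (str G).layer k)
    (hp : p ∈ P) (hpq : p - q ∈ (str G).filtration m) :
    ∃ p' ∈ P, p' - q ∈ (str G).filtration (m + 1) := by
  set r := (str G).proj m (p - q)
  have hr : r ∈ P := hm _ (hP.proj_sub_mem_leading hk hkm hq hp hpq)
  have hrm : -r ∈ (str G).filtration m :=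
    Submodule.neg_mem _ ((str G).layer_le_filtration le_rfl ((str G).proj_mem m _))
  have hp1 : p ∈ (str G).filtration 1 := by
    rw [Stratification.filtration_one]
    exact Submodule.mem_top
  have h : p * -r - (p + -r) ∈ (str G).filtration (m + 1) :=
    mul_sub_add_mem_filtration (by lia) hp1 hrm
  refine ⟨p * r⁻¹, P.mul_mem hp (P.inv_mem hr), ?_⟩
  rw [inv_eq_neg]
  convert Submodule.add_mem _ h ((str G).sub_proj_mem_filtration hpq) using 1
  abel

theorem mem_of_mem_leading (hP : IsHomogeneous P) {k : ℕ} (hk : 1 ≤ k) {q : G}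
    (hq : q ∈ hP.leading hk) : q ∈ P := by
  induction hj : (str G).step + 1 - k using Nat.strong_induction_on generalizing k q with
  | _ j ih =>
  have hqk := hP.mem_layer_of_mem_leading hk hq
  have h_approx (i : ℕ) : ∃ p ∈ P, p - q ∈ (str G).filtration (k + 1 + i) := by
    induction i with
    | zero =>
      obtain ⟨p, hp, hpk, rfl⟩ := hq
      exact ⟨p, hp, (str G).sub_proj_mem_filtration hpk⟩
    | succ i ihi =>
      obtain ⟨p, hp, hpq⟩ := ihi
      rcases lt_or_ge (str G).step (k + 1 + i) with hi | hi
      · refine ⟨p, hp, ?_⟩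
        rw [Stratification.filtration_eq_bot _ hi, Submodule.mem_bot] at hpq
        exact hpq ▸ Submodule.zero_mem _
      · exact hP.exists_sub_mem_filtration_succ hk (by lia)
          (fun r hr => ih _ (by lia) _ hr rfl) hqk hp hpq
  obtain ⟨p, hp, hpq⟩ := h_approx (str G).step
  rw [Stratification.filtration_eq_bot _ (by lia), Submodule.mem_bot, sub_eq_zero] at hpq
  rwa [← hpq]

theorem closure_inter_filtration_subset (hP : IsHomogeneous P) {k : ℕ} (hk : 1 ≤ k) :
    closure ((P : Set G) ∩ (str G).filtration k) ⊆ P := by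
  induction hj : (str G).step + 1 - k generalizing k with
  | zero =>
    rw [Stratification.filtration_eq_bot _ (by lia), Submodule.bot_coe]
    refine (closure_mono inter_subset_right).trans ?_
    rw [closure_singleton, singleton_subset_iff, ← one_eq_zero]
    exact P.one_mem
  | succ j ih =>
    intro x hx
    have h_cont : Continuous ((str G).proj k) := continuous_linearMap _
    have h_lead : (str G).proj k x ∈ (hP.leading hk : Set G) :=
      (isClosed_submodule _).closure_subset (map_mem_closure h_cont hx
        fun y hy => ⟨y, hy.1, hy.2, rfl⟩)
    have h_rest : ((str G).proj k x)⁻¹ * x ∈ closure ((P : Set G) ∩ (str G).filtration (k + 1)) :=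
      map_mem_closure (f := fun y => ((str G).proj k y)⁻¹ * y) (h_cont.inv.mul continuous_id) hx
        fun y hy => ⟨P.mul_mem (P.inv_mem (hP.mem_of_mem_leading hk ⟨y, hy.1, hy.2, rfl⟩)) hy.1,
          inv_proj_mul_mem_filtration hk hy.2⟩
    have h := P.mul_mem (hP.mem_of_mem_leading hk h_lead) (ih (by lia) (by lia) h_rest)
    rwa [mul_inv_cancel_left] at h

protected theorem isClosed (hP : IsHomogeneous P) : IsClosed (P : Set G) := by
  have h := hP.closure_inter_filtration_subset le_rfl
  rw [Stratification.filtration_one, Submodule.top_coe, inter_univ] at h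
  exact isClosed_of_closure_subset h

end IsHomogeneous

/-! ### Hausdorff and spherical measures -/

section Gauge

variable {X : Type u} [MetricSpace X]

/-- The sets `E` that enter the coverings defining `ψ^d` with weight at most `s ^ d`. The spherical
case admits all subsets of balls, so that the notion is hereditary in both cases. -/
def Admissible (k : MeasureKind) (E : Set X) (s : ℝ) : Prop :=
  match k with
  | .hausdorff => ∀ x ∈ E, ∀ y ∈ E, dist x y ≤ s
  | .spherical => ∃ x, E ⊆ Metric.closedBall x (s / 2)

namespace Admissible

variable {k : MeasureKind} {E F : Set X} {s t : ℝ}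

theorem mono (h : Admissible k E s) (hF : F ⊆ E) (hst : s ≤ t) : Admissible k F t := by
  cases k with
  | hausdorff => exact fun x hx y hy => (h x (hF hx) y (hF hy)).trans hst
  | spherical =>
    obtain ⟨x, hx⟩ := h
    exact ⟨x, hF.trans (hx.trans (Metric.closedBall_subset_closedBall (by linarith)))⟩

theorem dist_le (h : Admissible k E s) {x y : X} (hx : x ∈ E) (hy : y ∈ E) : dist x y ≤ s := by
  cases k with
  | hausdorff => exact h x hx y hy
  | spherical =>
    obtain ⟨z, hz⟩ := h
    linarith [dist_triangle_right x y z, Metric.mem_closedBall.1 (hz hx),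
      Metric.mem_closedBall.1 (hz hy)]

theorem ediam_le (h : Admissible k E s) : Metric.ediam E ≤ ENNReal.ofReal s :=
  Metric.ediam_le fun x hx y hy => by
    rw [edist_dist]
    exact ENNReal.ofReal_le_ofReal (h.dist_le hx hy)

theorem closure (h : Admissible k E s) : Admissible k (closure E) s := by
  cases k with
  | hausdorff =>
    intro x hx y hy
    exact closure_minimal (s := E ×ˢ E) (t := {p : X × X | dist p.1 p.2 ≤ s})
      (fun p hp => h _ hp.1 _ hp.2) (isClosed_le continuous_dist continuous_const)
      (by rw [closure_prod_eq]; exact ⟨hx, hy⟩ : (x, y) ∈ _root_.closure (E ×ˢ E))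
  | spherical =>
    obtain ⟨x, hx⟩ := h
    exact ⟨x, closure_minimal hx Metric.isClosed_closedBall⟩

theorem thicken (h : Admissible k E s) (ε : ℝ) :
    Admissible k {y | ∃ x ∈ E, dist y x ≤ ε} (s + 2 * ε) := by
  cases k with
  | hausdorff =>
    rintro x ⟨x', hx', hx⟩ y ⟨y', hy', hy⟩
    linarith [dist_triangle4_right x y x' y', h x' hx' y' hy']
  | spherical =>
    obtain ⟨z, hz⟩ := h
    refine ⟨z, ?_⟩
    rintro y ⟨x, hx, hyx⟩
    rw [Metric.mem_closedBall]
    linarith [dist_triangle y x z, Metric.mem_closedBall.1 (hz hx)]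

theorem image (h : Admissible k E s) {f : X → X} {c : ℝ} (hc : 0 ≤ c)
    (hf : ∀ x y, dist (f x) (f y) = c * dist x y) : Admissible k (f '' E) (c * s) := by
  cases k with
  | hausdorff =>
    rintro _ ⟨x, hx, rfl⟩ _ ⟨y, hy, rfl⟩
    rw [hf]
    exact mul_le_mul_of_nonneg_left (h x hx y hy) hc
  | spherical =>
    obtain ⟨z, hz⟩ := h
    refine ⟨f z, ?_⟩
    rintro _ ⟨x, hx, rfl⟩
    rw [Metric.mem_closedBall, hf, mul_div_assoc]
    exact mul_le_mul_of_nonneg_left (hz hx) hc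

theorem closedBall (k : MeasureKind) (x : X) (r : ℝ) :
    Admissible k (Metric.closedBall x r) (2 * r) := by
  cases k with
  | hausdorff =>
    intro y hy z hz
    linarith [dist_triangle_right y z x, Metric.mem_closedBall.1 hy, Metric.mem_closedBall.1 hz]
  | spherical => exact ⟨x, by rw [mul_div_cancel_left₀ _ two_ne_zero]⟩

end Admissible

theorem subset_interior_thicken (E : Set X) {ε : ℝ} (hε : 0 < ε) :
    E ⊆ interior {y | ∃ x ∈ E, dist y x ≤ ε} := fun x hx =>
  mem_interior_iff_mem_nhds.2 (mem_of_superset (Metric.closedBall_mem_nhds x hε)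
    fun _ hy => ⟨x, hx, hy⟩)

theorem ofReal_rpow_ne_zero {s : ℝ} (hs : 0 < s) (d : ℝ) : ENNReal.ofReal s ^ d ≠ 0 :=
  (ENNReal.rpow_pos (ENNReal.ofReal_pos.2 hs) ENNReal.ofReal_ne_top).ne'

theorem ofReal_rpow_ne_top {s : ℝ} (hs : 0 < s) (d : ℝ) : ENNReal.ofReal s ^ d ≠ ∞ :=
  ENNReal.rpow_ne_top_of_ne_zero (ENNReal.ofReal_pos.2 hs).ne' ENNReal.ofReal_ne_top

/-- The weight of a set in the construction of `ψ^d`. -/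
noncomputable def weight (k : MeasureKind) (d : ℝ) (B : Set X) : ℝ≥0∞ :=
  match k with
  | .hausdorff => Metric.ediam B ^ d
  | .spherical =>
    ⨅ (x : X) (r : ℝ) (_ : 0 ≤ r) (_ : B = Metric.closedBall x r), ENNReal.ofReal (2 * r) ^ d

/-- The outer measure that approximates `ψ^d` by coverings of mesh `δ`. -/
noncomputable def psiPre (k : MeasureKind) (d δ : ℝ) : OuterMeasure X :=
  OuterMeasure.mkMetric'.pre (weight k d) (ENNReal.ofReal δ)

theorem psiPre_le {k : MeasureKind} {d : ℝ} (hd : 0 ≤ d) {δ s : ℝ} {E : Set X} (hs : 0 ≤ s)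
    (hsδ : s ≤ δ) (hE : Admissible k E s) : psiPre k d δ E ≤ ENNReal.ofReal s ^ d := by
  have hδ := ENNReal.ofReal_le_ofReal hsδ
  cases k with
  | hausdorff =>
    exact (OuterMeasure.mkMetric'.pre_le (hE.ediam_le.trans hδ)).trans
      (ENNReal.rpow_le_rpow hE.ediam_le hd)
  | spherical =>
    obtain ⟨x, hx⟩ := hE
    have hball := (Admissible.closedBall .spherical x (s / 2)).ediam_le
    rw [mul_div_cancel₀ _ two_ne_zero] at hball
    refine (measure_mono hx).trans ((OuterMeasure.mkMetric'.pre_le (hball.trans hδ)).trans ?_)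
    refine iInf_le_of_le x (iInf_le_of_le (s / 2) (iInf_le_of_le (by positivity)
      (iInf_le_of_le rfl ?_)))
    rw [mul_div_cancel₀ _ two_ne_zero]

theorem le_weight {k : MeasureKind} {d : ℝ} (hd : 0 ≤ d) {ν : OuterMeasure X} {δ : ℝ} (hδ : 0 ≤ δ)
    (h : ∀ (E : Set X) (s : ℝ), 0 ≤ s → s ≤ 2 * δ → Admissible k E s → ν E ≤ ENNReal.ofReal s ^ d)
    {E : Set X} (hE : Metric.ediam E ≤ ENNReal.ofReal δ) : ν E ≤ weight k d E := by
  rcases E.eq_empty_or_nonempty with rfl | -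
  · simp
  cases k with
  | hausdorff =>
    have hfin : Metric.ediam E ≠ ∞ := (hE.trans_lt ENNReal.ofReal_lt_top).ne
    have hdiam : (Metric.ediam E).toReal ≤ δ := ENNReal.toReal_le_of_le_ofReal hδ hE
    refine (h E (Metric.ediam E).toReal ENNReal.toReal_nonneg (by linarith)
      fun x hx y hy => Metric.dist_le_diam_of_mem' hfin hx hy).trans_eq ?_
    rw [ENNReal.ofReal_toReal hfin, weight]
  | spherical =>
    refine le_iInf fun x => le_iInf fun r => le_iInf fun hr => le_iInf fun hB => ?_
    -- The radius of a ball may exceed its diameter, hence the truncation of `r` at `δ`.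
    refine (h E (2 * min r δ) (by positivity) (by linarith [min_le_right r δ])
      ⟨x, fun y hy => ?_⟩).trans
      (ENNReal.rpow_le_rpow (ENNReal.ofReal_le_ofReal (by linarith [min_le_left r δ])) hd)
    have hx : x ∈ E := hB ▸ Metric.mem_closedBall_self hr
    have hyx := (Metric.edist_le_ediam_of_mem hy hx).trans hE
    rw [edist_dist, ENNReal.ofReal_le_ofReal_iff hδ] at hyx
    rw [mul_div_cancel_left₀ _ two_ne_zero, Metric.mem_closedBall, le_min_iff]
    exact ⟨by rwa [hB] at hy, hyx⟩

variable [MeasurableSpace X] [BorelSpace X]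

theorem psi_eq_mkMetric' (k : MeasureKind) (d : ℝ) :
    (psi k d : Measure X) = Measure.mkMetric' (weight k d) := by
  cases k <;> rfl

theorem trim_pre_weight (k : MeasureKind) (d : ℝ) (r : ℝ≥0∞) :
    (OuterMeasure.mkMetric'.pre (weight k d : Set X → ℝ≥0∞) r).trim =
      OuterMeasure.mkMetric'.pre (weight k d) r := by
  cases k with
  | hausdorff => exact OuterMeasure.mkMetric'.trim_pre _ (fun s => by simp [weight]) _
  | spherical =>
    refine le_antisymm (OuterMeasure.mkMetric'.le_pre.2 fun s hs => ?_) (OuterMeasure.le_trim _)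
    by_cases h : MeasurableSet s
    · rw [OuterMeasure.trim_eq _ h]
      exact OuterMeasure.mkMetric'.pre_le hs
    · refine le_top.trans_eq (Eq.symm ?_)
      simp only [weight, iInf_eq_top]
      rintro x r _ rfl
      exact absurd Metric.isClosed_closedBall.measurableSet h

theorem psi_le_of_psiPre_le {k : MeasureKind} {d : ℝ} {B : Set X} {c : ℝ≥0∞}
    (h : ∀ δ > 0, psiPre k d δ B ≤ c) : psi k d B ≤ c := by
  have hpsi : psi k d B = (OuterMeasure.mkMetric' (weight k d)).trim B := by
    rw [psi_eq_mkMetric']; rfl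
  rw [hpsi, OuterMeasure.mkMetric'.eq_iSup_nat, OuterMeasure.trim_iSup, OuterMeasure.iSup_apply]
  refine iSup_le fun n => ?_
  rw [trim_pre_weight]
  refine le_trans (OuterMeasure.mkMetric'.mono_pre _ ?_ B) (h (1 / (n + 1)) (by positivity))
  rw [ENNReal.ofReal_div_of_pos (by positivity), ENNReal.ofReal_one, one_div, ENNReal.inv_le_inv,
    ENNReal.ofReal_add (by positivity) zero_le_one, ENNReal.ofReal_natCast]
  exact le_self_add

theorem le_psi {k : MeasureKind} {d : ℝ} (hd : 0 ≤ d) {ν : OuterMeasure X} {δ : ℝ} (hδ : 0 < δ)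
    (h : ∀ (E : Set X) (s : ℝ), 0 ≤ s → s ≤ δ → Admissible k E s → ν E ≤ ENNReal.ofReal s ^ d)
    (B : Set X) : ν B ≤ psi k d B := by
  have hpre : ν ≤ OuterMeasure.mkMetric'.pre (weight k d) (ENNReal.ofReal (δ / 2)) :=
    OuterMeasure.mkMetric'.le_pre.2 fun E hE => le_weight hd (half_pos hδ).le
      (fun F s hs hsδ => h F s hs (by linarith)) hE
  have hν : ν ≤ OuterMeasure.mkMetric' (weight k d) :=
    hpre.trans (le_iSup₂ (f := fun r (_ : r > 0) =>
      OuterMeasure.mkMetric'.pre (weight k d : Set X → ℝ≥0∞) r) (ENNReal.ofReal (δ / 2))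
      (ENNReal.ofReal_pos.2 (half_pos hδ)))
  rw [psi_eq_mkMetric']
  exact (hν B).trans (le_toMeasure_apply _ _ _)

end Gauge

/-! ### Densities with respect to `ψ^d` -/

section Density

theorem exists_disjoint_subfamily_tsum_le {X ι : Type*} [MeasurableSpace X] {ν : Measure X}
    {Q : ι → Set X} {r : ι → ℝ} {F : Set ι} {R d : ℝ} {t : ℝ≥0} (ht : t ≠ 0) {U : Set X}
    (hU : ν U ≠ ∞) (hQ : ∀ a ∈ F, MeasurableSet (Q a)) (hQne : ∀ a ∈ F, (Q a).Nonempty)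
    (hr : ∀ a ∈ F, 0 < r a) (hrR : ∀ a ∈ F, r a ≤ R) (hQU : ∀ a ∈ F, Q a ⊆ U)
    (hν : ∀ a ∈ F, t * ENNReal.ofReal (r a) ^ d ≤ ν (Q a)) :
    ∃ u ⊆ F, u.Countable ∧ ∑' a : u, ENNReal.ofReal (r a) ^ d ≤ ν U / t ∧
      ∀ a ∈ F, ∃ b ∈ u, (Q a ∩ Q b).Nonempty ∧ r a ≤ 2 * r b := by
  have ht0 : (t : ℝ≥0∞) ≠ 0 := ENNReal.coe_ne_zero.2 ht
  obtain ⟨u, huF, hdisj, hu⟩ := Vitali.exists_disjoint_subfamily_covering_enlargement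
    Q F r 2 one_lt_two (fun a ha => (hr a ha).le) R hrR hQne
  have hdisj' : Pairwise (Function.onFun Disjoint fun a : u => Q a) := fun a b hab =>
    hdisj a.2 b.2 (fun h => hab (Subtype.ext h))
  have hmeas : ∀ a : u, MeasurableSet (Q a) := fun a => hQ a (huF a.2)
  have hsubU : ⋃ a : u, Q a ⊆ U := iUnion_subset fun a => hQU a (huF a.2)
  refine ⟨u, huF, ?_, ?_, hu⟩
  · have hpos : {a : u | 0 < ν (Q a)} = univ := eq_univ_of_forall fun a =>
      (ENNReal.mul_pos ht0 (ofReal_rpow_ne_zero (hr a (huF a.2)) d)).trans_le (hν a (huF a.2))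
    have hcount := Measure.countable_meas_pos_of_disjoint_of_meas_iUnion_ne_top ν hmeas hdisj'
      (ne_top_of_le_ne_top hU (measure_mono hsubU))
    rw [hpos] at hcount
    exact countable_univ_iff.1 hcount
  · rw [ENNReal.le_div_iff_mul_le (Or.inl ht0) (Or.inl ENNReal.coe_ne_top), mul_comm,
      ← ENNReal.tsum_mul_left]
    calc ∑' a : u, t * ENNReal.ofReal (r a) ^ d ≤ ∑' a : u, ν (Q a) :=
          ENNReal.tsum_le_tsum fun a => hν a (huF a.2)
      _ ≤ ν (⋃ a : u, Q a) := tsum_meas_le_meas_iUnion_of_disjoint ν hmeas hdisj'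
      _ ≤ ν U := measure_mono hsubU

variable {X : Type u} [MetricSpace X] [MeasurableSpace X] {k : MeasureKind} {d : ℝ}
  {μ : Measure X} {p : X} {t : ℝ≥0}

/-- The upper density of a measure with respect to `ψ^d`. The competitors are neighbourhoods of `p`,
which makes the density a Borel function of `p`. -/
noncomputable def upperDensity (k : MeasureKind) (d : ℝ) (μ : Measure X) (p : X) : ℝ≥0∞ :=
  ⨅ n : ℕ, ⨆ (a : Set X × ℝ) (_ : p ∈ interior a.1 ∧ 0 < a.2 ∧ a.2 ≤ 1 / ((n : ℝ) + 1) ∧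
    Admissible k a.1 a.2), μ a.1 / ENNReal.ofReal a.2 ^ d

theorem measurable_upperDensity [BorelSpace X] (k : MeasureKind) (d : ℝ) (μ : Measure X) :
    Measurable (upperDensity k d μ) := by
  refine Measurable.iInf fun n => measurable_of_Ioi fun t => IsOpen.measurableSet ?_
  have hpre : (fun p => ⨆ (a : Set X × ℝ) (_ : p ∈ interior a.1 ∧ 0 < a.2 ∧
      a.2 ≤ 1 / ((n : ℝ) + 1) ∧ Admissible k a.1 a.2), μ a.1 / ENNReal.ofReal a.2 ^ d) ⁻¹' Ioi t =
      ⋃ (a : Set X × ℝ) (_ : 0 < a.2 ∧ a.2 ≤ 1 / ((n : ℝ) + 1) ∧ Admissible k a.1 a.2 ∧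
        t < μ a.1 / ENNReal.ofReal a.2 ^ d), interior a.1 := by
    ext p
    simp only [mem_preimage, mem_Ioi, lt_iSup_iff, mem_iUnion, exists_prop]
    exact exists_congr fun a => by tauto
  rw [hpre]
  exact isOpen_iUnion fun a => isOpen_iUnion fun _ => isOpen_interior

theorem upperDensity_le {δ : ℝ} (hδ : 0 < δ) (h : ∀ (E : Set X) (s : ℝ), p ∈ interior E → 0 < s →
    s ≤ δ → Admissible k E s → μ E ≤ t * ENNReal.ofReal s ^ d) : upperDensity k d μ p ≤ t := by
  obtain ⟨n, hn⟩ := exists_nat_one_div_lt hδ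
  refine iInf_le_of_le n (iSup₂_le fun a ha => ?_)
  rw [ENNReal.div_le_iff (ofReal_rpow_ne_zero ha.2.1 d) (ofReal_rpow_ne_top ha.2.1 d)]
  exact h a.1 a.2 ha.1 ha.2.1 (ha.2.2.1.trans hn.le) ha.2.2.2

theorem le_upperDensity (h : ∀ δ > 0, ∃ (E : Set X) (s : ℝ), p ∈ interior E ∧ 0 < s ∧ s ≤ δ ∧
    Admissible k E s ∧ t * ENNReal.ofReal s ^ d ≤ μ E) : t ≤ upperDensity k d μ p := by
  refine le_iInf fun n => ?_
  obtain ⟨E, s, hpE, hs, hsn, hE, hμ⟩ := h (1 / ((n : ℝ) + 1)) (by positivity)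
  refine le_iSup₂_of_le (E, s) ⟨hpE, hs, hsn, hE⟩ ?_
  rwa [ENNReal.le_div_iff_mul_le (Or.inl (ofReal_rpow_ne_zero hs d))
    (Or.inl (ofReal_rpow_ne_top hs d))]

theorem exists_forall_measure_le (h : upperDensity k d μ p < t) : ∃ n : ℕ,
    ∀ (E : Set X) (s : ℝ), p ∈ interior E → 0 < s → s ≤ 1 / ((n : ℝ) + 1) → Admissible k E s →
      μ E ≤ t * ENNReal.ofReal s ^ d := by
  obtain ⟨n, hn⟩ := iInf_lt_iff.1 h
  refine ⟨n, fun E s hpE hs hsn hE => ?_⟩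
  rw [← ENNReal.div_le_iff (ofReal_rpow_ne_zero hs d) (ofReal_rpow_ne_top hs d)]
  exact (le_iSup₂_of_le (f := fun (a : Set X × ℝ) (_ : p ∈ interior a.1 ∧ 0 < a.2 ∧
    a.2 ≤ 1 / ((n : ℝ) + 1) ∧ Admissible k a.1 a.2) => μ a.1 / ENNReal.ofReal a.2 ^ d)
    (E, s) ⟨hpE, hs, hsn, hE⟩ le_rfl).trans hn.le

theorem exists_isClosed_le_measure (h : t < upperDensity k d μ p) {δ : ℝ} (hδ : 0 < δ) :
    ∃ (E : Set X) (s : ℝ), IsClosed E ∧ p ∈ E ∧ 0 < s ∧ s ≤ δ ∧ Admissible k E s ∧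
      t * ENNReal.ofReal s ^ d ≤ μ E := by
  obtain ⟨n, hn⟩ := exists_nat_one_div_lt hδ
  obtain ⟨⟨E, s⟩, hE⟩ := lt_iSup_iff.1 (h.trans_le (iInf_le _ n))
  obtain ⟨⟨hpE, hs, hsn, hE⟩, hlt⟩ := lt_iSup_iff.1 hE
  have hle := (ENNReal.le_div_iff_mul_le (Or.inl (ofReal_rpow_ne_zero hs d))
    (Or.inl (ofReal_rpow_ne_top hs d))).1 hlt.le
  exact ⟨closure E, s, isClosed_closure, subset_closure (interior_subset hpE), hs, hsn.trans hn.le,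
    hE.closure, hle.trans (measure_mono subset_closure)⟩

theorem measure_le_of_mem_of_forall_interior {δ : ℝ}
    (h : ∀ (E : Set X) (s : ℝ), p ∈ interior E → 0 < s → s ≤ δ → Admissible k E s →
      μ E ≤ t * ENNReal.ofReal s ^ d)
    {E : Set X} {s : ℝ} (hp : p ∈ E) (hs : 0 ≤ s) (hsδ : s < δ) (hE : Admissible k E s) :
    μ E ≤ t * ENNReal.ofReal s ^ d := by
  have hlim : Tendsto (fun s' => (t : ℝ≥0∞) * ENNReal.ofReal s' ^ d) (𝓝[>] s)
      (𝓝 (t * ENNReal.ofReal s ^ d)) :=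
    ENNReal.Tendsto.const_mul ((((ENNReal.continuous_rpow_const.comp
      ENNReal.continuous_ofReal).tendsto s).mono_left nhdsWithin_le_nhds))
      (Or.inr ENNReal.coe_ne_top)
  refine ge_of_tendsto hlim ?_
  filter_upwards [Ioo_mem_nhdsGT hsδ] with s' hs'
  have hpos : 0 < (s' - s) / 2 := by linarith [hs'.1]
  have hsub := subset_interior_thicken E hpos
  exact (measure_mono (hsub.trans interior_subset)).trans (h _ s' (hsub hp) (hs.trans_lt hs'.1)
    hs'.2.le ((hE.thicken _).mono Subset.rfl (by linarith)))

variable [BorelSpace X] {B : Set X}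

theorem measure_le_mul_psi_of_forall_measure_le (hd : 0 ≤ d) (ht : t ≠ 0) {δ : ℝ} (hδ : 0 < δ)
    (h : ∀ p ∈ B, ∀ (E : Set X) (s : ℝ), p ∈ E → 0 ≤ s → s ≤ δ → Admissible k E s →
      μ E ≤ t * ENNReal.ofReal s ^ d) : μ B ≤ t * psi k d B := by
  have ht0 : (t : ℝ≥0∞) ≠ 0 := ENNReal.coe_ne_zero.2 ht
  have key := le_psi (k := k) hd
    (ν := (t : ℝ≥0∞)⁻¹ • OuterMeasure.restrict B μ.toOuterMeasure) hδ (fun E s hs hsδ hE => ?_) B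
  · rwa [smul_apply, OuterMeasure.restrict_apply, inter_self, smul_eq_mul,
      Measure.coe_toOuterMeasure, ENNReal.inv_mul_le_iff ht0 ENNReal.coe_ne_top] at key
  · rw [smul_apply, OuterMeasure.restrict_apply, smul_eq_mul,
      Measure.coe_toOuterMeasure, ENNReal.inv_mul_le_iff ht0 ENNReal.coe_ne_top]
    rcases (E ∩ B).eq_empty_or_nonempty with h0 | ⟨p, hpE, hpB⟩
    · rw [h0, measure_empty]
      exact zero_le
    · exact (measure_mono inter_subset_left).trans (h p hpB E s hpE hs hsδ hE)

theorem measure_le_mul_psi (hd : 0 ≤ d) (h : ∀ p ∈ B, upperDensity k d μ p < t) :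
    μ B ≤ t * psi k d B := by
  rcases eq_or_ne t 0 with rfl | ht
  · rw [eq_empty_of_forall_notMem fun p hp => (h p hp).not_ge (by simp), measure_empty]
    exact zero_le
  let C : ℕ → Set X := fun n => {p ∈ B | ∀ (E : Set X) (s : ℝ), p ∈ interior E → 0 < s →
    s ≤ 1 / ((n : ℝ) + 1) → Admissible k E s → μ E ≤ t * ENNReal.ofReal s ^ d}
  have hmono : Monotone C := fun m n hmn p hp => ⟨hp.1, fun E s hpE hs hsn =>
    hp.2 E s hpE hs (hsn.trans (one_div_le_one_div_of_le (by positivity) (by gcongr)))⟩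
  have hunion : B = ⋃ n, C n := Subset.antisymm
    (fun p hp => mem_iUnion.2 ((exists_forall_measure_le (h p hp)).imp fun _ hn => ⟨hp, hn⟩))
    (iUnion_subset fun _ _ hp => hp.1)
  have hC : ∀ n, μ (C n) ≤ t * psi k d B := fun n => by
    have hn : (0 : ℝ) < 1 / ((n : ℝ) + 1) := by positivity
    refine (measure_le_mul_psi_of_forall_measure_le hd ht (half_pos hn)
      fun p hp E s hpE hs hsn => ?_).trans (mul_le_mul_right (measure_mono fun p hp => hp.1) _)
    exact measure_le_of_mem_of_forall_interior hp.2 hpE hs (hsn.trans_lt (half_lt_self hn))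
  calc μ B = ⨆ n, μ (C n) := by rw [← hmono.measure_iUnion, ← hunion]
    _ ≤ t * psi k d B := iSup_le hC

omit [MeasurableSpace X] [BorelSpace X] in
/-- Outside finitely many sets of a Vitali family only their complement has to be covered by the
enlarged sets, and the weights of the enlarged sets have small sum. -/
theorem psiPre_le_tsum (hd : 0 ≤ d) {δ : ℝ} {u : Set (Set X × ℝ)} (hu : u.Countable)
    (hs : ∀ a ∈ u, 0 < a.2) (hsδ : ∀ a ∈ u, a.2 ≤ δ / 5) (hA : ∀ a ∈ u, Admissible k a.1 a.2)
    (hfin : ∑' a : u, ENNReal.ofReal a.1.2 ^ d ≠ ∞)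
    (hB : ∀ F : Finset u, B ⊆ (⋃ a ∈ F, a.1.1) ∪
      ⋃ a : {a : u // a ∉ F}, {y | ∃ x ∈ a.1.1.1, dist y x ≤ 2 * a.1.1.2}) :
    psiPre k d δ B ≤ ∑' a : u, ENNReal.ofReal a.1.2 ^ d := by
  have := hu.to_subtype
  have hball : ∀ a : u, psiPre k d δ a.1.1 ≤ ENNReal.ofReal a.1.2 ^ d := fun a =>
    psiPre_le hd (hs a a.2).le (by linarith [hs a a.2, hsδ a a.2]) (hA a a.2)
  have henlarged : ∀ a : u, psiPre k d δ {y | ∃ x ∈ a.1.1, dist y x ≤ 2 * a.1.2} ≤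
      ENNReal.ofReal 5 ^ d * ENNReal.ofReal a.1.2 ^ d := fun a => by
    rw [← ENNReal.mul_rpow_of_nonneg _ _ hd, ← ENNReal.ofReal_mul (by norm_num)]
    exact psiPre_le hd (by linarith [hs a a.2]) (by linarith [hsδ a a.2])
      (((hA a a.2).thicken _).mono Subset.rfl (by linarith))
  have hbound : ∀ F : Finset u, psiPre k d δ B ≤ ∑' a : u, ENNReal.ofReal a.1.2 ^ d +
      ENNReal.ofReal 5 ^ d * ∑' a : {a : u // a ∉ F}, ENNReal.ofReal a.1.1.2 ^ d := fun F => by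
    refine (measure_mono (hB F)).trans ((measure_union_le _ _).trans (add_le_add ?_ ?_))
    · exact (measure_biUnion_finset_le F _).trans
        ((Finset.sum_le_sum fun a _ => hball a).trans (ENNReal.sum_le_tsum F))
    · rw [← ENNReal.tsum_mul_left]
      exact (measure_iUnion_le _).trans (ENNReal.tsum_le_tsum fun a => henlarged a.1)
  have hlim : Tendsto (fun F : Finset u => ∑' a : u, ENNReal.ofReal a.1.2 ^ d +
      ENNReal.ofReal 5 ^ d * ∑' a : {a : u // a ∉ F}, ENNReal.ofReal a.1.1.2 ^ d) atTop
      (𝓝 (∑' a : u, ENNReal.ofReal a.1.2 ^ d + ENNReal.ofReal 5 ^ d * 0)) :=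
    tendsto_const_nhds.add (ENNReal.Tendsto.const_mul (ENNReal.tendsto_tsum_compl_atTop_zero hfin)
      (Or.inr (ofReal_rpow_ne_top (by norm_num) d)))
  rw [mul_zero, add_zero] at hlim
  exact ge_of_tendsto' hlim hbound

theorem psiPre_le_div (hd : 0 ≤ d) (ht : t ≠ 0) (h : ∀ p ∈ B, t < upperDensity k d μ p)
    {U : Set X} (hBU : B ⊆ U) (hU : IsOpen U) (hμU : μ U ≠ ∞) {δ : ℝ} (hδ : 0 < δ) :
    psiPre k d δ B ≤ μ U / t := by
  let T : Set (Set X × ℝ) := {a | IsClosed a.1 ∧ a.1.Nonempty ∧ 0 < a.2 ∧ a.2 ≤ δ / 5 ∧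
    Admissible k a.1 a.2 ∧ t * ENNReal.ofReal a.2 ^ d ≤ μ a.1 ∧ a.1 ⊆ U}
  obtain ⟨u, huT, hcount, hsum, hu⟩ := exists_disjoint_subfamily_tsum_le (F := T) (Q := Prod.fst)
    (r := Prod.snd) ht hμU (fun a ha => ha.1.measurableSet) (fun a ha => ha.2.1)
    (fun a ha => ha.2.2.1) (fun a ha => ha.2.2.2.1) (fun a ha => ha.2.2.2.2.2.2)
    (fun a ha => ha.2.2.2.2.2.1)
  refine (psiPre_le_tsum hd hcount (fun a ha => (huT ha).2.2.1) (fun a ha => (huT ha).2.2.2.1)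
    (fun a ha => (huT ha).2.2.2.2.1) (ne_top_of_le_ne_top
      (ENNReal.div_ne_top hμU (ENNReal.coe_ne_zero.2 ht)) hsum) fun F p hp => ?_).trans hsum
  by_cases hpF : p ∈ ⋃ a ∈ F, a.1.1
  · exact Or.inl hpF
  have hclosed : IsClosed (⋃ a ∈ F, a.1.1) := isClosed_biUnion_finset fun a _ => (huT a.2).1
  obtain ⟨r, hr, hrsub⟩ := Metric.isOpen_iff.1 (hU.inter hclosed.isOpen_compl) p ⟨hBU hp, hpF⟩
  obtain ⟨E, s, hEcl, hpE, hs, hsle, hE, hEμ⟩ :=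
    exists_isClosed_le_measure (h p hp) (show 0 < min (r / 2) (δ / 5) by positivity)
  have hEsub : E ⊆ U ∩ (⋃ a ∈ F, a.1.1)ᶜ := fun y hy => hrsub (by
    rw [Metric.mem_ball]
    linarith [hE.dist_le hy hpE, min_le_left (r / 2) (δ / 5)])
  obtain ⟨b, hbu, ⟨z, hzE, hzb⟩, hsb⟩ := hu (E, s) ⟨hEcl, ⟨p, hpE⟩, hs,
    hsle.trans (min_le_right _ _), hE, hEμ, fun y hy => (hEsub hy).1⟩
  exact Or.inr (mem_iUnion.2 ⟨⟨⟨b, hbu⟩, fun hbF => (hEsub hzE).2 (mem_biUnion hbF hzb)⟩, z, hzb,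
    (hE.dist_le hpE hzE).trans hsb⟩)

theorem mul_psi_le_measure [μ.OuterRegular] (hd : 0 ≤ d)
    (h : ∀ p ∈ B, t < upperDensity k d μ p) : t * psi k d B ≤ μ B := by
  rcases eq_or_ne t 0 with rfl | ht
  · simp
  refine ENNReal.le_of_forall_pos_le_add fun ε hε hB => ?_
  obtain ⟨U, hBU, hU, hμU⟩ := B.exists_isOpen_lt_add hB.ne (ENNReal.coe_pos.2 hε).ne'
  refine le_trans ?_ hμU.le
  rw [mul_comm, ← ENNReal.le_div_iff_mul_le (Or.inl (ENNReal.coe_ne_zero.2 ht))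
    (Or.inl ENNReal.coe_ne_top)]
  exact psi_le_of_psiPre_le fun δ hδ => psiPre_le_div hd ht h hBU hU hμU.ne_top hδ

end Density

section Radon

variable {X : Type*} [MeasurableSpace X] {μ ν : Measure X} {g : X → ℝ≥0∞} {B : Set X}

theorem measure_eq_tsum_Ico_zpow (m : Measure X) (hg : Measurable g) (hB : MeasurableSet B)
    (h0 : ∀ p ∈ B, g p ≠ 0) (htop : ∀ p ∈ B, g p ≠ ∞) {t : ℝ≥0} (ht : 1 < t) :
    m B = ∑' n : ℤ, m (B ∩ g ⁻¹' Ico ((t : ℝ≥0∞) ^ n) ((t : ℝ≥0∞) ^ (n + 1))) := by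
  have hzero : B ∩ g ⁻¹' {0} = ∅ := eq_empty_of_forall_notMem fun p hp => h0 p hp.1 hp.2
  have htop' : B ∩ g ⁻¹' {∞} = ∅ := eq_empty_of_forall_notMem fun p hp => htop p hp.1 hp.2
  rw [measure_eq_measure_preimage_add_measure_tsum_Ico_zpow m hg hB ht, hzero, htop',
    measure_empty, zero_add, zero_add]

theorem measure_le_mul_withDensity (hg : Measurable g) (h0 : ∀ p ∈ B, g p ≠ 0)
    (htop : ∀ p ∈ B, g p ≠ ∞) (hle : ∀ A ⊆ B, ∀ t : ℝ≥0, (∀ p ∈ A, g p < t) → μ A ≤ t * ν A)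
    (hB : MeasurableSet B) {t : ℝ≥0} (ht : 1 < t) :
    μ B ≤ t * ν.withDensity g B := by
  have t0' : t ≠ 0 := (zero_lt_one.trans ht).ne'
  have t0 : (t : ℝ≥0∞) ≠ 0 := ENNReal.coe_ne_zero.2 t0'
  rw [measure_eq_tsum_Ico_zpow μ hg hB h0 htop ht, measure_eq_tsum_Ico_zpow _ hg hB h0 htop ht,
    ← ENNReal.tsum_mul_left]
  refine ENNReal.tsum_le_tsum fun n => ?_
  set A := B ∩ g ⁻¹' Ico ((t : ℝ≥0∞) ^ n) ((t : ℝ≥0∞) ^ (n + 1))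
  calc μ A ≤ (t ^ (n + 1) : ℝ≥0) * ν A := hle A inter_subset_left _ fun p hp => by
        rw [ENNReal.coe_zpow t0']
        exact hp.2.2
    _ = t * ((t : ℝ≥0∞) ^ n * ν A) := by
        rw [ENNReal.coe_zpow t0', add_comm, ENNReal.zpow_add t0 ENNReal.coe_ne_top, zpow_one,
          mul_assoc]
    _ ≤ t * ν.withDensity g A := by
        gcongr
        rw [withDensity_apply _ (hB.inter (hg measurableSet_Ico)), ← setLIntegral_const]
        exact setLIntegral_mono hg fun p hp => hp.2.1

theorem withDensity_le_sq_mul_measure (hg : Measurable g) (h0 : ∀ p ∈ B, g p ≠ 0)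
    (htop : ∀ p ∈ B, g p ≠ ∞) (hge : ∀ A ⊆ B, ∀ t : ℝ≥0, (∀ p ∈ A, t < g p) → t * ν A ≤ μ A)
    (hB : MeasurableSet B) {t : ℝ≥0} (ht : 1 < t) :
    ν.withDensity g B ≤ (t : ℝ≥0∞) ^ 2 * μ B := by
  have t0' : t ≠ 0 := (zero_lt_one.trans ht).ne'
  have t0 : (t : ℝ≥0∞) ≠ 0 := ENNReal.coe_ne_zero.2 t0'
  rw [measure_eq_tsum_Ico_zpow μ hg hB h0 htop ht, measure_eq_tsum_Ico_zpow _ hg hB h0 htop ht,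
    ← ENNReal.tsum_mul_left]
  refine ENNReal.tsum_le_tsum fun n => ?_
  set A := B ∩ g ⁻¹' Ico ((t : ℝ≥0∞) ^ n) ((t : ℝ≥0∞) ^ (n + 1))
  have hlt : (t : ℝ≥0∞) ^ (n - 1) < (t : ℝ≥0∞) ^ n := by
    rw [← ENNReal.coe_zpow t0', ← ENNReal.coe_zpow t0', ENNReal.coe_lt_coe]
    exact zpow_lt_zpow_right₀ ht (by omega)
  calc ν.withDensity g A ≤ (t : ℝ≥0∞) ^ (n + 1) * ν A := by
        rw [withDensity_apply _ (hB.inter (hg measurableSet_Ico)), ← setLIntegral_const]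
        exact setLIntegral_mono measurable_const fun p hp => hp.2.2.le
    _ = (t : ℝ≥0∞) ^ (2 : ℤ) * ((t ^ (n - 1) : ℝ≥0) * ν A) := by
        rw [ENNReal.coe_zpow t0', ← mul_assoc, ← ENNReal.zpow_add t0 ENNReal.coe_ne_top,
          show (2 : ℤ) + (n - 1) = n + 1 by ring]
    _ ≤ (t : ℝ≥0∞) ^ 2 * μ A := by
        refine mul_le_mul' (le_of_eq (by norm_cast)) (hge A inter_subset_left _ ?_)
        intro p hp
        rw [ENNReal.coe_zpow t0']
        exact hlt.trans_le hp.2.1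

theorem measure_eq_setLIntegral_of_forall_le (hg : Measurable g)
    (h0 : ∀ p ∈ B, g p ≠ 0) (htop : ∀ p ∈ B, g p ≠ ∞)
    (hle : ∀ A ⊆ B, ∀ t : ℝ≥0, (∀ p ∈ A, g p < t) → μ A ≤ t * ν A)
    (hge : ∀ A ⊆ B, ∀ t : ℝ≥0, (∀ p ∈ A, t < g p) → t * ν A ≤ μ A)
    (hB : MeasurableSet B) : μ B = ∫⁻ p in B, g p ∂ν := by
  rw [← withDensity_apply g hB]
  have hlim : ∀ (c : ℝ≥0∞) (n : ℕ),
      Tendsto (fun t : ℝ≥0 => (t : ℝ≥0∞) ^ n * c) (𝓝[>] 1) (𝓝 (1 ^ n * c)) := fun c n =>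
    ENNReal.Tendsto.mul_const (ENNReal.Tendsto.pow
      ((ENNReal.tendsto_coe.2 tendsto_id).mono_left nhdsWithin_le_nhds)) (Or.inl (by simp))
  refine le_antisymm ?_ ?_
  · have := ge_of_tendsto (hlim (ν.withDensity g B) 1)
      (eventually_mem_nhdsWithin.mono fun t ht => by
        rw [pow_one]
        exact measure_le_mul_withDensity hg h0 htop hle hB ht)
    rwa [one_pow, one_mul] at this
  · have := ge_of_tendsto (hlim (μ B) 2) (eventually_mem_nhdsWithin.mono fun t ht =>
      withDensity_le_sq_mul_measure hg h0 htop hge hB ht)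
    rwa [one_pow, one_mul] at this

end Radon

theorem measure_eq_setLIntegral_upperDensity {X : Type u} [MetricSpace X] [MeasurableSpace X]
    [BorelSpace X] {k : MeasureKind} {d : ℝ} (hd : 0 ≤ d) {μ : Measure X} [μ.OuterRegular]
    {B : Set X} (hB : MeasurableSet B) (h0 : ∀ p ∈ B, upperDensity k d μ p ≠ 0)
    (htop : ∀ p ∈ B, upperDensity k d μ p ≠ ∞) :
    μ B = ∫⁻ p in B, upperDensity k d μ p ∂psi k d :=
  measure_eq_setLIntegral_of_forall_le (measurable_upperDensity k d μ) h0 htop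
    (fun _ _ _ => measure_le_mul_psi hd) (fun _ _ _ => mul_psi_le_measure hd) hB

/-! ### The projection onto a subgroup along a complementary one -/

section Projection

variable {G : Type u} [CarnotGroup G] {P W V : Subgroup G}

namespace Complementary

/-- The projection onto `P` along `V`. It is viewed as a map from `G` to `G`. -/
noncomputable def fst (h : Complementary P V) (g : G) : G := (h.1 g).choose

theorem fst_mem (h : Complementary P V) (g : G) : h.fst g ∈ P := (h.1 g).choose_spec.1

theorem inv_fst_mul_mem (h : Complementary P V) (g : G) : (h.fst g)⁻¹ * g ∈ V := by
  obtain ⟨v, hv, hg⟩ := (h.1 g).choose_spec.2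
  have hgv : (h.fst g)⁻¹ * g = v := inv_mul_eq_iff_eq_mul.2 hg
  rwa [hgv]

theorem eq_of_inv_mul_mem (h : Complementary P V) {p q : G} (hp : p ∈ P) (hq : q ∈ P)
    (hpq : p⁻¹ * q ∈ V) : p = q := by
  have hbot : p⁻¹ * q ∈ P ⊓ V := ⟨P.mul_mem (P.inv_mem hp) hq, hpq⟩
  rwa [h.2, Subgroup.mem_bot, inv_mul_eq_one] at hbot

theorem fst_eq (h : Complementary P V) {g p : G} (hp : p ∈ P) (hg : p⁻¹ * g ∈ V) : h.fst g = p := by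
  refine h.eq_of_inv_mul_mem (h.fst_mem g) hp ?_
  have := V.mul_mem (h.inv_fst_mul_mem g) (V.inv_mem hg)
  rwa [mul_inv_rev, inv_inv, mul_assoc, mul_inv_cancel_left] at this

theorem fst_mul_right (h : Complementary P V) (g : G) {v : G} (hv : v ∈ V) :
    h.fst (g * v) = h.fst g :=
  h.fst_eq (h.fst_mem g) (by rw [← mul_assoc]; exact V.mul_mem (h.inv_fst_mul_mem g) hv)

theorem fst_of_mem (h : Complementary P V) {p : G} (hp : p ∈ P) : h.fst p = p :=
  h.fst_eq hp (by rw [inv_mul_cancel]; exact V.one_mem)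

theorem fst_mul (h : Complementary P V) {p v : G} (hp : p ∈ P) (hv : v ∈ V) :
    h.fst (p * v) = p := by
  rw [h.fst_mul_right p hv, h.fst_of_mem hp]

theorem fst_one (h : Complementary P V) : h.fst 1 = 1 := h.fst_of_mem P.one_mem

theorem fst_of_mem_right (h : Complementary P V) {v : G} (hv : v ∈ V) : h.fst v = 1 :=
  h.fst_eq P.one_mem (by rwa [inv_one, one_mul])

theorem fst_eq_fst_iff (h : Complementary W V) {x y : G} : h.fst x = h.fst y ↔ x⁻¹ * y ∈ V := by
  constructor
  · intro hxy
    have := V.mul_mem (V.inv_mem (h.inv_fst_mul_mem x)) (h.inv_fst_mul_mem y)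
    rwa [hxy, mul_inv_rev, inv_inv, mul_assoc, mul_inv_cancel_left] at this
  · intro hxy
    rw [← h.fst_mul_right x hxy, mul_inv_cancel_left]

theorem injOn_fst (h : Complementary W V) (hP : Complementary P V) : InjOn h.fst P :=
  fun _ hx _ hy hxy => hP.eq_of_inv_mul_mem hx hy (h.fst_eq_fst_iff.1 hxy)

theorem fst_fst (h : Complementary W V) (hP : Complementary P V) (g : G) :
    h.fst (hP.fst g) = h.fst g :=
  h.fst_eq_fst_iff.2 (hP.inv_fst_mul_mem g)

theorem fst_mul_left (h : Complementary W V) (hW : W.Normal) (g x : G) :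
    h.fst (g * x) = h.fst g * (((h.fst g)⁻¹ * g) * h.fst x * ((h.fst g)⁻¹ * g)⁻¹) := by
  refine h.fst_eq (W.mul_mem (h.fst_mem g) (hW.conj_mem _ (h.fst_mem x) _)) ?_
  convert V.mul_mem (h.inv_fst_mul_mem g) (h.inv_fst_mul_mem x) using 1
  group

theorem fst_dil (h : Complementary P V) (hP : IsHomogeneous P) (hV : IsHomogeneous V) {t : ℝ}
    (ht : 0 < t) (g : G) : h.fst (dil t g) = dil t (h.fst g) := by
  refine h.fst_eq (hP.dil_mem ht (h.fst_mem g)) ?_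
  rw [← dil_inv, ← dil_mul]
  exact hV.dil_mem ht (h.inv_fst_mul_mem g)

theorem disjoint_sphere (h : Complementary P V) :
    Disjoint ((P : Set G) ∩ Metric.sphere 1 1) (V : Set G) := by
  refine Set.disjoint_left.2 fun x hx hxV => ?_
  have hbot : x ∈ P ⊓ V := ⟨hx.1, hxV⟩
  rw [h.2, Subgroup.mem_bot] at hbot
  have hsphere := hx.2
  rw [hbot, Metric.mem_sphere, dist_self] at hsphere
  exact zero_ne_one hsphere

/-- By homogeneity, the bound reduces to the positive distance of `V` from the unit sphere of
`P`. -/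
theorem exists_gnorm_fst_le (h : Complementary P V) (hP : IsHomogeneous P) (hV : IsHomogeneous V) :
    ∃ C > 0, ∀ g : G, gnorm (h.fst g) ≤ C * gnorm g := by
  have hK : IsCompact ((P : Set G) ∩ Metric.sphere 1 1) :=
    (isCompact_sphere _ _).inter_left hP.isClosed
  obtain ⟨r, hr, hrV⟩ := Metric.exists_pos_forall_lt_edist hK hV.isClosed h.disjoint_sphere
  have hr' : (0 : ℝ) < r := hr
  refine ⟨(r : ℝ)⁻¹, by positivity, fun g => ?_⟩
  rcases (gnorm_nonneg (h.fst g)).eq_or_lt with h0 | h0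
  · rw [← h0]
    exact mul_nonneg (by positivity) (gnorm_nonneg g)
  set R := gnorm (h.fst g) with hR
  have hRi : 0 < R⁻¹ := inv_pos.2 h0
  have hunit : (dil R⁻¹ (h.fst g))⁻¹ ∈ (P : Set G) ∩ Metric.sphere 1 1 := by
    refine ⟨P.inv_mem (hP.dil_mem hRi (h.fst_mem g)), ?_⟩
    rw [Metric.mem_sphere, dist_comm]
    change gnorm _ = 1
    rw [gnorm_inv, gnorm_dil hRi, ← hR, inv_mul_cancel₀ h0.ne']
  have hlt := hrV _ hunit (dil R⁻¹ ((h.fst g)⁻¹ * g)) (hV.dil_mem hRi (h.inv_fst_mul_mem g))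
  rw [edist_dist, dist_eq_gnorm, inv_inv, ← dil_mul, mul_inv_cancel_left, gnorm_dil hRi,
    ← ENNReal.ofReal_coe_nnreal, ENNReal.ofReal_lt_ofReal_iff_of_nonneg r.coe_nonneg,
    lt_inv_mul_iff₀ h0] at hlt
  rw [← div_eq_inv_mul, le_div_iff₀ hr']
  exact hlt.le

theorem continuous_fst (h : Complementary P V) (hP : IsHomogeneous P) (hV : IsHomogeneous V) :
    Continuous h.fst := by
  obtain ⟨C, hC, hbound⟩ := h.exists_gnorm_fst_le hP hV
  refine continuous_iff_continuousAt.2 fun g => ?_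
  have hK : IsCompact (Metric.closedBall (1 : G) (C * (gnorm g + 1))) := isCompact_closedBall _ _
  refine hK.tendsto_nhds_of_unique_mapClusterPt ?_ fun y _ hy => ?_
  · have hlt : ∀ᶠ x in 𝓝 g, gnorm x < gnorm g + 1 :=
      continuous_gnorm.continuousAt.eventually_lt continuousAt_const (by linarith)
    filter_upwards [hlt] with x hx
    rw [mem_closedBall_one]
    exact (hbound x).trans (by gcongr)
  · obtain ⟨U, hU, hUy⟩ := mapClusterPt_iff_ultrafilter.1 hy
    have hyP : y ∈ P := hP.isClosed.mem_of_tendsto hUy (Eventually.of_forall fun x => h.fst_mem x)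
    have hyV : y⁻¹ * g ∈ V := hV.isClosed.mem_of_tendsto (hUy.inv.mul (tendsto_id.mono_left hU))
      (Eventually.of_forall fun x => h.inv_fst_mul_mem x)
    exact (h.fst_eq hyP hyV).symm

end Complementary

end Projection

/-! ### Haar measures of normal homogeneous subgroups -/

/-- `τ` is the image in `G` of a Haar measure on the normal homogeneous subgroup `W` of homogeneous
dimension `d`. The measure is not required to vanish outside `W`; all sets it is applied to
are subsets of `W`. -/
structure IsHomogeneousHaar {G : Type u} [CarnotGroup G] [MeasurableSpace G] (W : Subgroup G)
    (d : ℝ) (τ : Measure G) : Prop where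
  finite : IsFiniteMeasureOnCompacts τ
  nonneg : 0 ≤ d
  mul_left : ∀ w ∈ W, ∀ E : Set G, τ ((fun x => w * x) '' E) = τ E
  conj : ∀ (g : G) (E : Set G), τ ((fun x => g * x * g⁻¹) '' E) = τ E
  dil : ∀ t : ℝ, 0 < t → ∀ E : Set G, τ ((dil t : G → G) '' E) = ENNReal.ofReal t ^ d * τ E
  ne_zero : τ W ≠ 0

section Haar

variable {G : Type u} [CarnotGroup G]

/-- The dilation of ratio `t > 0` as a homeomorphism. -/
noncomputable def dilHomeo (t : ℝ) (ht : 0 < t) : G ≃ₜ G where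
  toFun := dil t
  invFun := dil t⁻¹
  left_inv x := by rw [dil_dil, inv_mul_cancel₀ ht.ne', dil_one_left]
  right_inv x := by rw [dil_dil, mul_inv_cancel₀ ht.ne', dil_one_left]
  continuous_toFun := continuous_linearMap _
  continuous_invFun := continuous_linearMap _

theorem dil_image_closedBall {r : ℝ} (hr : 0 < r) :
    (dil r : G → G) '' Metric.closedBall 1 1 = Metric.closedBall 1 r := by
  ext x
  have hpre : (dil r : G → G) '' Metric.closedBall 1 1 = dil r⁻¹ ⁻¹' Metric.closedBall 1 1 :=
    (dilHomeo r hr).toEquiv.image_eq_preimage_symm _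
  rw [hpre, mem_preimage]
  rw [mem_closedBall_one, mem_closedBall_one, gnorm_dil (inv_pos.2 hr), inv_mul_le_iff₀ hr, mul_one]

theorem gnorm_le_gnorm_conj_add (g x : G) : gnorm x ≤ gnorm (g * x * g⁻¹) + 2 * gnorm g := by
  calc gnorm x = gnorm (g⁻¹ * (g * x * g⁻¹) * g) := by group
    _ ≤ gnorm g⁻¹ + gnorm (g * x * g⁻¹) + gnorm g :=
      (gnorm_mul_le _ _).trans (add_le_add_left (gnorm_mul_le _ _) _)
    _ = gnorm (g * x * g⁻¹) + 2 * gnorm g := by rw [gnorm_inv]; ring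

theorem le_one_of_forall_le_rpow {c : ℝ≥0∞} {a d : ℝ}
    (hc : ∀ r : ℝ, 0 < r → c ≤ ENNReal.ofReal ((r + a) / r) ^ d) : c ≤ 1 := by
  have hratio : Tendsto (fun r : ℝ => (r + a) / r) atTop (𝓝 1) := by
    have : Tendsto (fun r : ℝ => 1 + a / r) atTop (𝓝 (1 + 0)) :=
      tendsto_const_nhds.add (tendsto_const_nhds.div_atTop tendsto_id)
    rw [add_zero] at this
    refine this.congr' ?_
    filter_upwards [eventually_gt_atTop 0] with r hr
    rw [add_div, div_self hr.ne']
  have hlim := ((ENNReal.continuous_rpow_const (y := d).comp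
    ENNReal.continuous_ofReal).tendsto 1).comp hratio
  simp only [Function.comp_def, ENNReal.ofReal_one, ENNReal.one_rpow] at hlim
  exact ge_of_tendsto hlim ((eventually_gt_atTop 0).mono hc)

section Conj

variable {W : Subgroup G}

theorem continuous_conjNormal [W.Normal] (g : G) : Continuous (MulAut.conjNormal g : W ≃* W) :=
  Continuous.subtype_mk ((continuous_const.mul continuous_subtype_val).mul continuous_const) _

theorem conjNormal_preimage_closedBall_subset [W.Normal] (g : G) (r : ℝ) :
    (MulAut.conjNormal g : W ≃* W) ⁻¹' Metric.closedBall 1 r ⊆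
      Metric.closedBall 1 (r + 2 * gnorm g) := by
  intro w hw
  have hconj : g * w * g⁻¹ ∈ Metric.closedBall (1 : G) r := hw
  change (w : G) ∈ Metric.closedBall (1 : G) _
  rw [mem_closedBall_one] at hconj ⊢
  linarith [gnorm_le_gnorm_conj_add g (w : G)]

theorem isCompact_closedBall_one_subgroup (hW : IsClosed (W : Set G)) :
    IsCompact (Metric.closedBall (1 : W) 1) :=
  hW.isClosedEmbedding_subtypeVal.isCompact_preimage (isCompact_closedBall (1 : G) 1)

variable [MeasurableSpace G] [BorelSpace G] {d : ℝ} {θ : Measure W} [θ.IsHaarMeasure]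

omit [BorelSpace G] in
theorem nonneg_of_measure_closedBall (hW : IsClosed (W : Set G))
    (hball : ∀ r : ℝ, 0 < r → θ (Metric.closedBall 1 r) =
      ENNReal.ofReal r ^ d * θ (Metric.closedBall 1 1)) : 0 ≤ d := by
  by_contra! hneg
  have hle : θ (Metric.closedBall 1 1) ≤ θ (Metric.closedBall 1 2) :=
    measure_mono (Metric.closedBall_subset_closedBall one_le_two)
  rw [hball 2 two_pos] at hle
  have hlt : ENNReal.ofReal 2 ^ d < 1 := by
    refine ENNReal.rpow_lt_one_of_one_lt_of_neg ?_ hneg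
    rw [← ENNReal.ofReal_one, ENNReal.ofReal_lt_ofReal_iff two_pos]
    exact one_lt_two
  have hmul := (ENNReal.mul_lt_mul_iff_left (Metric.measure_closedBall_pos θ 1 one_pos).ne'
    (isCompact_closedBall_one_subgroup hW).measure_ne_top).2 hlt
  exact hle.not_gt (hmul.trans_eq (one_mul _))

/-- By uniqueness of Haar measures, conjugation by `g` multiplies `θ` by a constant; comparing large
balls shows that it is at most `1`. -/
theorem map_conjNormal_le [W.Normal] (hW : IsClosed (W : Set G))
    (hball : ∀ r : ℝ, 0 < r → θ (Metric.closedBall 1 r) =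
      ENNReal.ofReal r ^ d * θ (Metric.closedBall 1 1)) (g : G) :
    θ.map (MulAut.conjNormal g : W ≃* W) ≤ θ := by
  have : LocallyCompactSpace W := hW.locallyCompactSpace
  have hsymm : Continuous (MulAut.conjNormal g : W ≃* W).symm := by
    have := continuous_conjNormal (W := W) g⁻¹
    rwa [map_inv] at this
  have : (θ.map (MulAut.conjNormal g : W ≃* W)).IsHaarMeasure :=
    MulEquiv.isHaarMeasure_map θ _ (continuous_conjNormal g) hsymm
  have heq := Measure.isMulLeftInvariant_eq_smul (θ.map (MulAut.conjNormal g : W ≃* W)) θ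
  set c := Measure.haarScalarFactor (θ.map (MulAut.conjNormal g : W ≃* W)) θ
  have hc : (c : ℝ≥0∞) ≤ 1 := le_one_of_forall_le_rpow (a := 2 * gnorm g) (d := d) fun r hr => by
    have hr' : 0 < r + 2 * gnorm g := by linarith [gnorm_nonneg g]
    have hle := measure_mono (μ := θ) (conjNormal_preimage_closedBall_subset g r)
    rw [← Measure.map_apply (continuous_conjNormal g).measurable
      Metric.isClosed_closedBall.measurableSet, heq] at hle
    change c * θ (Metric.closedBall 1 r) ≤ _ at hle
    rw [hball r hr, hball _ hr', ← mul_assoc, ENNReal.mul_le_mul_iff_left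
      (Metric.measure_closedBall_pos θ 1 one_pos).ne'
      (isCompact_closedBall_one_subgroup hW).measure_ne_top] at hle
    rwa [ENNReal.ofReal_div_of_pos hr,
      ENNReal.div_rpow_of_nonneg _ _ (nonneg_of_measure_closedBall hW hball),
      ENNReal.le_div_iff_mul_le (Or.inl (ofReal_rpow_ne_zero hr d))
        (Or.inl (ofReal_rpow_ne_top hr d))]
  rw [heq]
  refine Measure.le_iff.2 fun s _ => ?_
  change c * θ s ≤ θ s
  exact mul_le_of_le_one_left zero_le hc

theorem map_conjNormal_eq [W.Normal] (hW : IsClosed (W : Set G))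
    (hball : ∀ r : ℝ, 0 < r → θ (Metric.closedBall 1 r) =
      ENNReal.ofReal r ^ d * θ (Metric.closedBall 1 1)) (g : G) :
    θ.map (MulAut.conjNormal g : W ≃* W) = θ := by
  refine le_antisymm (map_conjNormal_le hW hball g) ?_
  have hid : (MulAut.conjNormal g : W ≃* W) ∘ (MulAut.conjNormal g⁻¹ : W ≃* W) = id := by
    ext w
    simp
  have hle := Measure.map_mono (map_conjNormal_le hW hball g⁻¹) (continuous_conjNormal g).measurable
  rwa [Measure.map_map (continuous_conjNormal g).measurable (continuous_conjNormal g⁻¹).measurable,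
    hid, Measure.map_id] at hle

end Conj

variable [MeasurableSpace G] [BorelSpace G]

theorem measure_image_of_map_eq {X : Type*} [TopologicalSpace X] [MeasurableSpace X]
    [BorelSpace X] {τ : Measure X} (f : X ≃ₜ X) (hf : τ.map f = τ) (E : Set X) :
    τ (f '' E) = τ E := by
  have h := (⟨f.measurable, hf⟩ : MeasurePreserving f.toMeasurableEquiv τ τ).measure_preimage_equiv
    (f '' E)
  rw [← h]
  exact congrArg τ (f.injective.preimage_image E)

theorem measure_dil_image {τ : Measure G} {d t : ℝ} (ht : 0 < t)
    (hτ : τ.map (dil t : G → G) = ENNReal.ofReal (t ^ (-d)) • τ) (E : Set G) :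
    τ ((dil t : G → G) '' E) = ENNReal.ofReal t ^ d * τ E := by
  have h := (dilHomeo (G := G) t ht).toMeasurableEquiv.map_apply (μ := τ) ((dil t : G → G) '' E)
  change τ.map (dil t : G → G) _ = τ ((dil t : G → G) ⁻¹' _) at h
  have hinj : Function.Injective (dil t : G → G) := (dilHomeo (G := G) t ht).injective
  rw [hinj.preimage_image, hτ, Measure.smul_apply, smul_eq_mul,
    ← ENNReal.ofReal_rpow_of_pos ht, ENNReal.rpow_neg] at h
  rw [← h, ← mul_assoc, ENNReal.mul_inv_cancel (ofReal_rpow_ne_zero ht d) (ofReal_rpow_ne_top ht d),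
    one_mul]

theorem IsSplitting.exists_isHomogeneousHaar {W V : Subgroup G} (hWV : IsSplitting W V) {d : ℝ}
    (hd : IsHomogeneousDimension W d) : ∃ τ : Measure G, IsHomogeneousHaar W d τ := by
  obtain ⟨θ, hH, hθ⟩ := hd
  have := hWV.normal
  have hW := hWV.homogeneous_left.isClosed
  have hemb : MeasurableEmbedding (Subtype.val : W → G) :=
    MeasurableEmbedding.subtype_coe hW.measurableSet
  set τ := θ.map (Subtype.val : W → G) with hτ
  have hdil : ∀ t : ℝ, 0 < t → ∀ E : Set G,
      τ ((dil t : G → G) '' E) = ENNReal.ofReal t ^ d * τ E :=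
    fun t ht E => measure_dil_image ht (hθ t ht) E
  have hτball : ∀ r, τ (Metric.closedBall 1 r) = θ (Metric.closedBall 1 r) :=
    fun r => hemb.map_apply θ _
  have hball : ∀ r : ℝ, 0 < r → θ (Metric.closedBall 1 r) =
      ENNReal.ofReal r ^ d * θ (Metric.closedBall 1 1) := fun r hr => by
    rw [← hτball, ← hτball, ← hdil r hr, dil_image_closedBall hr]
  refine ⟨τ, ⟨fun K hK => ?_⟩, nonneg_of_measure_closedBall hW hball, fun w hw E => ?_,
    fun g E => ?_, hdil, fun h0 => ?_⟩
  · rw [hτ, hemb.map_apply]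
    exact (hW.isClosedEmbedding_subtypeVal.isCompact_preimage hK).measure_lt_top
  · refine measure_image_of_map_eq (Homeomorph.mulLeft w) ?_ E
    change (θ.map Subtype.val).map (fun x => w * x) = θ.map Subtype.val
    rw [Measure.map_map (measurable_const_mul w) hemb.measurable,
      show (fun x => w * x) ∘ (Subtype.val : W → G) = Subtype.val ∘ fun x : W => (⟨w, hw⟩ : W) * x
        from rfl,
      ← Measure.map_map hemb.measurable (measurable_const_mul _), map_mul_left_eq_self]
  · let f : G ≃ₜ G := (Homeomorph.mulLeft g).trans (Homeomorph.mulRight g⁻¹)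
    refine measure_image_of_map_eq f ?_ E
    rw [hτ, Measure.map_map f.continuous.measurable hemb.measurable,
      show f ∘ (Subtype.val : W → G) = Subtype.val ∘ (MulAut.conjNormal g : W ≃* W) from rfl,
      ← Measure.map_map hemb.measurable (continuous_conjNormal g).measurable,
      map_conjNormal_eq hW hball g]
  · rw [hτ, hemb.map_apply] at h0
    exact (Metric.measure_closedBall_pos θ 1 one_pos).ne' (measure_mono_null (fun x _ => x.2) h0)

end Haar

/-! ### The area factor -/

section AreaFactor

variable {G : Type u} [CarnotGroup G]

theorem Admissible.mul_left {k : MeasureKind} {E : Set G} {s : ℝ} (h : Admissible k E s) (g : G) :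
    Admissible k ((fun x => g * x) '' E) s := by
  have := h.image zero_le_one (f := fun x => g * x) fun x y => by rw [dist_mul_left, one_mul]
  rwa [one_mul] at this

theorem Admissible.dil {k : MeasureKind} {E : Set G} {s t : ℝ} (h : Admissible k E s)
    (ht : 0 < t) : Admissible k ((dil t : G → G) '' E) (t * s) :=
  h.image ht.le fun x y => dist_dil ht x y

variable {W V P : Subgroup G}

theorem IsHomogeneous.dil_image_inter (hP : IsHomogeneous P) {t : ℝ} (ht : 0 < t) (E : Set G) :
    (dil t : G → G) '' (E ∩ P) = (dil t : G → G) '' E ∩ P := by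
  have hinj : Function.Injective (dil t : G → G) := (dilHomeo (G := G) t ht).injective
  rw [image_inter hinj, hP t ht]

namespace IsHomogeneousGraph

variable {φ : W → V}

theorem mul_mem (h : IsHomogeneousGraph P φ) (w : W) : (w : G) * φ w ∈ P :=
  h.2.superset (mem_range_self w)

theorem exists_eq_mul (h : IsHomogeneousGraph P φ) {p : G} (hp : p ∈ P) :
    ∃ w : W, (w : G) * φ w = p :=
  h.2.subset hp

theorem mem_complements (h : IsHomogeneousGraph P φ) (hWV : Complementary W V) :
    P ∈ complements V := by
  refine ⟨h.1, fun g => ?_, ?_⟩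
  · obtain ⟨w, hw, v, hv, rfl⟩ := hWV.1 g
    exact ⟨w * φ ⟨w, hw⟩, h.mul_mem ⟨w, hw⟩, (φ ⟨w, hw⟩ : G)⁻¹ * v,
      V.mul_mem (V.inv_mem (φ _).2) hv, by group⟩
  · have hφ : ∀ x ∈ P ⊓ V, x = φ 1 := by
      rintro x ⟨hx, hxV⟩
      obtain ⟨w, rfl⟩ := h.exists_eq_mul hx
      have hw : (w : G) = 1 := by
        rw [← hWV.fst_mul w.2 (φ w).2, hWV.fst_of_mem_right hxV]
      rw [hw, one_mul, show w = 1 from Subtype.ext hw]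
    refine (Subgroup.eq_bot_iff_forall _).2 fun x hx => ?_
    rw [hφ x hx, ← hφ 1 (one_mem _)]

theorem mul_eq_fst (h : IsHomogeneousGraph P φ) (hP : Complementary P V) (w : W) :
    (w : G) * φ w = hP.fst w := by
  rw [← hP.fst_of_mem (h.mul_mem w), hP.fst_mul_right _ (φ w).2]

end IsHomogeneousGraph

namespace IsSplitting

variable (hWV : IsSplitting W V)

/-- The projection onto `W` along `V`. -/
noncomputable abbrev proj : G → G := hWV.complementary.fst

theorem continuous_proj : Continuous hWV.proj :=
  hWV.complementary.continuous_fst hWV.homogeneous_left hWV.homogeneous_right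

include hWV in
theorem left_mem_complements : W ∈ complements V :=
  ⟨hWV.homogeneous_left, hWV.complementary⟩

theorem proj_dil {t : ℝ} (ht : 0 < t) (x : G) : hWV.proj (dil t x) = dil t (hWV.proj x) :=
  hWV.complementary.fst_dil hWV.homogeneous_left hWV.homogeneous_right ht x

variable [MeasurableSpace G] {d : ℝ} {τ : Measure G}

theorem measure_proj_image_mul (hτ : IsHomogeneousHaar W d τ) (g : G) (E : Set G) :
    τ (hWV.proj '' ((fun x => g * x) '' E)) = τ (hWV.proj '' E) := by
  have h : hWV.proj '' ((fun x => g * x) '' E) = (fun x => hWV.proj g * x) ''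
      ((fun x => ((hWV.proj g)⁻¹ * g) * x * ((hWV.proj g)⁻¹ * g)⁻¹) '' (hWV.proj '' E)) := by
    simp only [image_image, hWV.complementary.fst_mul_left hWV.normal g]
  rw [h, hτ.mul_left _ (hWV.complementary.fst_mem g), hτ.conj]

theorem measure_proj_image_dil (hτ : IsHomogeneousHaar W d τ) {t : ℝ} (ht : 0 < t) (E : Set G) :
    τ (hWV.proj '' ((dil t : G → G) '' E)) = ENNReal.ofReal t ^ d * τ (hWV.proj '' E) := by
  rw [← hτ.dil t ht, image_image, image_image]
  simp only [hWV.proj_dil ht]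

/-- The `ψ^d`-density at the points of `P` of the measure that `τ` induces on `P` by means of the
projection onto `W`. By homogeneity, only sets of size one that contain the unit matter. -/
noncomputable def areaDensity (τ : Measure G) (k : MeasureKind) (P : Subgroup G) : ℝ≥0∞ :=
  ⨆ (E : Set G) (_ : 1 ∈ E ∧ Admissible k E 1), τ (hWV.proj '' (E ∩ P))

variable {k : MeasureKind}

theorem measure_le_areaDensity {E : Set G} (h1 : 1 ∈ E) (hE : Admissible k E 1) :
    τ (hWV.proj '' (E ∩ P)) ≤ hWV.areaDensity τ k P :=
  le_iSup₂_of_le (f := fun (E : Set G) (_ : 1 ∈ E ∧ Admissible k E 1) => τ (hWV.proj '' (E ∩ P)))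
    E ⟨h1, hE⟩ le_rfl

theorem measure_le_areaDensity_mul (hτ : IsHomogeneousHaar W d τ) (hP : IsHomogeneous P)
    {E : Set G} {s : ℝ} (h1 : 1 ∈ E) (hs : 0 < s) (hE : Admissible k E s) :
    τ (hWV.proj '' (E ∩ P)) ≤ hWV.areaDensity τ k P * ENNReal.ofReal s ^ d := by
  have hE' : Admissible k ((dil s⁻¹ : G → G) '' E) 1 := by
    have := hE.dil (inv_pos.2 hs)
    rwa [inv_mul_cancel₀ hs.ne'] at this
  have h : (dil s : G → G) '' ((dil s⁻¹ : G → G) '' E ∩ P) = E ∩ P := by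
    simp only [hP.dil_image_inter hs, image_image, dil_dil, mul_inv_cancel₀ hs.ne', dil_one_left,
      image_id']
  rw [← h, hWV.measure_proj_image_dil hτ hs, mul_comm]
  gcongr
  exact hWV.measure_le_areaDensity ⟨1, h1, dil_one_right _⟩ hE'

theorem exists_lt_of_lt_areaDensity {t : ℝ≥0∞} (ht : t < hWV.areaDensity τ k P) :
    ∃ E : Set G, 1 ∈ E ∧ Admissible k E 1 ∧ t < τ (hWV.proj '' (E ∩ P)) := by
  simp only [areaDensity, lt_iSup_iff] at ht
  obtain ⟨E, hE, h⟩ := ht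
  exact ⟨E, hE.1, hE.2, h⟩

theorem areaDensity_ne_top (hτ : IsHomogeneousHaar W d τ) : hWV.areaDensity τ k P ≠ ∞ := by
  have := hτ.finite
  refine ne_top_of_le_ne_top (IsCompact.measure_ne_top (μ := τ)
    ((isCompact_closedBall (1 : G) 1).image hWV.continuous_proj))
    (iSup₂_le fun E hE => measure_mono ?_)
  exact image_mono fun x hx => hE.2.dist_le hx.1 hE.1

theorem areaDensity_ne_zero (hτ : IsHomogeneousHaar W d τ) (hP : P ∈ complements V) :
    hWV.areaDensity τ k P ≠ 0 := by
  intro h0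
  refine hτ.ne_zero (measure_mono_null (t := ⋃ n : ℕ, hWV.proj ''
    (Metric.closedBall 1 ((n : ℝ) + 1) ∩ P)) ?_ (measure_iUnion_null fun n => ?_))
  · intro w hw
    obtain ⟨n, hn⟩ := exists_nat_ge (gnorm (hP.2.fst w))
    refine mem_iUnion.2 ⟨n, hP.2.fst w, ⟨mem_closedBall_one.2 (by linarith), hP.2.fst_mem w⟩, ?_⟩
    rw [proj, Complementary.fst_fst, Complementary.fst_of_mem _ hw]
  · have hn : (0 : ℝ) < (n : ℝ) + 1 := by positivity
    have := hWV.measure_le_areaDensity_mul hτ hP.1 (Metric.mem_closedBall_self hn.le)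
      (by positivity) (Admissible.closedBall k (1 : G) ((n : ℝ) + 1))
    rwa [h0, zero_mul, nonpos_iff_eq_zero] at this

/-- The area factor `𝒜(P)` of the splitting, for the measure `ψ^d` of kind `k`. It does not depend
on the Haar measure `τ`. -/
noncomputable def areaFactor (τ : Measure G) (k : MeasureKind) (P : Subgroup G) : ℝ≥0 :=
  (hWV.areaDensity τ k W / hWV.areaDensity τ k P).toNNReal

theorem coe_areaFactor (hτ : IsHomogeneousHaar W d τ) (hP : P ∈ complements V) :
    (hWV.areaFactor τ k P : ℝ≥0∞) = hWV.areaDensity τ k W / hWV.areaDensity τ k P :=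
  ENNReal.coe_toNNReal (ENNReal.div_ne_top (hWV.areaDensity_ne_top hτ)
    (hWV.areaDensity_ne_zero hτ hP))

theorem areaFactor_pos (hτ : IsHomogeneousHaar W d τ) (hP : P ∈ complements V) :
    0 < hWV.areaFactor τ k P := by
  rw [← ENNReal.coe_pos, hWV.coe_areaFactor hτ hP]
  exact ENNReal.div_pos (hWV.areaDensity_ne_zero hτ hWV.left_mem_complements)
    (hWV.areaDensity_ne_top hτ)

theorem inv_areaFactor (hτ : IsHomogeneousHaar W d τ) (hP : P ∈ complements V) :
    (hWV.areaFactor τ k P : ℝ≥0∞)⁻¹ =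
      (hWV.areaDensity τ k W)⁻¹ * hWV.areaDensity τ k P := by
  rw [hWV.coe_areaFactor hτ hP, ENNReal.inv_div (Or.inl (hWV.areaDensity_ne_top hτ))
    (Or.inl (hWV.areaDensity_ne_zero hτ hP)), ENNReal.div_eq_inv_mul]

section Continuity

variable {P' : Subgroup G} {φ φ' : W → V} {δ : ℝ}

/-- A test set for `P`, thickened by `δ`, is a test set for `P'`. -/
theorem areaDensity_le_of_dist_lt (hτ : IsHomogeneousHaar W d τ)
    (h : IsHomogeneousGraph P φ) (h' : IsHomogeneousGraph P' φ') (hδ : 0 < δ)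
    (hφ : ∀ w : W, (∃ v ∈ V, (w : G) * v ∈ Metric.closedBall (0 : G) 1) →
        dist (φ w : G) (φ' w : G) < δ) :
    hWV.areaDensity τ k P ≤ hWV.areaDensity τ k P' * ENNReal.ofReal (1 + 2 * δ) ^ d := by
  refine iSup₂_le fun E hE => ?_
  refine le_trans (measure_mono ?_) (hWV.measure_le_areaDensity_mul hτ h'.1
    (E := {y | ∃ x ∈ E, dist y x ≤ δ}) ⟨1, hE.1, by rw [dist_self]; exact hδ.le⟩ (by positivity)
    (hE.2.thicken δ))
  rintro _ ⟨p, ⟨hpE, hp⟩, rfl⟩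
  obtain ⟨w, rfl⟩ := h.exists_eq_mul hp
  refine ⟨w * φ' w, ⟨⟨_, hpE, ?_⟩, h'.mul_mem w⟩, ?_⟩
  · rw [dist_mul_left, dist_comm]
    refine (hφ w ⟨_, (φ w).2, ?_⟩).le
    rw [← one_eq_zero]
    exact hE.2.dist_le hpE hE.1
  · rw [proj, hWV.complementary.fst_mul w.2 (φ' w).2, hWV.complementary.fst_mul w.2 (φ w).2]

theorem areaFactor_le_of_dist_lt (hτ : IsHomogeneousHaar W d τ)
    (h : IsHomogeneousGraph P φ) (h' : IsHomogeneousGraph P' φ') (hδ : 0 < δ)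
    (hφ : ∀ w : W, (∃ v ∈ V, (w : G) * v ∈ Metric.closedBall (0 : G) 1) →
        dist (φ w : G) (φ' w : G) < δ) :
    (hWV.areaFactor τ k P' : ℝ) ≤ hWV.areaFactor τ k P * (1 + 2 * δ) ^ d := by
  have hP := h.mem_complements hWV.complementary
  have hP' := h'.mem_complements hWV.complementary
  have hδ' : 0 < 1 + 2 * δ := by positivity
  have hinv : (hWV.areaDensity τ k P')⁻¹ ≤
      ENNReal.ofReal (1 + 2 * δ) ^ d / hWV.areaDensity τ k P := by
    rw [← ENNReal.inv_div (Or.inl (ofReal_rpow_ne_top hδ' d)) (Or.inl (ofReal_rpow_ne_zero hδ' d)),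
      ENNReal.inv_le_inv]
    exact ENNReal.div_le_of_le_mul (hWV.areaDensity_le_of_dist_lt hτ h h' hδ hφ)
  have hle : (hWV.areaFactor τ k P' : ℝ≥0∞) ≤
      hWV.areaFactor τ k P * ENNReal.ofReal (1 + 2 * δ) ^ d := by
    rw [hWV.coe_areaFactor hτ hP, hWV.coe_areaFactor hτ hP', div_eq_mul_inv,
      ENNReal.mul_comm_div]
    gcongr
  have hreal := ENNReal.toReal_mono
    (ENNReal.mul_ne_top ENNReal.coe_ne_top (ofReal_rpow_ne_top hδ' d)) hle
  rwa [ENNReal.toReal_mul, ENNReal.coe_toReal, ENNReal.coe_toReal, ← ENNReal.toReal_rpow,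
    ENNReal.toReal_ofReal hδ'.le] at hreal

theorem isContinuousOnGraphs (hτ : IsHomogeneousHaar W d τ) :
    IsContinuousOnGraphs W V (hWV.areaFactor τ k) := by
  intro P φ h ε hε
  set a := (hWV.areaFactor τ k P : ℝ) with ha
  have hlim : ∀ᶠ δ : ℝ in 𝓝[>] 0, a * (1 + 2 * δ) ^ d * ((1 + 2 * δ) ^ d - 1) < ε := by
    have hc : ContinuousAt (fun δ : ℝ => (1 + 2 * δ) ^ d) 0 :=
      ContinuousAt.rpow_const (by fun_prop) (Or.inl (by norm_num))
    refine (((continuousAt_const.mul hc).mul (hc.sub continuousAt_const)).eventually_lt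
      continuousAt_const ?_).filter_mono nhdsWithin_le_nhds
    simpa using hε
  obtain ⟨δ, hδε, hδ : 0 < δ⟩ := (hlim.and self_mem_nhdsWithin).exists
  refine ⟨δ, hδ, fun P' φ' h' hφ => ?_⟩
  have hc : 1 ≤ (1 + 2 * δ) ^ d := Real.one_le_rpow (by linarith) hτ.nonneg
  set c := (1 + 2 * δ) ^ d
  have h₁ : (hWV.areaFactor τ k P' : ℝ) ≤ a * c := hWV.areaFactor_le_of_dist_lt hτ h h' hδ hφ
  have h₂ : a ≤ hWV.areaFactor τ k P' * c :=
    hWV.areaFactor_le_of_dist_lt hτ h' h hδ fun w hw => by rw [dist_comm]; exact hφ w hw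
  have ha0 : 0 ≤ a := NNReal.coe_nonneg _
  have hsub : 0 ≤ c - 1 := sub_nonneg.2 hc
  have h₃ := mul_le_mul_of_nonneg_right h₁ hsub
  have h₄ := mul_nonneg (mul_nonneg ha0 hsub) hsub
  rw [NNReal.dist_eq, ← ha, abs_lt]
  constructor <;> linarith

end Continuity

variable [BorelSpace G]

/-- The measure that `τ` induces on a graph `S` over a part of `W`. -/
noncomputable def graphMeasure (τ : Measure G) (S : Set G) : Measure G :=
  (τ.comap (S.domRestrict hWV.proj)).map Subtype.val

variable {S : Set G}

theorem graphMeasure_apply (hS : MeasurableSet S) (hinj : InjOn hWV.proj S) (E : Set G) :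
    hWV.graphMeasure τ S E = τ (hWV.proj '' (E ∩ S)) := by
  have hemb := hWV.continuous_proj.continuousOn.measurableEmbedding hS hinj
  rw [graphMeasure, (MeasurableEmbedding.subtype_coe hS).map_apply, hemb.comap_apply,
    domRestrict_eq, image_comp, Subtype.image_preimage_coe, inter_comm]

theorem outerRegular_graphMeasure (hτ : IsHomogeneousHaar W d τ) (hS : MeasurableSet S)
    (hinj : InjOn hWV.proj S) : (hWV.graphMeasure τ S).OuterRegular := by
  have := hτ.finite
  have : IsFiniteMeasureOnCompacts (hWV.graphMeasure τ S) := ⟨fun K hK => by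
    rw [hWV.graphMeasure_apply hS hinj]
    exact (measure_mono (image_mono inter_subset_left)).trans_lt
      (hK.image hWV.continuous_proj).measure_lt_top⟩
  infer_instance

end IsSplitting

end AreaFactor

/-! ### Tangent subgroups -/

section Tangent

variable {G : Type u} [CarnotGroup G]

/-- Near `p`, the set `S` is close to the translate `p T` of a complement `T` of `V`. -/
def HasTangent (V : Subgroup G) (S : Set G) (p : G) (T : Subgroup G) : Prop :=
  ∃ hT : T ∈ complements V, ∀ ε > 0, ∃ r > 0, ∀ q ∈ S, dist p q < r →
    dist (p⁻¹ * q) (hT.2.fst (p⁻¹ * q)) ≤ ε * gnorm (p⁻¹ * q)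

theorem HasTangent.mono {V : Subgroup G} {S S' : Set G} {p : G} {T : Subgroup G}
    (h : HasTangent V S p T) (hS : S' ⊆ S) : HasTangent V S' p T := by
  obtain ⟨hT, h⟩ := h
  refine ⟨hT, fun ε hε => ?_⟩
  obtain ⟨r, hr, h⟩ := h ε hε
  exact ⟨r, hr, fun q hq => h q (hS hq)⟩

theorem exists_pos_forall_lt_imp_lt {X : Type*} [TopologicalSpace X] {K : Set X} (hK : IsCompact K)
    {f g : X → ℝ} (hf : Continuous f) (hg : Continuous g) {ε : ℝ}
    (hpos : ∀ x ∈ K, ε ≤ g x → 0 < f x) : ∃ η > 0, ∀ x ∈ K, f x < η → g x < ε := by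
  obtain ⟨η, hη, h⟩ := (hK.inter_right (isClosed_le continuous_const hg)).exists_forall_le'
    hf.continuousOn fun x hx => hpos x hx.1 hx.2
  exact ⟨η, hη, fun x hx hlt => not_le.1 fun hle => hlt.not_ge (h x ⟨hx, hle⟩)⟩

variable {H : Type v} [CarnotGroup H]

theorem exists_dist_fst_le {L : HomogeneousHom G H} {T V : Subgroup G}
    (hT : T ∈ complements V) (hV : IsHomogeneous V) (hL : (T : Set G) = {x | L.toLieHom x = 0})
    {ε : ℝ} (hε : 0 < ε) :
    ∃ η > 0, ∀ x : G, gnorm (L.toLieHom x) < η * gnorm x → dist x (hT.2.fst x) ≤ ε * gnorm x := by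
  have hker : ∀ x ∈ Metric.sphere (1 : G) 1, ε ≤ dist x (hT.2.fst x) →
      0 < gnorm (L.toLieHom x) := by
    refine fun x _ hx => (gnorm_nonneg _).lt_of_ne' fun h0 => ?_
    rw [gnorm_eq_zero, one_eq_zero] at h0
    have hxT : x ∈ (T : Set G) := by rw [hL]; exact h0
    rw [hT.2.fst_of_mem hxT, dist_self] at hx
    exact hx.not_gt hε
  obtain ⟨η, hη, h⟩ := exists_pos_forall_lt_imp_lt (isCompact_sphere (1 : G) 1)
    (continuous_gnorm.comp L.continuous)
    (continuous_id.dist (hT.2.continuous_fst hT.1 hV)) hker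
  refine ⟨η, hη, fun x hx => ?_⟩
  have hpos : 0 < gnorm x := by
    refine (gnorm_nonneg x).lt_of_ne' fun h0 => ?_
    rw [h0, mul_zero] at hx
    exact hx.not_ge (gnorm_nonneg _)
  have hi := inv_pos.2 hpos
  have hunit : dil (gnorm x)⁻¹ x ∈ Metric.sphere (1 : G) 1 := by
    rw [Metric.mem_sphere, dist_comm]
    exact (gnorm_dil hi x).trans (inv_mul_cancel₀ hpos.ne')
  have hlt : gnorm (L.toLieHom (dil (gnorm x)⁻¹ x)) < η := by
    rwa [L.map_dil, gnorm_dil hi, inv_mul_lt_iff₀ hpos, mul_comm]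
  have hdist : dist (dil (gnorm x)⁻¹ x) (hT.2.fst (dil (gnorm x)⁻¹ x)) < ε := h _ hunit hlt
  rw [hT.2.fst_dil hT.1 hV hi, dist_dil hi, inv_mul_lt_iff₀ hpos, mul_comm] at hdist
  exact hdist.le

variable {S : Set G} {p : G} {T V : Subgroup G}

theorem IsLevelSetNear.hasTangent (h : IsLevelSetNear H S p T) (hp : p ∈ S)
    (hT : T ∈ complements V) (hV : IsHomogeneous V) : HasTangent V S p T := by
  obtain ⟨Ω, f, hΩ, hpΩ, -, ⟨L, hL, -, hker, -⟩, hS⟩ := h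
  have hzero : ∀ q ∈ S, q ∈ Ω → f q = 1 := fun q hq hqΩ => by
    rw [(hS.subset ⟨hq, hqΩ⟩).2, one_eq_zero]
  refine ⟨hT, fun ε hε => ?_⟩
  obtain ⟨η, hη, hLη⟩ := exists_dist_fst_le hT hV hker hε
  have hev : ∀ᶠ q in 𝓝[≠] p,
      dist ((f p)⁻¹ * f q) (L.toLieHom (p⁻¹ * q)) / dist p q < η ∧ q ∈ Ω :=
    (hL.eventually (gt_mem_nhds hη)).and (mem_nhdsWithin_of_mem_nhds (hΩ.mem_nhds hpΩ))
  rw [eventually_nhdsWithin_iff] at hev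
  obtain ⟨r, hr, hball⟩ := Metric.eventually_nhds_iff.1 hev
  refine ⟨r, hr, fun q hq hpq => ?_⟩
  rcases eq_or_ne q p with rfl | hne
  · rw [inv_mul_cancel, hT.2.fst_one, dist_self, gnorm_one, mul_zero]
  obtain ⟨hlt, hqΩ⟩ := hball (by rwa [dist_comm]) hne
  rw [hzero p hp hpΩ, hzero q hq hqΩ, inv_one, mul_one, div_lt_iff₀ (dist_pos.2 hne.symm),
    dist_eq_gnorm p q] at hlt
  exact hLη _ hlt

theorem HasPansuDifferentialAt.continuousAt {f : G → H} {L : HomogeneousHom G H}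
    (h : HasPansuDifferentialAt f L p) : ContinuousAt f p := by
  rw [← continuousWithinAt_compl_self]
  refine tendsto_iff_dist_tendsto_zero.2 ?_
  have hdist : Tendsto (fun x => dist p x) (𝓝[≠] p) (𝓝 0) := by
    have hc : Continuous fun x => dist p x := by fun_prop
    have := hc.tendsto p
    rw [dist_self] at this
    exact this.mono_left nhdsWithin_le_nhds
  have hL : Tendsto (fun x => gnorm (L.toLieHom (p⁻¹ * x))) (𝓝[≠] p) (𝓝 0) := by
    have hc : Continuous fun x => gnorm (L.toLieHom (p⁻¹ * x)) :=
      continuous_gnorm.comp (L.continuous.comp (continuous_const.mul continuous_id))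
    have := hc.tendsto p
    rw [inv_mul_cancel, one_eq_zero, map_zero, ← one_eq_zero, gnorm_one] at this
    exact this.mono_left nhdsWithin_le_nhds
  have hsum := (h.mul hdist).add hL
  rw [mul_zero, add_zero] at hsum
  refine squeeze_zero' (Eventually.of_forall fun x => dist_nonneg) ?_ hsum
  filter_upwards [self_mem_nhdsWithin] with x hx
  rw [div_mul_cancel₀ _ (dist_ne_zero.2 (Ne.symm hx))]
  calc dist (f x) (f p) = dist ((f p)⁻¹ * f x) 1 := by
        rw [dist_comm, dist_eq_gnorm, gnorm, dist_comm]
    _ ≤ dist ((f p)⁻¹ * f x) (L.toLieHom (p⁻¹ * x)) + dist (L.toLieHom (p⁻¹ * x)) 1 :=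
      dist_triangle _ _ _
    _ = _ := by rw [dist_comm _ (1 : H), gnorm]

theorem IsLevelSetNear.exists_isCompact (h : IsLevelSetNear H S p T) :
    ∃ K, IsCompact K ∧ K ⊆ S ∧ K ∈ 𝓝[S] p := by
  obtain ⟨Ω, f, hΩ, hpΩ, ⟨D, hD, -⟩, -, hS⟩ := h
  obtain ⟨r, hr, hball⟩ := Metric.nhds_basis_closedBall.mem_iff.1 (hΩ.mem_nhds hpΩ)
  have hf : ContinuousOn f (Metric.closedBall p r) := fun q hq =>
    (hD q (hball hq)).continuousAt.continuousWithinAt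
  have heq : S ∩ Metric.closedBall p r = Metric.closedBall p r ∩ f ⁻¹' {0} := by
    ext x
    exact ⟨fun hx => ⟨hx.2, (hS.subset ⟨hx.1, hball hx.2⟩).2⟩,
      fun hx => ⟨(hS.superset ⟨hball hx.1, hx.2⟩).1, hx.1⟩⟩
  refine ⟨S ∩ Metric.closedBall p r, ?_, inter_subset_left,
    inter_mem self_mem_nhdsWithin (mem_nhdsWithin_of_mem_nhds (Metric.closedBall_mem_nhds p hr))⟩
  rw [heq]
  exact (isCompact_closedBall p r).of_isClosed_subset
    (hf.preimage_isClosed_of_isClosed Metric.isClosed_closedBall isClosed_singleton)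
    inter_subset_left

theorem IsC1HSubmanifold.isSigmaCompact (h : IsC1HSubmanifold S) : IsSigmaCompact S := by
  obtain ⟨H, _, hS⟩ := h
  choose! T hT using hS
  choose! K hK hKS hKp using fun p hp => (hT p hp).exists_isCompact
  obtain ⟨t, htS, htc, hcov⟩ := TopologicalSpace.countable_cover_nhdsWithin (f := K) hKp
  have hunion : S = ⋃ p ∈ t, K p :=
    hcov.antisymm (iUnion₂_subset fun p hp => hKS p (htS hp))
  rw [hunion]
  exact isSigmaCompact_biUnion htc fun p hp => (hK p (htS hp)).isSigmaCompact

end Tangent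

/-! ### Null sets of a graph -/

section Cone

variable {G : Type u} [CarnotGroup G] {W V : Subgroup G}

namespace IsSplitting

variable (hWV : IsSplitting W V)

theorem exists_cone_of_hasTangent {S : Set G} {p : G} {T : Subgroup G} (h : HasTangent V S p T) :
    ∃ n : ℕ, ∀ q ∈ S, dist p q < 1 / ((n : ℝ) + 1) →
      gnorm (p⁻¹ * q) ≤ n * gnorm (hWV.proj (p⁻¹ * q)) := by
  obtain ⟨hT, h⟩ := h
  obtain ⟨C, -, hbound⟩ := hT.2.exists_gnorm_fst_le hT.1 hWV.homogeneous_right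
  obtain ⟨r, hr, h⟩ := h (1 / 2) (by norm_num)
  obtain ⟨m, hm⟩ := exists_nat_one_div_lt hr
  obtain ⟨n, hn⟩ := exists_nat_ge (max (2 * C) m)
  refine ⟨n, fun q hq hpq => ?_⟩
  have hmn : (m : ℝ) ≤ n := (le_max_right _ _).trans hn
  have htangent := h q hq (hpq.trans_le ((one_div_le_one_div_of_le (by positivity)
    (by linarith)).trans hm.le))
  set x := p⁻¹ * q
  have hproj : gnorm (hT.2.fst x) ≤ C * gnorm (hWV.proj x) := by
    rw [← hT.2.fst_fst hWV.complementary x]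
    exact hbound _
  have htriangle : gnorm x ≤ gnorm (hT.2.fst x) + dist x (hT.2.fst x) := by
    rw [gnorm, gnorm, dist_comm x]
    exact dist_triangle _ _ _
  calc gnorm x ≤ 2 * C * gnorm (hWV.proj x) := by linarith
    _ ≤ n * gnorm (hWV.proj x) :=
      mul_le_mul_of_nonneg_right ((le_max_left _ _).trans hn) (gnorm_nonneg _)

theorem exists_mul_gnorm_proj_lt_one (n : ℝ) :
    ∃ ρ > 0, ∀ b y c : G, y ∈ V → gnorm b < ρ → gnorm c < ρ → gnorm (b * y * c) = 1 →
      n * gnorm (hWV.proj (b * y * c)) < 1 := by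
  have hK : IsCompact (Metric.sphere (1 : G) 1 ∩ {x | 1 ≤ n * gnorm (hWV.proj x)}) :=
    (isCompact_sphere _ _).inter_right (isClosed_le continuous_const
      (continuous_const.mul (continuous_gnorm.comp hWV.continuous_proj)))
  have hopen : IsOpen {a : (G × G) × G | a.1.1⁻¹ * a.2 * a.1.2⁻¹ ∉ (V : Set G)} :=
    (hWV.homogeneous_right.isClosed.preimage (by fun_prop)).isOpen_compl
  have hev := hK.eventually_forall_of_forall_eventually (x₀ := ((1 : G), (1 : G)))
    (P := fun a x => a.1⁻¹ * x * a.2⁻¹ ∉ (V : Set G)) fun x hx => hopen.mem_nhds fun hxV => by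
      simp only [inv_one, one_mul, mul_one, SetLike.mem_coe] at hxV
      have hle := hx.2
      rw [mem_ofPred_eq, proj, hWV.complementary.fst_of_mem_right hxV, gnorm_one, mul_zero] at hle
      exact hle.not_gt one_pos
  obtain ⟨ρ, hρ, hball⟩ := Metric.eventually_nhds_iff.1 hev
  refine ⟨ρ, hρ, fun b y c hy hb hc hunit => not_le.1 fun hle => ?_⟩
  have hsphere : b * y * c ∈ Metric.sphere (1 : G) 1 := by rwa [Metric.mem_sphere, dist_comm]
  have hbc : dist (b, c) ((1 : G), (1 : G)) < ρ := by
    rw [Prod.dist_eq, max_lt_iff, dist_comm _ (1 : G), dist_comm _ (1 : G)]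
    exact ⟨hb, hc⟩
  refine hball hbc _ ⟨hsphere, hle⟩ ?_
  rwa [show b⁻¹ * (b * y * c) * c⁻¹ = y by group]

theorem exists_gnorm_le_of_cone (n : ℝ) :
    ∃ C > 0, ∀ (b y c : G) (r : ℝ), y ∈ V → gnorm b ≤ r → gnorm c ≤ r →
      gnorm (b * y * c) ≤ n * gnorm (hWV.proj (b * y * c)) → gnorm (b * y * c) ≤ C * r := by
  obtain ⟨ρ, hρ, hunit⟩ := hWV.exists_mul_gnorm_proj_lt_one n
  refine ⟨2 / ρ, by positivity, fun b y c r hy hb hc hcone => not_lt.1 fun hlt => ?_⟩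
  have hr : 0 ≤ r := (gnorm_nonneg b).trans hb
  set R := gnorm (b * y * c) with hR
  have hRpos : 0 < R := lt_of_le_of_lt (by positivity) hlt
  have hi := inv_pos.2 hRpos
  have hsmall : ∀ a : G, gnorm a ≤ r → gnorm (dil R⁻¹ a) < ρ := fun a ha => by
    rw [gnorm_dil hi, inv_mul_lt_iff₀ hRpos]
    rw [div_mul_eq_mul_div, div_lt_iff₀ hρ] at hlt
    linarith
  have hdil : dil R⁻¹ b * dil R⁻¹ y * dil R⁻¹ c = dil R⁻¹ (b * y * c) := by
    rw [dil_mul, dil_mul]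
  have hcone' := hunit (dil R⁻¹ b) (dil R⁻¹ y) (dil R⁻¹ c) (hWV.homogeneous_right.dil_mem hi hy)
    (hsmall b hb) (hsmall c hc) (by rw [hdil, gnorm_dil hi, ← hR, inv_mul_cancel₀ hRpos.ne'])
  rw [hdil, hWV.proj_dil hi, gnorm_dil hi, mul_left_comm, inv_mul_lt_iff₀ hRpos, mul_one] at hcone'
  exact hcone'.not_ge hcone

theorem exists_dist_le_of_cone (n : ℝ) : ∃ C > 0, ∀ (p q : G) (s r : ℝ), s ≤ 2 * r →
    (hWV.proj '' Metric.closedBall p s ∩ hWV.proj '' Metric.closedBall q r).Nonempty →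
    gnorm (q⁻¹ * p) ≤ n * gnorm (hWV.proj (q⁻¹ * p)) → dist p q ≤ C * r := by
  obtain ⟨C, hC, hbound⟩ := hWV.exists_gnorm_le_of_cone n
  refine ⟨2 * C, by positivity, ?_⟩
  rintro p q s r hsr ⟨_, ⟨x, hx, rfl⟩, ⟨y, hy, hxy⟩⟩ hcone
  rw [Metric.mem_closedBall] at hx hy
  have hfactor : q⁻¹ * y * (y⁻¹ * x) * (x⁻¹ * p) = q⁻¹ * p := by group
  have hle := hbound (q⁻¹ * y) (y⁻¹ * x) (x⁻¹ * p) (2 * r)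
    (hWV.complementary.fst_eq_fst_iff.1 hxy)
    (by rw [← dist_eq_gnorm, dist_comm]; linarith [dist_nonneg (x := y) (y := q)])
    (by rw [← dist_eq_gnorm]; exact hx.trans hsr)
  rw [hfactor] at hle
  rw [dist_comm, dist_eq_gnorm]
  linarith [hle hcone]

end IsSplitting

theorem psiPre_le_of_subset_iUnion_closedBall {X : Type u} [MetricSpace X] {k : MeasureKind}
    {d : ℝ} (hd : 0 ≤ d) {C δ : ℝ} (hC : 0 ≤ C) {u : Set (X × ℝ)} (hu : u.Countable)
    (hpos : ∀ a ∈ u, 0 ≤ a.2) (hδ : ∀ a ∈ u, 2 * C * a.2 ≤ δ) {Z : Set X}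
    (hZ : Z ⊆ ⋃ a : u, Metric.closedBall a.1.1 (C * a.1.2)) :
    psiPre k d δ Z ≤ ENNReal.ofReal (2 * C) ^ d * ∑' a : u, ENNReal.ofReal a.1.2 ^ d := by
  have := hu.to_subtype
  rw [← ENNReal.tsum_mul_left]
  refine (measure_mono hZ).trans ((measure_iUnion_le _).trans
    (ENNReal.tsum_le_tsum fun a => ?_))
  have ha := hpos a a.2
  rw [← ENNReal.mul_rpow_of_nonneg _ _ hd, ← ENNReal.ofReal_mul (by positivity)]
  exact psiPre_le hd (by positivity) (hδ a a.2)
    ((Admissible.closedBall k _ _).mono Subset.rfl (by linarith))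

section Projection

variable {X : Type u} [MetricSpace X] [ProperSpace X] {Y : Type*} [TopologicalSpace Y] [T2Space Y]
  [MeasurableSpace Y] [BorelSpace Y] {π : X → Y} {ν : Measure Y} {k : MeasureKind} {d C : ℝ}
  {Z : Set X} {η : ℝ≥0}

theorem psiPre_le_of_dist_le (hπ : Continuous π) (hd : 0 ≤ d) (hC : 0 < C)
    (hdist : ∀ p ∈ Z, ∀ q ∈ Z, ∀ s r : ℝ, s ≤ 2 * r →
      (π '' Metric.closedBall p s ∩ π '' Metric.closedBall q r).Nonempty → dist p q ≤ C * r)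
    (hη : η ≠ 0) (h : ∀ p ∈ Z, ∀ δ > 0, ∃ s, 0 < s ∧ s ≤ δ ∧
      η * ENNReal.ofReal s ^ d ≤ ν (π '' Metric.closedBall p s))
    {U : Set Y} (hU : IsOpen U) (hZU : π '' Z ⊆ U) (hνU : ν U ≠ ∞) {δ : ℝ} (hδ : 0 < δ) :
    psiPre k d δ Z ≤ ENNReal.ofReal (2 * C) ^ d * (ν U / η) := by
  let Q : X × ℝ → Set Y := fun a => π '' Metric.closedBall a.1 a.2
  let F : Set (X × ℝ) := {a | a.1 ∈ Z ∧ 0 < a.2 ∧ a.2 ≤ δ / (2 * C) ∧ Q a ⊆ U ∧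
    η * ENNReal.ofReal a.2 ^ d ≤ ν (Q a)}
  obtain ⟨u, huF, hcount, hsum, hu⟩ := exists_disjoint_subfamily_tsum_le (F := F) (Q := Q)
    (r := Prod.snd) hη hνU
    (fun a _ => ((isCompact_closedBall a.1 a.2).image hπ).measurableSet)
    (fun a ha => ⟨_, mem_image_of_mem _ (Metric.mem_closedBall_self ha.2.1.le)⟩)
    (fun a ha => ha.2.1) (fun a ha => ha.2.2.1) (fun a ha => ha.2.2.2.1) (fun a ha => ha.2.2.2.2)
  have hcover : Z ⊆ ⋃ a : u, Metric.closedBall a.1.1 (C * a.1.2) := fun p hp => by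
    have hnhds : π ⁻¹' U ∈ 𝓝 p := (hU.preimage hπ).mem_nhds (hZU (mem_image_of_mem _ hp))
    obtain ⟨r, hr, hrU⟩ := Metric.nhds_basis_closedBall.mem_iff.1 hnhds
    obtain ⟨s, hs, hsle, hsν⟩ := h p hp (min r (δ / (2 * C))) (by positivity)
    have hpF : (p, s) ∈ F := ⟨hp, hs, hsle.trans (min_le_right _ _), image_subset_iff.2
      ((Metric.closedBall_subset_closedBall (hsle.trans (min_le_left _ _))).trans hrU), hsν⟩
    obtain ⟨b, hbu, hmeet, hsb⟩ := hu (p, s) hpF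
    exact mem_iUnion.2 ⟨⟨b, hbu⟩, hdist p hp b.1 (huF hbu).1 s b.2 hsb hmeet⟩
  refine (psiPre_le_of_subset_iUnion_closedBall hd hC.le hcount (fun a ha => (huF ha).2.1.le)
    (fun a ha => (le_div_iff₀' (by positivity)).1 (huF ha).2.2.1) hcover).trans ?_
  gcongr

/-- The balls of a Vitali family for their images under `π` are enlarged in `X`, not in `Y`, where
the images of enlarged balls are out of control since `π` need not be Lipschitz. -/
theorem psi_eq_zero_of_dist_le [MeasurableSpace X] [BorelSpace X] [ν.OuterRegular]
    (hπ : Continuous π) (hd : 0 ≤ d) (hC : 0 < C)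
    (hdist : ∀ p ∈ Z, ∀ q ∈ Z, ∀ s r : ℝ, s ≤ 2 * r →
      (π '' Metric.closedBall p s ∩ π '' Metric.closedBall q r).Nonempty → dist p q ≤ C * r)
    (hη : η ≠ 0) (h : ∀ p ∈ Z, ∀ δ > 0, ∃ s, 0 < s ∧ s ≤ δ ∧
      η * ENNReal.ofReal s ^ d ≤ ν (π '' Metric.closedBall p s))
    (hν : ν (π '' Z) = 0) : psi k d Z = 0 := by
  set c := ENNReal.ofReal (2 * C) ^ d
  have hctop : c ≠ ∞ := ofReal_rpow_ne_top (by positivity) d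
  have hη0 : (η : ℝ≥0∞) ≠ 0 := ENNReal.coe_ne_zero.2 hη
  refine le_antisymm (ENNReal.le_of_forall_pos_le_add fun ε hε _ => ?_) zero_le
  have hlim : Tendsto (fun t : ℝ≥0∞ => c * (t / η)) (𝓝 0) (𝓝 (c * (0 / η))) :=
    ENNReal.Tendsto.const_mul ((ENNReal.continuous_div_const _ hη0).tendsto 0) (Or.inr hctop)
  rw [ENNReal.zero_div, mul_zero] at hlim
  obtain ⟨t, ht, htε⟩ := (ENNReal.nhds_zero_basis.eventually_iff.1
    (hlim.eventually_lt_const (ENNReal.coe_pos.2 hε)))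
  obtain ⟨U, hZU, hU, hνU⟩ := (π '' Z).exists_isOpen_lt_of_lt t (hν ▸ ht)
  rw [zero_add]
  exact psi_le_of_psiPre_le fun δ hδ => (psiPre_le_of_dist_le hπ hd hC hdist hη h hU hZU
    hνU.ne_top hδ).trans (htε hνU).le

end Projection

namespace IsSplitting

variable (hWV : IsSplitting W V) [MeasurableSpace G] [BorelSpace G] {d : ℝ} {k : MeasureKind}

theorem psi_eq_zero_of_cone (hd : 0 ≤ d) {Z : Set G} {n : ℝ}
    (hcone : ∀ p ∈ Z, ∀ q ∈ Z, gnorm (p⁻¹ * q) ≤ n * gnorm (hWV.proj (p⁻¹ * q)))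
    {ν : Measure G} [ν.OuterRegular] (hν : ν (hWV.proj '' Z) = 0) {η : ℝ≥0} (hη : η ≠ 0)
    (h : ∀ p ∈ Z, ∀ δ > 0, ∃ s, 0 < s ∧ s ≤ δ ∧
      η * ENNReal.ofReal s ^ d ≤ ν (hWV.proj '' Metric.closedBall p s)) : psi k d Z = 0 := by
  obtain ⟨C, hC, hdist⟩ := hWV.exists_dist_le_of_cone n
  exact psi_eq_zero_of_dist_le hWV.continuous_proj hd hC (fun p hp q hq s r hsr hmeet =>
    hdist p q s r hsr hmeet (hcone q hq p hp)) hη h hν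

end IsSplitting

end Cone

/-! ### Densities of graphs -/

section GraphDensity

theorem tendsto_mul_ofReal_rpow {a : ℝ≥0∞} (ha : a ≠ ∞) (c d : ℝ) :
    Tendsto (fun ε : ℝ => a * ENNReal.ofReal (1 + c * ε) ^ d) (𝓝[>] 0) (𝓝 a) := by
  have hcont : Continuous fun ε : ℝ => ENNReal.ofReal (1 + c * ε) ^ d :=
    (ENNReal.continuous_rpow_const (y := d)).comp (ENNReal.continuous_ofReal.comp (by fun_prop))
  have hlim := ENNReal.Tendsto.const_mul (a := a) (hcont.tendsto 0) (Or.inr ha)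
  simp only [mul_zero, add_zero, ENNReal.ofReal_one, ENNReal.one_rpow, mul_one] at hlim
  exact hlim.mono_left nhdsWithin_le_nhds

variable {G : Type u} [CarnotGroup G] {W V T : Subgroup G} {S K : Set G} {p : G}

theorem HasTangent.mem_complements (h : HasTangent V S p T) : T ∈ complements V :=
  h.1

namespace IsSplitting

variable (hWV : IsSplitting W V)

theorem exists_dist_lt_of_proj_eq (hK : IsCompact K) (hinj : InjOn hWV.proj K) (hp : p ∈ K)
    {r : ℝ} (hr : 0 < r) :
    ∃ s > 0, ∀ x, dist p x ≤ s → ∀ q ∈ K, hWV.proj q = hWV.proj x → dist p q < r := by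
  have hC : IsCompact (hWV.proj '' (K \ Metric.ball p r)) :=
    (hK.diff Metric.isOpen_ball).image hWV.continuous_proj
  have hpC : hWV.proj p ∉ hWV.proj '' (K \ Metric.ball p r) := by
    rintro ⟨q, ⟨hq, hqr⟩, hpq⟩
    rw [hinj hq hp hpq] at hqr
    exact hqr (Metric.mem_ball_self hr)
  have hnhds : hWV.proj ⁻¹' (hWV.proj '' (K \ Metric.ball p r))ᶜ ∈ 𝓝 p :=
    hWV.continuous_proj.continuousAt.preimage_mem_nhds (hC.isClosed.isOpen_compl.mem_nhds hpC)
  obtain ⟨s, hs, hball⟩ := Metric.nhds_basis_closedBall.mem_iff.1 hnhds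
  refine ⟨s, hs, fun x hx q hq hqx => ?_⟩
  by_contra h
  refine hball (Metric.mem_closedBall'.2 hx) ⟨q, ⟨hq, fun hqr => h ?_⟩, hqx⟩
  rwa [Metric.mem_ball'] at hqr

theorem proj_mul_fst_inv_mul (hT : Complementary T V) (p q : G) :
    hWV.proj (p * hT.fst (p⁻¹ * q)) = hWV.proj q := by
  refine hWV.complementary.fst_eq_fst_iff.2 ?_
  have := hT.inv_fst_mul_mem (p⁻¹ * q)
  rwa [mul_inv_rev, mul_assoc]

/-- A point of `p T` whose projection is hit by `K` lies close to the point of `K` above the same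
point of `W`. -/
theorem proj_image_mul_inter_subset (hT : Complementary T V) {E : Set G} {s r ε : ℝ} (hε : 0 ≤ ε)
    (hε2 : ε ≤ 1 / 2) (hE : E ⊆ Metric.closedBall 1 s)
    (hsep : ∀ x, dist p x ≤ s → ∀ q ∈ K, hWV.proj q = hWV.proj x → dist p q < r)
    (htan : ∀ q ∈ K, dist p q < r → dist (p⁻¹ * q) (hT.fst (p⁻¹ * q)) ≤ ε * gnorm (p⁻¹ * q)) :
    hWV.proj '' ((fun x => p * x) '' (E ∩ T)) ⊆
      hWV.proj '' ({y | ∃ x ∈ (fun x => p * x) '' E, dist y x ≤ 2 * ε * s} ∩ K) ∪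
        hWV.proj '' Metric.closedBall p s \ hWV.proj '' K := by
  rintro _ ⟨_, ⟨x, ⟨hxE, hxT⟩, rfl⟩, rfl⟩
  have hxs : gnorm x ≤ s := mem_closedBall_one.1 (hE hxE)
  have hdist : dist p (p * x) ≤ s := by rwa [dist_eq_gnorm, inv_mul_cancel_left]
  by_cases hz : hWV.proj (p * x) ∈ hWV.proj '' K
  · obtain ⟨q, hq, hqx⟩ := hz
    have hfst : hT.fst (p⁻¹ * q) = x := by
      refine hT.fst_eq hxT ?_
      have := hWV.complementary.fst_eq_fst_iff.1 hqx.symm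
      rwa [mul_inv_rev, mul_assoc] at this
    have hclose : dist (p⁻¹ * q) x ≤ ε * gnorm (p⁻¹ * q) := by
      simpa only [hfst] using htan q hq (hsep _ hdist q hq hqx)
    have htri : gnorm (p⁻¹ * q) ≤ gnorm x + dist (p⁻¹ * q) x := by
      rw [gnorm, gnorm, dist_comm (p⁻¹ * q)]
      exact dist_triangle _ _ _
    have hnorm : gnorm (p⁻¹ * q) ≤ 2 * s := by nlinarith [gnorm_nonneg (p⁻¹ * q)]
    refine Or.inl ⟨q, ⟨⟨p * x, mem_image_of_mem _ hxE, ?_⟩, hq⟩, hqx⟩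
    calc dist q (p * x) = dist (p⁻¹ * q) x := by
          rw [← dist_mul_left p⁻¹ q, inv_mul_cancel_left]
      _ ≤ ε * gnorm (p⁻¹ * q) := hclose
      _ ≤ ε * (2 * s) := mul_le_mul_of_nonneg_left hnorm hε
      _ = 2 * ε * s := by ring
  · exact Or.inr ⟨⟨_, Metric.mem_closedBall'.2 hdist, rfl⟩, hz⟩

variable [MeasurableSpace G] {d : ℝ} {τ : Measure G} {k : MeasureKind}

theorem exists_measure_proj_image_le (hτ : IsHomogeneousHaar W d τ) (h : HasTangent V S p T)
    {t : ℝ≥0∞} (ht : hWV.areaDensity τ k T < t) :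
    ∃ δ > 0, ∀ (E : Set G) (s : ℝ), p ∈ E → 0 < s → s ≤ δ → Admissible k E s →
      τ (hWV.proj '' (E ∩ S)) ≤ t * ENNReal.ofReal s ^ d := by
  obtain ⟨ε, hεt, hε : 0 < ε⟩ := (((tendsto_mul_ofReal_rpow (hWV.areaDensity_ne_top hτ) 2
    d).eventually (gt_mem_nhds ht)).and self_mem_nhdsWithin).exists
  obtain ⟨hT, h⟩ := h
  obtain ⟨r, hr, h⟩ := h ε hε
  refine ⟨r / 2, half_pos hr, fun E s hpE hs hsr hE => ?_⟩
  let E' : Set G := {y | ∃ x ∈ (fun x => p⁻¹ * x) '' E, dist y x ≤ ε * s}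
  have hE' : Admissible k E' (s * (1 + 2 * ε)) := by
    have := (hE.mul_left p⁻¹).thicken (ε * s)
    rwa [show s + 2 * (ε * s) = s * (1 + 2 * ε) by ring] at this
  have hsub : hWV.proj '' (E ∩ S) ⊆ hWV.proj '' ((fun x => p * x) '' (E' ∩ T)) := by
    rintro _ ⟨q, ⟨hqE, hqS⟩, rfl⟩
    have hpq : dist p q ≤ s := hE.dist_le hpE hqE
    refine ⟨_, ⟨hT.2.fst (p⁻¹ * q), ⟨⟨_, ⟨q, hqE, rfl⟩, ?_⟩, hT.2.fst_mem _⟩, rfl⟩,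
      hWV.proj_mul_fst_inv_mul hT.2 p q⟩
    rw [dist_comm]
    refine (h q hqS (by linarith)).trans (mul_le_mul_of_nonneg_left ?_ hε.le)
    rwa [← dist_eq_gnorm]
  calc τ (hWV.proj '' (E ∩ S)) ≤ τ (hWV.proj '' ((fun x => p * x) '' (E' ∩ T))) :=
        measure_mono hsub
    _ ≤ hWV.areaDensity τ k T * ENNReal.ofReal (s * (1 + 2 * ε)) ^ d := by
      rw [hWV.measure_proj_image_mul hτ]
      exact hWV.measure_le_areaDensity_mul hτ hT.1
        ⟨1, ⟨p, hpE, inv_mul_cancel p⟩, by rw [dist_self]; positivity⟩ (by positivity) hE'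
    _ = hWV.areaDensity τ k T * ENNReal.ofReal (1 + 2 * ε) ^ d * ENNReal.ofReal s ^ d := by
      rw [mul_comm s, ENNReal.ofReal_mul (by positivity), ENNReal.mul_rpow_of_nonneg _ _ hτ.nonneg,
        mul_assoc]
    _ ≤ t * ENNReal.ofReal s ^ d := by gcongr

/-- The projection of `K` onto `W` has `τ`-density one at the projection of `p`. The density is
computed with the projections of the balls of `G` around `p`, not with the balls of `W`. -/
def HasProjDensityOne (d : ℝ) (τ : Measure G) (K : Set G) (p : G) : Prop :=
  ∀ η : ℝ≥0, 0 < η → ∀ᶠ s : ℝ in 𝓝[>] 0,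
    τ (hWV.proj '' Metric.closedBall p s \ hWV.proj '' K) ≤ η * ENNReal.ofReal s ^ d

theorem HasProjDensityOne.of_forall_nat (h : ∀ j : ℕ, ∃ δ > 0, ∀ s, 0 < s → s ≤ δ →
    τ (hWV.proj '' Metric.closedBall p s \ hWV.proj '' K) <
      ((j : ℝ≥0) + 1)⁻¹ * ENNReal.ofReal s ^ d) : hWV.HasProjDensityOne d τ K p := by
  intro η hη
  obtain ⟨j, hj⟩ := exists_nat_one_div_lt hη
  rw [one_div] at hj
  obtain ⟨δ, hδ, hlt⟩ := h j
  filter_upwards [Ioc_mem_nhdsGT hδ] with s hs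
  refine (hlt s hs.1 hs.2).le.trans ?_
  gcongr

/-- The test sets are translated and rescaled test sets for `T`, thickened by `2 ε s`. -/
theorem exists_le_measure_proj_image (hτ : IsHomogeneousHaar W d τ) (hK : IsCompact K)
    (hinj : InjOn hWV.proj K) (hp : p ∈ K) (h : HasTangent V K p T)
    (hpK : hWV.HasProjDensityOne d τ K p) {t : ℝ≥0} (ht : t < hWV.areaDensity τ k T)
    {δ : ℝ} (hδ : 0 < δ) :
    ∃ (E : Set G) (s : ℝ), p ∈ interior E ∧ 0 < s ∧ s ≤ δ ∧ Admissible k E s ∧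
      t * ENNReal.ofReal s ^ d ≤ τ (hWV.proj '' (E ∩ K)) := by
  have hlim : Tendsto (fun ε : ℝ => t * ENNReal.ofReal (1 + 4 * ε) ^ d + ENNReal.ofReal ε)
      (𝓝[>] 0) (𝓝 (t + ENNReal.ofReal 0)) :=
    (tendsto_mul_ofReal_rpow ht.ne_top 4 d).add
      ((ENNReal.continuous_ofReal.tendsto 0).mono_left nhdsWithin_le_nhds)
  rw [ENNReal.ofReal_zero, add_zero] at hlim
  obtain ⟨ε, hεt, hε, hε2⟩ := ((hlim.eventually (gt_mem_nhds ht)).and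
    (Ioo_mem_nhdsGT (show (0 : ℝ) < 1 / 2 by norm_num))).exists
  obtain ⟨E₀, h1E, hE₀, hlt⟩ := hWV.exists_lt_of_lt_areaDensity hεt
  obtain ⟨hT, h⟩ := h
  obtain ⟨r, hr, htan⟩ := h ε hε
  obtain ⟨s₀, hs₀, hsep⟩ := hWV.exists_dist_lt_of_proj_eq hK hinj hp hr
  obtain ⟨s, hsK, hs, hsle⟩ := ((hpK ε.toNNReal (Real.toNNReal_pos.2 hε)).and
    (Ioc_mem_nhdsGT (show 0 < min s₀ (δ / (1 + 4 * ε)) by positivity))).exists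
  have hsδ : (1 + 4 * ε) * s ≤ δ :=
    (le_div_iff₀' (by positivity)).1 (hsle.trans (min_le_right _ _))
  have hEs : Admissible k ((dil s : G → G) '' E₀) s := by simpa only [mul_one] using hE₀.dil hs
  have hE := (hEs.mul_left p).thicken (2 * ε * s)
  rw [show s + 2 * (2 * ε * s) = (1 + 4 * ε) * s by ring] at hE
  have h1s : (1 : G) ∈ (dil s : G → G) '' E₀ := ⟨1, h1E, dil_one_right _⟩
  refine ⟨_, (1 + 4 * ε) * s, subset_interior_thicken ((fun x => p * x) '' _) (by positivity)
    ⟨1, h1s, mul_one p⟩, by positivity, hsδ, hE, ?_⟩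
  have hsub := hWV.proj_image_mul_inter_subset hT.2 hε.le hε2.le
    (fun x hx => mem_closedBall_one.2 (hEs.dist_le h1s hx))
    (fun x hx => hsep x (hx.trans (hsle.trans (min_le_left _ _)))) htan
  have hfin : ENNReal.ofReal ε * ENNReal.ofReal s ^ d ≠ ∞ :=
    ENNReal.mul_ne_top ENNReal.ofReal_ne_top (ofReal_rpow_ne_top hs d)
  refine (ENNReal.add_le_add_iff_right hfin).1 ?_
  calc _ = (t * ENNReal.ofReal (1 + 4 * ε) ^ d + ENNReal.ofReal ε) * ENNReal.ofReal s ^ d := by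
        rw [ENNReal.ofReal_mul (by positivity), ENNReal.mul_rpow_of_nonneg _ _ hτ.nonneg, add_mul,
          mul_assoc]
    _ ≤ τ (hWV.proj '' (E₀ ∩ T)) * ENNReal.ofReal s ^ d := by gcongr
    _ = τ (hWV.proj '' ((fun x => p * x) '' ((dil s : G → G) '' E₀ ∩ T))) := by
        rw [hWV.measure_proj_image_mul hτ, ← hT.1.dil_image_inter hs,
          hWV.measure_proj_image_dil hτ hs, mul_comm]
    _ ≤ _ := (measure_mono hsub).trans (measure_union_le _ _)
    _ ≤ _ := add_le_add_right hsK _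

variable [BorelSpace G]

theorem upperDensity_graphMeasure_le (hτ : IsHomogeneousHaar W d τ) (hS : MeasurableSet S)
    (hinj : InjOn hWV.proj S) (h : HasTangent V S p T) :
    upperDensity k d (hWV.graphMeasure τ S) p ≤ hWV.areaDensity τ k T := by
  refine le_of_forall_gt_imp_ge_of_dense fun t ht => ?_
  obtain ⟨u, hu, hut⟩ := ENNReal.lt_iff_exists_nnreal_btwn.1 ht
  obtain ⟨δ, hδ, hle⟩ := hWV.exists_measure_proj_image_le hτ h hu
  refine (upperDensity_le hδ fun E s hpE hs hsδ hE => ?_).trans hut.le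
  rw [hWV.graphMeasure_apply hS hinj]
  exact hle E s (interior_subset hpE) hs hsδ hE

theorem le_upperDensity_graphMeasure (hτ : IsHomogeneousHaar W d τ) (hS : MeasurableSet S)
    (hinj : InjOn hWV.proj S) (hK : IsCompact K) (hKS : K ⊆ S) (hp : p ∈ K)
    (h : HasTangent V K p T) (hpK : hWV.HasProjDensityOne d τ K p) :
    hWV.areaDensity τ k T ≤ upperDensity k d (hWV.graphMeasure τ S) p := by
  refine ENNReal.le_of_forall_nnreal_lt fun t ht => le_upperDensity fun δ hδ => ?_
  obtain ⟨E, s, hpE, hs, hsδ, hE, hle⟩ :=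
    hWV.exists_le_measure_proj_image hτ hK (hinj.mono hKS) hp h hpK ht hδ
  refine ⟨E, s, hpE, hs, hsδ, hE, ?_⟩
  rw [hWV.graphMeasure_apply hS hinj]
  exact hle.trans (measure_mono (image_mono (inter_subset_inter_right E hKS)))

theorem psi_eq_zero_of_cone_of_forall_exists_le (hτ : IsHomogeneousHaar W d τ) (hK : IsCompact K)
    {Z : Set G} (hZ : Z ⊆ K) {n : ℝ}
    (hcone : ∀ p ∈ Z, ∀ q ∈ Z, gnorm (p⁻¹ * q) ≤ n * gnorm (hWV.proj (p⁻¹ * q)))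
    {η : ℝ≥0} (hη : η ≠ 0) (h : ∀ p ∈ Z, ∀ δ > 0, ∃ s, 0 < s ∧ s ≤ δ ∧
      η * ENNReal.ofReal s ^ d ≤ τ (hWV.proj '' Metric.closedBall p s \ hWV.proj '' K)) :
    psi k d Z = 0 := by
  have := hτ.finite
  have hν : ∀ F, IsCompact F → τ.restrict (hWV.proj '' K)ᶜ (hWV.proj '' F) =
      τ (hWV.proj '' F \ hWV.proj '' K) := fun F hF => by
    rw [Measure.restrict_apply (hF.image hWV.continuous_proj).measurableSet, sdiff_eq]
  refine hWV.psi_eq_zero_of_cone hτ.nonneg hcone (ν := τ.restrict (hWV.proj '' K)ᶜ) ?_ hη ?_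
  · refine measure_mono_null (image_mono hZ) ?_
    rw [hν K hK, Set.sdiff_self, measure_empty]
  · simpa only [hν _ (isCompact_closedBall _ _)] using h

/-- The points of `K` where the projection of `K` does not have density one lie in countably many
sets with a cone condition. -/
theorem psi_setOf_not_hasProjDensityOne (hτ : IsHomogeneousHaar W d τ) (hK : IsCompact K)
    (hT : ∀ p ∈ K, ∃ T, HasTangent V K p T) :
    psi k d {p ∈ K | ¬ hWV.HasProjDensityOne d τ K p} = 0 := by
  let Z : ℕ → ℕ → ℕ → Set G := fun j n i => {p ∈ K |
    dist p (TopologicalSpace.denseSeq G i) < 1 / (2 * ((n : ℝ) + 1)) ∧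
    (∀ q ∈ K, dist p q < 1 / ((n : ℝ) + 1) → gnorm (p⁻¹ * q) ≤ n * gnorm (hWV.proj (p⁻¹ * q))) ∧
    ∀ δ > 0, ∃ s, 0 < s ∧ s ≤ δ ∧ ((j : ℝ≥0) + 1)⁻¹ * ENNReal.ofReal s ^ d ≤
      τ (hWV.proj '' Metric.closedBall p s \ hWV.proj '' K)}
  have hcover : {p ∈ K | ¬ hWV.HasProjDensityOne d τ K p} ⊆ ⋃ (j) (n) (i), Z j n i := by
    rintro p ⟨hp, h⟩
    obtain ⟨j, hj⟩ := not_forall.1 (mt (HasProjDensityOne.of_forall_nat hWV) h)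
    push Not at hj
    obtain ⟨T, hpT⟩ := hT p hp
    obtain ⟨n, hn⟩ := hWV.exists_cone_of_hasTangent hpT
    obtain ⟨i, hi⟩ := (TopologicalSpace.denseRange_denseSeq G).exists_dist_lt p
      (show 0 < 1 / (2 * ((n : ℝ) + 1)) by positivity)
    simp only [mem_iUnion]
    exact ⟨j, n, i, hp, hi, hn, hj⟩
  refine measure_mono_null hcover (measure_iUnion_null fun j => measure_iUnion_null fun n =>
    measure_iUnion_null fun i => ?_)
  refine hWV.psi_eq_zero_of_cone_of_forall_exists_le hτ hK (fun p hp => hp.1) (n := n)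
    (fun p hp q hq => hp.2.2.1 q hq.1 ?_) (η := ((j : ℝ≥0) + 1)⁻¹) (by positivity)
    (fun p hp => by simpa using hp.2.2.2)
  calc dist p q ≤ dist p (TopologicalSpace.denseSeq G i) +
          dist q (TopologicalSpace.denseSeq G i) := dist_triangle_right _ _ _
    _ < 1 / (2 * ((n : ℝ) + 1)) + 1 / (2 * ((n : ℝ) + 1)) := add_lt_add hp.2.1 hq.2.1
    _ = 1 / ((n : ℝ) + 1) := by field_simp; norm_num

end IsSplitting

end GraphDensity

/-! ### The area formula -/

section AreaFormula

variable {G : Type u} [CarnotGroup G] {W V P : Subgroup G} {S : Set G}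

theorem measurableSet_of_isSigmaCompact {X : Type*} [TopologicalSpace X] [T2Space X]
    [MeasurableSpace X] [OpensMeasurableSpace X] {S : Set X} (hS : IsSigmaCompact S) :
    MeasurableSet S := by
  obtain ⟨K, hK, rfl⟩ := hS
  exact MeasurableSet.iUnion fun m => (hK m).measurableSet

theorem hasTangent_self (hP : P ∈ complements V) {p : G} (hp : p ∈ P) : HasTangent V P p P :=
  ⟨hP, fun ε hε => ⟨1, one_pos, fun q hq _ => by
    rw [hP.2.fst_of_mem (P.mul_mem (P.inv_mem hp) hq), dist_self]
    exact mul_nonneg hε.le (gnorm_nonneg _)⟩⟩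

theorem exists_isLevelSetNear_tangentSubgroup (hS : IsC1HSubmanifold S) {p : G} (hp : p ∈ S) :
    ∃ (H : Type u) (_ : CarnotGroup H), IsLevelSetNear H S p (tangentSubgroup S p) := by
  obtain ⟨H, hH, hS⟩ := hS
  obtain ⟨T, hT⟩ := hS p hp
  have h : ∃ (T : Subgroup G) (H : Type u) (_ : CarnotGroup H), p ∈ S ∧ IsLevelSetNear H S p T :=
    ⟨T, H, hH, hp, hT⟩
  obtain ⟨H', hH', -, h'⟩ := h.choose_spec
  refine ⟨H', hH', ?_⟩
  rwa [tangentSubgroup, dif_pos h]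

/-- The graph map of `φ`, with values in the intrinsic graph of `φ`. -/
def toIntrinsicGraph {A : Set W} (φ : A → V) (w : A) : intrinsicGraph φ :=
  ⟨graphMap φ w, mem_range_self w⟩

namespace IsSplitting

variable (hWV : IsSplitting W V)

include hWV in
theorem hasTangent_intrinsicGraph {A : Set W} {φ : A → V} (hφ : IsC1WV φ) {p : G}
    (hp : p ∈ intrinsicGraph φ) :
    HasTangent V (intrinsicGraph φ) p (tangentSubgroup (intrinsicGraph φ) p) := by
  obtain ⟨H, _, hH⟩ := exists_isLevelSetNear_tangentSubgroup hφ.1 hp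
  obtain ⟨w, rfl⟩ := hp
  exact hH.hasTangent (mem_range_self w) (hφ.2 w) hWV.homogeneous_right

theorem proj_image_of_subset {B : Set G} (hB : B ⊆ W) : hWV.proj '' B = B := by
  simpa only [image_id'] using image_congr fun x hx => hWV.complementary.fst_of_mem (hB hx)

theorem proj_image_subset (B : Set G) : hWV.proj '' B ⊆ W :=
  image_subset_iff.2 fun x _ => hWV.complementary.fst_mem x

theorem proj_graphMap {A : Set W} (φ : A → V) (w : A) : hWV.proj (graphMap φ w) = w :=
  hWV.complementary.fst_mul w.1.2 (φ w).2

theorem injOn_proj_intrinsicGraph {A : Set W} (φ : A → V) :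
    InjOn hWV.proj (intrinsicGraph φ) := by
  rintro _ ⟨w, rfl⟩ _ ⟨w', rfl⟩ h
  rw [hWV.proj_graphMap, hWV.proj_graphMap] at h
  rw [Subtype.ext (Subtype.ext h)]

theorem coe_image_preimage_toIntrinsicGraph {A : Set W} (φ : A → V)
    (B : Set (intrinsicGraph φ)) :
    (fun w : A => ((w : W) : G)) '' (toIntrinsicGraph φ ⁻¹' B) =
      hWV.proj '' (Subtype.val '' B) := by
  ext x
  constructor
  · rintro ⟨w, hw, rfl⟩
    exact ⟨_, ⟨toIntrinsicGraph φ w, hw, rfl⟩, hWV.proj_graphMap φ w⟩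
  · rintro ⟨_, ⟨⟨_, w, rfl⟩, hb, rfl⟩, rfl⟩
    exact ⟨w, hb, (hWV.proj_graphMap φ w).symm⟩

theorem proj_image_inter {φ : W → V} (h : IsHomogeneousGraph P φ) (E : Set G) :
    hWV.proj '' (E ∩ P) = Subtype.val '' ((fun w : W => (w : G) * (φ w : G)) ⁻¹' E) := by
  ext x
  constructor
  · rintro ⟨p, ⟨hpE, hp⟩, rfl⟩
    obtain ⟨w, rfl⟩ := h.exists_eq_mul hp
    exact ⟨w, hpE, (hWV.complementary.fst_mul w.2 (φ w).2).symm⟩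
  · rintro ⟨w, hw, rfl⟩
    exact ⟨_, ⟨hw, h.mul_mem w⟩, hWV.complementary.fst_mul w.2 (φ w).2⟩

variable [MeasurableSpace G] [BorelSpace G] {d : ℝ} {τ : Measure G} {k : MeasureKind}

theorem measurableSet_proj_image (hinj : InjOn hWV.proj S) {B : Set G} (hB : MeasurableSet B)
    (hBS : B ⊆ S) : MeasurableSet (hWV.proj '' B) :=
  hB.image_of_continuousOn_injOn hWV.continuous_proj.continuousOn (hinj.mono hBS)

theorem psi_setOf_upperDensity_ne (hτ : IsHomogeneousHaar W d τ) (hS : IsSigmaCompact S)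
    (hinj : InjOn hWV.proj S) {T : G → Subgroup G} (hT : ∀ p ∈ S, HasTangent V S p (T p)) :
    psi k d {p ∈ S | upperDensity k d (hWV.graphMeasure τ S) p ≠ hWV.areaDensity τ k (T p)} =
      0 := by
  have hSm := measurableSet_of_isSigmaCompact hS
  obtain ⟨K, hK, rfl⟩ := hS
  refine measure_mono_null ?_ (measure_iUnion_null fun m =>
    hWV.psi_setOf_not_hasProjDensityOne (k := k) hτ (hK m) fun p hp =>
      ⟨T p, (hT p (mem_iUnion_of_mem m hp)).mono (subset_iUnion K m)⟩)
  rintro p ⟨hp, hne⟩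
  obtain ⟨m, hm⟩ := mem_iUnion.1 hp
  refine mem_iUnion_of_mem m ⟨hm, fun hpK => hne (le_antisymm ?_ ?_)⟩
  · exact hWV.upperDensity_graphMeasure_le hτ hSm hinj (hT p hp)
  · exact hWV.le_upperDensity_graphMeasure hτ hSm hinj (hK m) (subset_iUnion K m) hm
      ((hT p hp).mono (subset_iUnion K m)) hpK

theorem graphMeasure_absolutelyContinuous (hτ : IsHomogeneousHaar W d τ) (hS : MeasurableSet S)
    (hinj : InjOn hWV.proj S) (hT : ∀ p ∈ S, ∃ T, HasTangent V S p T) :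
    hWV.graphMeasure τ S ≪ psi k d := by
  intro N hN
  have hcover : N ∩ S ⊆ ⋃ j : ℕ, {p ∈ N | upperDensity k d (hWV.graphMeasure τ S) p < j} := by
    rintro p ⟨hpN, hpS⟩
    obtain ⟨T, hpT⟩ := hT p hpS
    have htop : upperDensity k d (hWV.graphMeasure τ S) p ≠ ∞ := ne_top_of_le_ne_top
      (hWV.areaDensity_ne_top hτ) (hWV.upperDensity_graphMeasure_le hτ hS hinj hpT)
    obtain ⟨j, hj⟩ := ENNReal.exists_nat_gt htop
    exact mem_iUnion_of_mem j ⟨hpN, hj⟩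
  have hnull : hWV.graphMeasure τ S (N ∩ S) = 0 := by
    refine measure_mono_null hcover (measure_iUnion_null fun j => le_antisymm ?_ zero_le)
    calc _ ≤ (j : ℝ≥0) * psi k d {p ∈ N | upperDensity k d (hWV.graphMeasure τ S) p < j} :=
          measure_le_mul_psi hτ.nonneg fun p hp => by exact_mod_cast hp.2
      _ = 0 := by rw [measure_mono_null (fun p hp => hp.1) hN, mul_zero]
  rwa [hWV.graphMeasure_apply hS hinj, inter_assoc, inter_self,
    ← hWV.graphMeasure_apply hS hinj] at hnull

theorem measure_proj_image_eq_setLIntegral (hτ : IsHomogeneousHaar W d τ) (hS : IsSigmaCompact S)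
    (hinj : InjOn hWV.proj S) {T : G → Subgroup G} (hT : ∀ p ∈ S, HasTangent V S p (T p))
    {B : Set G} (hB : MeasurableSet B) (hBS : B ⊆ S) :
    τ (hWV.proj '' B) = ∫⁻ p in B, hWV.areaDensity τ k (T p) ∂psi k d := by
  have hSm := measurableSet_of_isSigmaCompact hS
  have := hWV.outerRegular_graphMeasure hτ hSm hinj
  set μ := hWV.graphMeasure τ S
  set N := toMeasurable (psi k d) {p ∈ S | upperDensity k d μ p ≠ hWV.areaDensity τ k (T p)}
  have hN : psi k d N = 0 := by
    rw [measure_toMeasurable]; exact hWV.psi_setOf_upperDensity_ne hτ hS hinj hT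
  have hD : ∀ p ∈ B \ N, upperDensity k d μ p = hWV.areaDensity τ k (T p) := fun p hp =>
    by_contra fun hne => hp.2 (subset_toMeasurable _ _ ⟨hBS hp.1, hne⟩)
  have hBN : MeasurableSet (B \ N) := hB.diff (measurableSet_toMeasurable _ _)
  have hμN : μ N = 0 :=
    hWV.graphMeasure_absolutelyContinuous hτ hSm hinj (fun p hp => ⟨_, hT p hp⟩) hN
  calc τ (hWV.proj '' B) = μ (B \ N) := by
        rw [measure_sdiff_null hμN, hWV.graphMeasure_apply hSm hinj, inter_eq_left.2 hBS]
    _ = ∫⁻ p in B \ N, upperDensity k d μ p ∂psi k d :=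
        measure_eq_setLIntegral_upperDensity hτ.nonneg hBN
          (fun p hp => by
            rw [hD p hp]; exact hWV.areaDensity_ne_zero hτ (hT p (hBS hp.1)).mem_complements)
          (fun p hp => by rw [hD p hp]; exact hWV.areaDensity_ne_top hτ)
    _ = ∫⁻ p in B \ N, hWV.areaDensity τ k (T p) ∂psi k d := setLIntegral_congr_fun hBN hD
    _ = ∫⁻ p in B, hWV.areaDensity τ k (T p) ∂psi k d :=
        setLIntegral_congr (sdiff_null_ae_eq_self hN)

theorem aemeasurable_areaDensity (hτ : IsHomogeneousHaar W d τ) (hS : IsSigmaCompact S)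
    (hinj : InjOn hWV.proj S) {T : G → Subgroup G} (hT : ∀ p ∈ S, HasTangent V S p (T p)) :
    AEMeasurable (fun p => hWV.areaDensity τ k (T p)) ((psi k d).restrict S) := by
  refine ⟨upperDensity k d (hWV.graphMeasure τ S), measurable_upperDensity k d _,
    EventuallyEq.symm ?_⟩
  rw [EventuallyEq, ae_restrict_iff' (measurableSet_of_isSigmaCompact hS), ae_iff]
  simpa only [Classical.not_imp] using hWV.psi_setOf_upperDensity_ne hτ hS hinj hT

theorem measure_eq_areaDensity_mul (hτ : IsHomogeneousHaar W d τ) {B : Set G}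
    (hB : MeasurableSet B) (hBW : B ⊆ W) : τ B = hWV.areaDensity τ k W * psi k d B := by
  have hW := hWV.left_mem_complements
  rw [← setLIntegral_const, ← hWV.measure_proj_image_eq_setLIntegral hτ
    (isSigmaCompact_univ.of_isClosed_subset hW.1.isClosed (subset_univ _))
    (hWV.complementary.injOn_fst hW.2) (fun p hp => hasTangent_self hW hp) hB hBW,
    hWV.proj_image_of_subset hBW]

theorem psi_proj_image (hτ : IsHomogeneousHaar W d τ) (hS : IsSigmaCompact S)
    (hinj : InjOn hWV.proj S) {T : G → Subgroup G} (hT : ∀ p ∈ S, HasTangent V S p (T p))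
    {B : Set G} (hB : MeasurableSet B) (hBS : B ⊆ S) :
    psi k d (hWV.proj '' B) = ∫⁻ p in B, (hWV.areaFactor τ k (T p) : ℝ≥0∞)⁻¹ ∂psi k d := by
  have h0 := hWV.areaDensity_ne_zero (k := k) hτ hWV.left_mem_complements
  have htop := hWV.areaDensity_ne_top (k := k) (P := W) hτ
  calc psi k d (hWV.proj '' B) = (hWV.areaDensity τ k W)⁻¹ * τ (hWV.proj '' B) := by
        rw [hWV.measure_eq_areaDensity_mul hτ (hWV.measurableSet_proj_image hinj hB hBS)
          (hWV.proj_image_subset B), ENNReal.inv_mul_cancel_left h0 htop]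
    _ = ∫⁻ p in B, (hWV.areaDensity τ k W)⁻¹ * hWV.areaDensity τ k (T p) ∂psi k d := by
        rw [lintegral_const_mul' _ _ (ENNReal.inv_ne_top.2 h0),
          hWV.measure_proj_image_eq_setLIntegral hτ hS hinj hT hB hBS]
    _ = ∫⁻ p in B, (hWV.areaFactor τ k (T p) : ℝ≥0∞)⁻¹ ∂psi k d :=
        setLIntegral_congr_fun hB fun p hp =>
          (hWV.inv_areaFactor hτ (hT p (hBS hp)).mem_complements).symm

theorem isAreaFactor (hτ : IsHomogeneousHaar W d τ) :
    IsAreaFactor k d W V (hWV.areaFactor τ k) := by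
  intro P φ h
  have hP := h.mem_complements hWV.complementary
  have hPc := hP.1.isClosed
  refine ⟨hWV.areaFactor_pos hτ hP, ?_⟩
  have hF : (hWV.areaFactor τ k P : ℝ≥0∞) ≠ 0 :=
    ENNReal.coe_ne_zero.2 (hWV.areaFactor_pos hτ hP).ne'
  have hval : MeasurableEmbedding (Subtype.val : W → G) :=
    MeasurableEmbedding.subtype_coe hWV.homogeneous_left.isClosed.measurableSet
  have hΦ : Measurable fun w : W => (w : G) * (φ w : G) := by
    simp only [h.mul_eq_fst hP.2]
    exact ((hP.2.continuous_fst hP.1 hWV.homogeneous_right).comp continuous_subtype_val).measurable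
  ext E hE
  have hproj := hWV.psi_proj_image (k := k) hτ
    (isSigmaCompact_univ.of_isClosed_subset hPc (subset_univ _))
    (hWV.complementary.injOn_fst hP.2) (fun p hp => hasTangent_self hP hp)
    (hE.inter hPc.measurableSet) inter_subset_right
  rw [setLIntegral_const, hWV.proj_image_inter h] at hproj
  rw [Measure.restrict_apply hE, Measure.smul_apply, smul_eq_mul, Measure.map_apply hΦ hE,
    hval.comap_apply, hproj, ENNReal.mul_inv_cancel_left hF ENNReal.coe_ne_top]

include hWV in
theorem measurableEmbedding_coe {A : Set W} (hA : MeasurableSet A) :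
    MeasurableEmbedding (fun w : A => ((w : W) : G)) :=
  (MeasurableEmbedding.subtype_coe hWV.homogeneous_left.isClosed.measurableSet).comp
    (MeasurableEmbedding.subtype_coe hA)

include hWV in
theorem measurable_toIntrinsicGraph {A : Set W} {φ : A → V} (hA : MeasurableSet A)
    (hS : MeasurableSet (intrinsicGraph φ)) : Measurable (toIntrinsicGraph φ) := fun B hB => by
  rw [← (hWV.measurableEmbedding_coe hA).measurableSet_image,
    hWV.coe_image_preimage_toIntrinsicGraph]
  exact hWV.measurableSet_proj_image (hWV.injOn_proj_intrinsicGraph φ)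
    ((MeasurableEmbedding.subtype_coe hS).measurableSet_image.2 hB)
    (Subtype.coe_image_subset (intrinsicGraph φ) B)

theorem map_comap_psi (hτ : IsHomogeneousHaar W d τ) {A : Set W} {φ : A → V}
    (hA : MeasurableSet A) (hφ : IsC1WV φ) :
    ((psi k d).comap (fun w : A => ((w : W) : G))).map (toIntrinsicGraph φ) =
      ((psi k d).comap (Subtype.val : intrinsicGraph φ → G)).withDensity fun p =>
        (hWV.areaFactor τ k (tangentSubgroup (intrinsicGraph φ) p) : ℝ≥0∞)⁻¹ := by
  have hS := measurableSet_of_isSigmaCompact hφ.1.isSigmaCompact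
  ext B hB
  rw [Measure.map_apply (hWV.measurable_toIntrinsicGraph hA hS) hB,
    (hWV.measurableEmbedding_coe hA).comap_apply, hWV.coe_image_preimage_toIntrinsicGraph,
    withDensity_apply _ hB,
    hWV.psi_proj_image hτ hφ.1.isSigmaCompact (hWV.injOn_proj_intrinsicGraph φ)
      (fun p hp => hWV.hasTangent_intrinsicGraph hφ hp)
      ((MeasurableEmbedding.subtype_coe hS).measurableSet_image.2 hB)
      (Subtype.coe_image_subset (intrinsicGraph φ) B)]
  exact (setLIntegral_subtype hS B fun p =>
    (hWV.areaFactor τ k (tangentSubgroup (intrinsicGraph φ) p) : ℝ≥0∞)⁻¹).symm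

theorem aemeasurable_areaFactor (hτ : IsHomogeneousHaar W d τ) {A : Set W} {φ : A → V}
    (hφ : IsC1WV φ) :
    AEMeasurable (fun p : intrinsicGraph φ =>
        (hWV.areaFactor τ k (tangentSubgroup (intrinsicGraph φ) p) : ℝ≥0∞))
      ((psi k d).comap Subtype.val) := by
  have hS := measurableSet_of_isSigmaCompact hφ.1.isSigmaCompact
  have hD := hWV.aemeasurable_areaDensity (k := k) hτ hφ.1.isSigmaCompact
    (hWV.injOn_proj_intrinsicGraph φ) fun p hp => hWV.hasTangent_intrinsicGraph hφ hp
  have hF : AEMeasurable (fun p =>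
      (hWV.areaFactor τ k (tangentSubgroup (intrinsicGraph φ) p) : ℝ≥0∞))
      ((psi k d).restrict (intrinsicGraph φ)) :=
    (hD.const_div _).ennreal_toNNReal.coe_nnreal_ennreal
  rw [← map_comap_subtype_coe hS] at hF
  exact hF.comp_measurable measurable_subtype_coe

theorem lintegral_intrinsicGraph (hτ : IsHomogeneousHaar W d τ) {A : Set W} {φ : A → V}
    (hA : MeasurableSet A) (hφ : IsC1WV φ) {h : intrinsicGraph φ → ℝ≥0∞} (hh : Measurable h) :
    ∫⁻ p, h p ∂(psi k d).comap (Subtype.val : intrinsicGraph φ → G) =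
      ∫⁻ w : A, h (toIntrinsicGraph φ w) *
        (hWV.areaFactor τ k (tangentSubgroup (intrinsicGraph φ) (graphMap φ w)) : ℝ≥0∞)
          ∂(psi k d).comap (fun w : A => ((w : W) : G)) := by
  set F : intrinsicGraph φ → ℝ≥0∞ := fun p =>
    (hWV.areaFactor τ k (tangentSubgroup (intrinsicGraph φ) p) : ℝ≥0∞)
  set ψ := (psi k d).comap (Subtype.val : intrinsicGraph φ → G)
  have hF : AEMeasurable F ψ := hWV.aemeasurable_areaFactor hτ hφ
  have hF0 (p : intrinsicGraph φ) : F p ≠ 0 := ENNReal.coe_ne_zero.2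
    (hWV.areaFactor_pos hτ (hWV.hasTangent_intrinsicGraph hφ p.2).mem_complements).ne'
  have hhF : AEMeasurable (fun p => h p * F p) (ψ.withDensity fun p => (F p)⁻¹) :=
    (hh.aemeasurable.mul hF).mono_ac (withDensity_absolutelyContinuous _ _)
  have hmap : _ = ψ.withDensity fun p => (F p)⁻¹ := hWV.map_comap_psi hτ hA hφ
  calc ∫⁻ p, h p ∂ψ = ∫⁻ p, (F p)⁻¹ * (h p * F p) ∂ψ := lintegral_congr fun p => by
        rw [mul_comm (h p), ENNReal.inv_mul_cancel_left (hF0 p) ENNReal.coe_ne_top]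
    _ = ∫⁻ p, h p * F p ∂ψ.withDensity fun p => (F p)⁻¹ :=
        (lintegral_withDensity_eq_lintegral_mul₀' hF.inv hhF).symm
    _ = ∫⁻ w, h (toIntrinsicGraph φ w) * F (toIntrinsicGraph φ w)
          ∂(psi k d).comap (fun w : A => ((w : W) : G)) := by
        rw [← hmap] at hhF ⊢
        exact lintegral_map' hhF (hWV.measurable_toIntrinsicGraph hA
          (measurableSet_of_isSigmaCompact hφ.1.isSigmaCompact)).aemeasurable

end IsSplitting

end AreaFormula

end Carnot

theorem theorem1p1 {G : Type*} [Carnot.CarnotGroup G] [MeasurableSpace G] [BorelSpace G]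
    (W V : Subgroup G) (hWV : Carnot.IsSplitting W V)
    (d : ℝ) (hd : Carnot.IsHomogeneousDimension W d) (k : Carnot.MeasureKind) :
    ∃ 𝒜 : Subgroup G → ℝ≥0,
      Carnot.IsAreaFactor k d W V 𝒜 ∧ Carnot.IsContinuousOnGraphs W V 𝒜 ∧
      ∀ (A : Set W) (φ : A → V), IsOpen A → Carnot.IsC1WV φ →
        ∀ h : Carnot.intrinsicGraph φ → ℝ≥0, Measurable h →
          ∫⁻ p, (h p : ℝ≥0∞) ∂((Carnot.psi k d).comap
              (Subtype.val : Carnot.intrinsicGraph φ → G)) =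
            ∫⁻ w : A, (h ⟨Carnot.graphMap φ w, mem_range_self w⟩ : ℝ≥0∞) *
                (𝒜 (Carnot.tangentSubgroup (Carnot.intrinsicGraph φ) (Carnot.graphMap φ w)) : ℝ≥0∞)
              ∂((Carnot.psi k d).comap (fun w : A => ((w : W) : G))) := by
  obtain ⟨τ, hτ⟩ := hWV.exists_isHomogeneousHaar hd
  exact ⟨hWV.areaFactor τ k, hWV.isAreaFactor hτ, hWV.isContinuousOnGraphs hτ,
    fun A φ hA hφ h hh =>
      hWV.lintegral_intrinsicGraph hτ hA.measurableSet hφ hh.coe_nnreal_ennreal⟩
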